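/- Fix a dimension $d\ge 1$. For a finite set $P\subset\mathbb{R}^d$ let $f(P,u)=\max_{p\in P}\langle u,p\rangle$ (with $f(\emptyset,u)=0$) and $\omega(P,u)=f(P,u)+f(P,-u)$, the directional width. If $\mathcal{P}$ is a set of uncertain points, let $\omega(\mathcal{P},u)=\mathbb{E}_{P\sim\mathcal{P}}[\omega(P,u)]$, where $P$ is a random realization of $\mathcal{P}$. A finite set $S\subset\mathbb{R}^d$ of deterministic points is an $\varepsilon$-exp-kernel of $\mathcal{P}$ if $(1-\varepsilon)\,\omega(\mathcal{P},u)\le\omega(S,u)\le\omega(\mathcal{P},u)$ for all $u\in\mathbb{R}^d$. Running times are measured on a real RAM: the four arithmetic operations and comparisons on real numbers, addition, subtraction and comparison of natural numbers used as indices and counters, and each memory access take one unit of time; there are no roots and no rounding, and the only real constants in a program are rational. (a) Existential model: $\mathcal{P}$ consists of $n\ge 1$ points of $\mathbb{R}^d$, the $i$-th of which is present, independently of the others, with probability $p_i\in[0,1]$. There are a real RAM program and a constant $C$, both depending only on $d$, such that for every $\varepsilon\in(0,1]$, every $n\ge1$ and every such $\mathcal{P}$, the program, given $\varepsilon$, $n$,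 the points and the probabilities, halts within $C\,\varepsilon^{-(d-1)}\,n\log(n+1)$ steps and returns at most $C\,\varepsilon^{-(d-1)/2}$ points that form an $\varepsilon$-exp-kernel of $\mathcal{P}$. (b) Locational model: $\mathcal{P}$ consists of $n$ points with independent random locations in $\mathbb{R}^d$; there are $m\ge 1$ possible locations in total, each being a possible location of exactly one of the points, and for each point the probabilities of its locations are nonnegative and sum to $1$. There are a real RAM program and a constant $C$, both depending only on $d$, such that for every $\varepsilon\in(0,1]$ and every such $\mathcal{P}$, the program, given $\varepsilon$, $m$, $n$, and the coordinates, the probability and the point of every location, halts within $C\,\varepsilon^{-(d-1)}\,m\log(m+1)$ steps and returns at most $C\,\varepsilon^{-(d-1)/2}$ points that form an $\varepsilon$-exp-kernel of $\mathcal{P}$. -/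

import Mathlib

open scoped BigOperators

noncomputable section

namespace UncertainKernel

/-! ### Support functions and directional widths of finite point sets -/

/-- Points (and directions) of Euclidean `d`-space. -/
abbrev Pt (d : ℕ) : Type := EuclideanSpace ℝ (Fin d)

/-- The support function `f(P, u) = max_{p ∈ P} ⟨u, p⟩` of a finite set `P`.
A realization of uncertain points may be empty; it contributes `0`. -/
def supportFn {d : ℕ} (P : Finset (Pt d)) (u : Pt d) : ℝ :=
  if h : P.Nonempty then P.sup' h (fun p => inner ℝ u p) else 0

/-- The directional width `ω(P, u) = f(P, u) + f(P, -u)`. -/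
def dirWidth {d : ℕ} (P : Finset (Pt d)) (u : Pt d) : ℝ :=
  supportFn P u + supportFn P (-u)

/-! ### The two models of uncertain points -/

/-- `n` existentially uncertain points in `ℝ^d`: the `i`-th point sits at `loc i` and is present,
independently of the others, with probability `prob i`. -/
structure Existential (d n : ℕ) where
  loc : Fin n → Pt d
  prob : Fin n → ℝ
  prob_nonneg : ∀ i, 0 ≤ prob i
  prob_le_one : ∀ i, prob i ≤ 1

/-- The probability that exactly the points with index in `A` are present. -/
def Existential.realizationProb {d n : ℕ} (P : Existential d n) (A : Finset (Fin n)) : ℝ :=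
  (∏ i ∈ A, P.prob i) * ∏ i ∈ Aᶜ, (1 - P.prob i)

open Classical in
/-- The expected directional width of existentially uncertain points. -/
def Existential.expWidth {d n : ℕ} (P : Existential d n) (u : Pt d) : ℝ :=
  ∑ A : Finset (Fin n), P.realizationProb A * dirWidth (A.image P.loc) u

/-- `n` locationally uncertain points in `ℝ^d` with `m` possible locations altogether. Location `s`
is a possible location of the point `owner s` only, and that point is there with probability
`prob s`. Every point has exactly one location, and distinct points are independent. -/
structure Locational (d n m : ℕ) where
  loc : Fin m → Pt d
  owner : Fin m → Fin n
  prob : Fin m → ℝ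
  prob_nonneg : ∀ s, 0 ≤ prob s
  sum_prob : ∀ v, ∑ s with owner s = v, prob s = 1

/-- The probability that every point `v` is realized at the location with index `c v`. -/
def Locational.realizationProb {d n m : ℕ} (P : Locational d n m) (c : Fin n → Fin m) : ℝ :=
  ∏ v, if P.owner (c v) = v then P.prob (c v) else 0

open Classical in
/-- The expected directional width of locationally uncertain points. -/
def Locational.expWidth {d n m : ℕ} (P : Locational d n m) (u : Pt d) : ℝ :=
  ∑ c : Fin n → Fin m,
    P.realizationProb c * dirWidth (Finset.univ.image fun v => P.loc (c v)) u

/-- The finite set `S` of deterministic points is an `ε`-exp-kernel for uncertain points whose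
expected directional width function is `w`. -/
def IsExpKernel {d : ℕ} (ε : ℝ) (w : Pt d → ℝ) (S : Finset (Pt d)) : Prop :=
  ∀ u : Pt d, (1 - ε) * w u ≤ dirWidth S u ∧ dirWidth S u ≤ w u

/-! ### The real RAM

Programs of a random access machine with natural number and real number variables and arrays,
written in a structured imperative language. Real numbers can be added, subtracted, multiplied,
divided and compared; there are no roots, no rounding, and no way to turn a real number into an
index. Natural numbers (indices and counters) can be added, subtracted and compared.
Every such operation and every memory access takes one step. -/

/-- The memory: variables and arrays are named by natural numbers, array cells are addressed by
natural numbers. A program mentions only finitely many variables and arrays. -/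
structure Store where
  natVar : ℕ → ℕ
  realVar : ℕ → ℝ
  natArr : ℕ → ℕ → ℕ
  realArr : ℕ → ℕ → ℝ

/-- Expressions with natural number values. -/
inductive NExp where
  | const (k : ℕ)
  | var (x : ℕ)
  | arr (a : ℕ) (i : NExp)
  | add (e f : NExp)
  | sub (e f : NExp)

/-- Expressions with real values. The only constants are rational. -/
inductive RExp where
  | const (q : ℚ)
  | var (x : ℕ)
  | arr (a : ℕ) (i : NExp)
  | ofNat (e : NExp)
  | add (e f : RExp)
  | sub (e f : RExp)
  | mul (e f : RExp)
  | div (e f : RExp)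

/-- Tests. -/
inductive BExp where
  | natLt (e f : NExp)
  | realLt (e f : RExp)
  | neg (b : BExp)
  | conj (b c : BExp)

/-- Programs. -/
inductive Prog where
  | skip
  | setNat (x : ℕ) (e : NExp)
  | setReal (x : ℕ) (e : RExp)
  | setNatArr (a : ℕ) (i : NExp) (e : NExp)
  | setRealArr (a : ℕ) (i : NExp) (e : RExp)
  | seq (p q : Prog)
  | cond (b : BExp) (p q : Prog)
  | loop (b : BExp) (p : Prog)

/-- The value of an expression; subtraction of natural numbers is truncated at `0`. -/
def NExp.val (s : Store) : NExp → ℕ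
  | const k => k
  | var x => s.natVar x
  | arr a i => s.natArr a (i.val s)
  | add e f => e.val s + f.val s
  | sub e f => e.val s - f.val s

/-- The number of steps needed to evaluate an expression: one for each node. -/
def NExp.cost : NExp → ℕ
  | const _ => 1
  | var _ => 1
  | arr _ i => i.cost + 1
  | add e f => e.cost + f.cost + 1
  | sub e f => e.cost + f.cost + 1

/-- The value of an expression; a quotient with denominator `0` has the value `0`. -/
def RExp.val (s : Store) : RExp → ℝ
  | const q => (q : ℝ)
  | var x => s.realVar x
  | arr a i => s.realArr a (i.val s)
  | ofNat e => (e.val s : ℝ)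
  | add e f => e.val s + f.val s
  | sub e f => e.val s - f.val s
  | mul e f => e.val s * f.val s
  | div e f => e.val s / f.val s

/-- The number of steps needed to evaluate an expression: one for each node. -/
def RExp.cost : RExp → ℕ
  | const _ => 1
  | var _ => 1
  | arr _ i => i.cost + 1
  | ofNat e => e.cost + 1
  | add e f => e.cost + f.cost + 1
  | sub e f => e.cost + f.cost + 1
  | mul e f => e.cost + f.cost + 1
  | div e f => e.cost + f.cost + 1

/-- The truth of a test. -/
def BExp.holds (s : Store) : BExp → Prop
  | natLt e f => e.val s < f.val s
  | realLt e f => e.val s < f.val s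
  | neg b => ¬ b.holds s
  | conj b c => b.holds s ∧ c.holds s

/-- The number of steps needed to evaluate a test: one for each node. -/
def BExp.cost : BExp → ℕ
  | natLt e f => e.cost + f.cost + 1
  | realLt e f => e.cost + f.cost + 1
  | neg b => b.cost + 1
  | conj b c => b.cost + c.cost + 1

def Store.setNat (s : Store) (x k : ℕ) : Store :=
  { s with natVar := Function.update s.natVar x k }

def Store.setReal (s : Store) (x : ℕ) (r : ℝ) : Store :=
  { s with realVar := Function.update s.realVar x r }

def Store.setNatArr (s : Store) (a i k : ℕ) : Store :=
  { s with natArr := Function.update s.natArr a (Function.update (s.natArr a) i k) }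

def Store.setRealArr (s : Store) (a i : ℕ) (r : ℝ) : Store :=
  { s with realArr := Function.update s.realArr a (Function.update (s.realArr a) i r) }

/-- `Runs p s t s'`: the program `p`, started with the memory `s`, halts after exactly `t` steps
with the memory `s'`. -/
inductive Runs : Prog → Store → ℕ → Store → Prop
  | skip (s : Store) : Runs .skip s 1 s
  | setNat (s : Store) (x : ℕ) (e : NExp) :
      Runs (.setNat x e) s (e.cost + 1) (s.setNat x (e.val s))
  | setReal (s : Store) (x : ℕ) (e : RExp) :
      Runs (.setReal x e) s (e.cost + 1) (s.setReal x (e.val s))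
  | setNatArr (s : Store) (a : ℕ) (i e : NExp) :
      Runs (.setNatArr a i e) s (i.cost + e.cost + 1) (s.setNatArr a (i.val s) (e.val s))
  | setRealArr (s : Store) (a : ℕ) (i : NExp) (e : RExp) :
      Runs (.setRealArr a i e) s (i.cost + e.cost + 1) (s.setRealArr a (i.val s) (e.val s))
  | seq {p q : Prog} {s s₁ s₂ : Store} {t₁ t₂ : ℕ}
      (hp : Runs p s t₁ s₁) (hq : Runs q s₁ t₂ s₂) : Runs (.seq p q) s (t₁ + t₂) s₂
  | condTrue {b : BExp} {p q : Prog} {s s₁ : Store} {t : ℕ}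
      (hb : b.holds s) (hp : Runs p s t s₁) : Runs (.cond b p q) s (b.cost + 1 + t) s₁
  | condFalse {b : BExp} {p q : Prog} {s s₁ : Store} {t : ℕ}
      (hb : ¬ b.holds s) (hq : Runs q s t s₁) : Runs (.cond b p q) s (b.cost + 1 + t) s₁
  | loopDone {b : BExp} {p : Prog} {s : Store}
      (hb : ¬ b.holds s) : Runs (.loop b p) s (b.cost + 1) s
  | loopStep {b : BExp} {p : Prog} {s s₁ s₂ : Store} {t₁ t₂ : ℕ}
      (hb : b.holds s) (hp : Runs p s t₁ s₁) (hl : Runs (.loop b p) s₁ t₂ s₂) :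
      Runs (.loop b p) s (b.cost + 1 + t₁ + t₂) s₂

/-! ### Input and output conventions -/

/-- The array that holds the values of `f`, and `0` in all further cells. -/
def cells {α : Type} [Zero α] {k : ℕ} (f : Fin k → α) (i : ℕ) : α :=
  if h : i < k then f ⟨i, h⟩ else 0

/-- The array that holds `k` points of `ℝ^d`, coordinate `j` of the `i`-th one in cell
`i * d + j`, and `0` in all further cells. -/
def pointCells {d k : ℕ} (pts : Fin k → Pt d) (i : ℕ) : ℝ :=
  if h : i < k * d then pts (Fin.divNat ⟨i, h⟩) (Fin.modNat ⟨i, h⟩) else 0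

/-- The initial memory for existentially uncertain points: natural number variable `0` holds `n`,
real variable `0` holds `ε`, real array `0` the locations, real array `1` the probabilities;
everything else is `0`. -/
def Existential.input {d n : ℕ} (P : Existential d n) (ε : ℝ) : Store where
  natVar x := if x = 0 then n else 0
  realVar x := if x = 0 then ε else 0
  natArr _ _ := 0
  realArr a := if a = 0 then pointCells P.loc else if a = 1 then cells P.prob else 0

/-- The initial memory for locationally uncertain points: natural number variables `0` and `1` hold
`m` and `n`, real variable `0` holds `ε`, real array `0` the locations, real array `1` their
probabilities, natural number array `0` the indices of the points that they belong to; everything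
else is `0`. -/
def Locational.input {d n m : ℕ} (P : Locational d n m) (ε : ℝ) : Store where
  natVar x := if x = 0 then m else if x = 1 then n else 0
  realVar x := if x = 0 then ε else 0
  natArr a := if a = 0 then cells (fun s => (P.owner s : ℕ)) else 0
  realArr a := if a = 0 then pointCells P.loc else if a = 1 then cells P.prob else 0

/-- The number of points that a program returns: natural number variable `0`. -/
def Store.outputSize (s : Store) : ℕ := s.natVar 0

open Classical in
/-- The points that a program returns: real array `0` holds coordinate `j` of the `l`-th one in
cell `l * d + j`. -/
def Store.output (d : ℕ) (s : Store) : Finset (Pt d) :=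
  (Finset.range s.outputSize).image fun l =>
    WithLp.toLp 2 fun j : Fin d => s.realArr 0 (l * d + j)

/-- Started with the memory `s`, the program `prog` halts within `time` steps and returns at most
`size` points, which form an `ε`-exp-kernel for the expected directional width `w`. -/
def ComputesExpKernel {d : ℕ} (prog : Prog) (s : Store) (ε : ℝ) (w : Pt d → ℝ)
    (size time : ℝ) : Prop :=
  ∃ (t : ℕ) (s' : Store), Runs prog s t s' ∧ (t : ℝ) ≤ time ∧
    (s'.outputSize : ℝ) ≤ size ∧ IsExpKernel ε w (s'.output d)

end UncertainKernel

end

/-!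
Both models are instances of `Model`: a random set of locations whose expected support function `H`
is the support function of a convex body, the expected polytope, and the expected width is the width
of this body. So the task is to choose points of the body whose convex hull approximates its width,
knowing the body only through its extreme points.

*Extreme points.* Sort the locations by descending values of `⟨u, ·⟩`. In every realization, the
first location that is present is a farthest point, so its expectation is an extreme point of the
body in direction `u` (`isExtreme_expSupport`). The probability that the first `k` locations are all
absent is a product over the uncertain points (`survival`), which is updated in constant time per
location; with heap sort, an extreme point costs `O(m log m)` steps (`exists_exec_findExtreme`).

*An adapted basis.* Gauss-Jordan elimination, the pivot vector in each step being the difference of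
the two extreme points in directions `± u k`, produces a basis such that the width of the body in
every basis direction is bounded by a constant, while the coordinates of a direction `v` are bounded
by the width in direction `v` (`IsFat`). Directions of width `0` are carried along, so that flat
bodies need no separate treatment.

*The grid.* Up to scaling, the coordinates of a direction form a point on the boundary of the cube
`[-1, 1] ^ d`. With `d = e + 1` and `N` of the order of `1 / √ε`, every face of the cube carries a
grid of `(2 * N ^ 2) ^ e = O(ε ^ (-e))` directions of resolution `1 / N ^ 2`, grouped into cells of
side length `1 / N`. An extreme point is computed for each of them, but it is added to the output
only if no point that was output for the same cell is within `1 / N` of it in all coordinates. Inside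
a cell, both the directions and the points then vary by at most `1 / N`, so that the error is of
second order, `O(1 / N ^ 2)` times the width (`exists_near_extreme`).

*The size.* Extreme points depend monotonically on the direction: `⟨x - y, p - q⟩ ≥ 0` if `p` and `q`
are extreme for `x` and `y`. Therefore, the sum `x + p` determines both the direction and the point up
to the change of the sum (`sq_add_sq_le_of_isExtreme`). The sums lie in a bounded region, the output
points of a cell are `1 / N` apart, and the cells have side length `1 / N`, so there are
`O(N ^ e) = O(ε ^ (-e / 2))` output points (`card_le_of_separated`). The same bound pays for the
comparisons with earlier output points (`exists_runs_visitCell`).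

The program keeps its working data in fixed variables and arrays: the locations are moved to real
array `8`, because array `0` receives the output; array `6` holds the basis, array `4` the current
direction and array `5` the extreme point that belongs to it; natural number variables `2` and `3`
hold `N` and the number of output points. All other cells are scratch space of single subprograms.
-/


open scoped BigOperators

noncomputable section

namespace UncertainKernel

/-! ### A calculus for real RAM programs -/

/-- `Exec p s T Q`: started with the memory `s`, the program `p` halts within `T` steps with a
memory that satisfies `Q`. -/
def Exec (p : Prog) (s : Store) (T : ℕ) (Q : Store → Prop) : Prop :=
  ∃ t s', Runs p s t s' ∧ t ≤ T ∧ Q s'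

theorem Exec.mono {p : Prog} {s : Store} {T T' : ℕ} {Q Q' : Store → Prop}
    (h : Exec p s T Q) (hT : T ≤ T') (hQ : ∀ s', Q s' → Q' s') : Exec p s T' Q' := by
  obtain ⟨t, s', h1, h2, h3⟩ := h
  exact ⟨t, s', h1, h2.trans hT, hQ _ h3⟩

theorem Exec.skip {s : Store} {Q : Store → Prop} (h : Q s) : Exec .skip s 1 Q :=
  ⟨_, _, .skip s, le_rfl, h⟩

theorem Exec.setNat {s : Store} {x : ℕ} {e : NExp} {Q : Store → Prop}
    (h : Q (s.setNat x (e.val s))) : Exec (.setNat x e) s (e.cost + 1) Q :=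
  ⟨_, _, .setNat s x e, le_rfl, h⟩

theorem Exec.setReal {s : Store} {x : ℕ} {e : RExp} {Q : Store → Prop}
    (h : Q (s.setReal x (e.val s))) : Exec (.setReal x e) s (e.cost + 1) Q :=
  ⟨_, _, .setReal s x e, le_rfl, h⟩

theorem Exec.setNatArr {s : Store} {a : ℕ} {i e : NExp} {Q : Store → Prop}
    (h : Q (s.setNatArr a (i.val s) (e.val s))) :
    Exec (.setNatArr a i e) s (i.cost + e.cost + 1) Q :=
  ⟨_, _, .setNatArr s a i e, le_rfl, h⟩

theorem Exec.setRealArr {s : Store} {a : ℕ} {i : NExp} {e : RExp} {Q : Store → Prop}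
    (h : Q (s.setRealArr a (i.val s) (e.val s))) :
    Exec (.setRealArr a i e) s (i.cost + e.cost + 1) Q :=
  ⟨_, _, .setRealArr s a i e, le_rfl, h⟩

theorem Exec.seq {p q : Prog} {s : Store} {T₁ T₂ : ℕ} {Q : Store → Prop}
    (h : Exec p s T₁ (fun s₁ => Exec q s₁ T₂ Q)) : Exec (.seq p q) s (T₁ + T₂) Q := by
  obtain ⟨t, s₁, h1, h2, t', s₂, h3, h4, h5⟩ := h
  exact ⟨_, _, .seq h1 h3, add_le_add h2 h4, h5⟩

theorem Exec.cond {b : BExp} {p q : Prog} {s : Store} {T : ℕ} {Q : Store → Prop}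
    (hp : b.holds s → Exec p s T Q) (hq : ¬ b.holds s → Exec q s T Q) :
    Exec (.cond b p q) s (b.cost + 1 + T) Q := by
  by_cases hb : b.holds s
  · obtain ⟨t, s', h1, h2, h3⟩ := hp hb
    exact ⟨_, _, .condTrue hb h1, by omega, h3⟩
  · obtain ⟨t, s', h1, h2, h3⟩ := hq hb
    exact ⟨_, _, .condFalse hb h1, by omega, h3⟩

theorem Exec.loopDone {b : BExp} {p : Prog} {s : Store} {Q : Store → Prop}
    (hb : ¬ b.holds s) (h : Q s) : Exec (.loop b p) s (b.cost + 1) Q :=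
  ⟨_, _, .loopDone hb, le_rfl, h⟩

theorem Exec.loopStep {b : BExp} {p : Prog} {s : Store} {T₁ T₂ : ℕ} {Q : Store → Prop}
    (hb : b.holds s) (h : Exec p s T₁ (fun s₁ => Exec (.loop b p) s₁ T₂ Q)) :
    Exec (.loop b p) s (b.cost + 1 + T₁ + T₂) Q := by
  obtain ⟨t, s₁, h1, h2, t', s₂, h3, h4, h5⟩ := h
  exact ⟨_, _, .loopStep hb h1 h3, by omega, h5⟩

/-- A loop whose body decreases the measure `μ` makes at most `μ s` iterations. -/
theorem Exec.loop {b : BExp} {p : Prog} {T : ℕ} (Inv : Store → Prop) (μ : Store → ℕ)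
    (hstep : ∀ s, Inv s → b.holds s → Exec p s T (fun s' => Inv s' ∧ μ s' < μ s)) :
    ∀ {s : Store}, Inv s →
      Exec (.loop b p) s (μ s * (T + b.cost + 1) + b.cost + 1)
        (fun s' => Inv s' ∧ ¬ b.holds s') := by
  suffices H : ∀ n s, μ s ≤ n → Inv s →
      Exec (.loop b p) s (n * (T + b.cost + 1) + b.cost + 1)
        (fun s' => Inv s' ∧ ¬ b.holds s') from fun {s} h => H _ s le_rfl h
  intro n
  induction n with
  | zero =>
    intro s hn hs
    by_cases hb : b.holds s
    · obtain ⟨_, _, _, _, _, h⟩ := hstep s hs hb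
      omega
    · exact (Exec.loopDone hb ⟨hs, hb⟩).mono (by omega) fun _ h => h
  | succ n ih =>
    intro s hn hs
    by_cases hb : b.holds s
    · refine (Exec.loopStep hb ((hstep s hs hb).mono le_rfl fun s' h =>
        ih s' (by omega) h.1)).mono ?_ fun _ h => h
      have : (n + 1) * (T + b.cost + 1) = n * (T + b.cost + 1) + (T + b.cost + 1) := by ring
      omega
    · exact (Exec.loopDone hb ⟨hs, hb⟩).mono (by omega) fun _ h => h

/-! ### The memory cells that a program may change -/

/-- The memories agree outside of the variables and arrays listed in `W`. The pairs `(0, x)`,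
`(1, x)`, `(2, a)`, `(3, a)` stand for natural number and real variables and natural number and
real arrays. -/
structure Frame (W : List (ℕ × ℕ)) (s s' : Store) : Prop where
  nv : ∀ {x}, (0, x) ∉ W → s'.natVar x = s.natVar x
  rv : ∀ {x}, (1, x) ∉ W → s'.realVar x = s.realVar x
  na : ∀ {x}, (2, x) ∉ W → s'.natArr x = s.natArr x
  ra : ∀ {x}, (3, x) ∉ W → s'.realArr x = s.realArr x

theorem Frame.refl (W : List (ℕ × ℕ)) (s : Store) : Frame W s s :=
  ⟨fun _ => rfl, fun _ => rfl, fun _ => rfl, fun _ => rfl⟩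

theorem Frame.trans {W : List (ℕ × ℕ)} {s s' s'' : Store} (h : Frame W s s')
    (h' : Frame W s' s'') : Frame W s s'' :=
  ⟨fun hx => (h'.nv hx).trans (h.nv hx), fun hx => (h'.rv hx).trans (h.rv hx),
    fun hx => (h'.na hx).trans (h.na hx), fun hx => (h'.ra hx).trans (h.ra hx)⟩

theorem Frame.mono {W W' : List (ℕ × ℕ)} {s s' : Store} (h : Frame W s s') (hW : W ⊆ W') :
    Frame W' s s' :=
  ⟨fun hx => h.nv fun h' => hx (hW h'), fun hx => h.rv fun h' => hx (hW h'),
    fun hx => h.na fun h' => hx (hW h'), fun hx => h.ra fun h' => hx (hW h')⟩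

/-- All assignments in the program are to cells listed in `W`. -/
def Prog.WritesIn (W : List (ℕ × ℕ)) : Prog → Prop
  | skip => True
  | setNat x _ => (0, x) ∈ W
  | setReal x _ => (1, x) ∈ W
  | setNatArr a _ _ => (2, a) ∈ W
  | setRealArr a _ _ => (3, a) ∈ W
  | seq p q => p.WritesIn W ∧ q.WritesIn W
  | cond _ p q => p.WritesIn W ∧ q.WritesIn W
  | loop _ p => p.WritesIn W

theorem Prog.WritesIn.mono {W W' : List (ℕ × ℕ)} (hW : W ⊆ W') :
    ∀ {p : Prog}, p.WritesIn W → p.WritesIn W'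
  | .skip, _ => trivial
  | .setNat _ _, h => hW h
  | .setReal _ _, h => hW h
  | .setNatArr _ _ _, h => hW h
  | .setRealArr _ _ _, h => hW h
  | .seq _ _, h => ⟨h.1.mono hW, h.2.mono hW⟩
  | .cond _ _ _, h => ⟨h.1.mono hW, h.2.mono hW⟩
  | .loop _ p, h => Prog.WritesIn.mono (p := p) hW h

theorem frame_setNat {W : List (ℕ × ℕ)} {x : ℕ} (h : (0, x) ∈ W) (s : Store) (k : ℕ) :
    Frame W s (s.setNat x k) :=
  ⟨fun {y} hy => Function.update_of_ne (by rintro rfl; exact hy h) _ _, fun _ => rfl,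
    fun _ => rfl, fun _ => rfl⟩

theorem frame_setNatArr {W : List (ℕ × ℕ)} {x : ℕ} (h : (2, x) ∈ W) (s : Store) (i k : ℕ) :
    Frame W s (s.setNatArr x i k) :=
  ⟨fun _ => rfl, fun _ => rfl,
    fun {y} hy => Function.update_of_ne (by rintro rfl; exact hy h) _ _, fun _ => rfl⟩

theorem Runs.frame {W : List (ℕ × ℕ)} {p : Prog} {s s' : Store} {t : ℕ} (h : Runs p s t s')
    (hW : p.WritesIn W) : Frame W s s' := by
  induction h with
  | skip => exact Frame.refl _ _
  | setNat s x e => exact frame_setNat hW _ _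
  | setReal s x e =>
    exact ⟨fun _ => rfl, fun {y} hy => Function.update_of_ne (by rintro rfl; exact hy hW) _ _,
      fun _ => rfl, fun _ => rfl⟩
  | setNatArr s a i e => exact frame_setNatArr hW _ _ _
  | setRealArr s a i e =>
    exact ⟨fun _ => rfl, fun _ => rfl, fun _ => rfl,
      fun {y} hy => Function.update_of_ne (by rintro rfl; exact hy hW) _ _⟩
  | seq _ _ ih₁ ih₂ => exact (ih₁ hW.1).trans (ih₂ hW.2)
  | condTrue _ _ ih => exact ih hW.1
  | condFalse _ _ ih => exact ih hW.2
  | loopDone => exact Frame.refl _ _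
  | loopStep _ _ _ ih₁ ih₂ => exact (ih₁ hW).trans (ih₂ hW)

theorem Exec.frame {W : List (ℕ × ℕ)} {p : Prog} {s : Store} {T : ℕ} {Q : Store → Prop}
    (h : Exec p s T Q) (hW : p.WritesIn W) : Exec p s T (fun s' => Q s' ∧ Frame W s s') := by
  obtain ⟨t, s', h1, h2, h3⟩ := h
  exact ⟨t, s', h1, h2, h3, h1.frame hW⟩

/-- Natural number expressions do not read real variables and arrays. -/
theorem NExp.val_congr {s s' : Store} (hv : s'.natVar = s.natVar) (ha : s'.natArr = s.natArr) :
    ∀ e : NExp, e.val s' = e.val s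
  | .const _ => rfl
  | .var x => congrFun hv x
  | .arr a i => by simp only [NExp.val, ha, NExp.val_congr hv ha i]
  | .add e f => by simp only [NExp.val, NExp.val_congr hv ha e, NExp.val_congr hv ha f]
  | .sub e f => by simp only [NExp.val, NExp.val_congr hv ha e, NExp.val_congr hv ha f]

@[simp] theorem Store.setNat_natVar (s : Store) (x k y : ℕ) :
    (s.setNat x k).natVar y = if y = x then k else s.natVar y := by
  simp [Store.setNat, Function.update_apply]
@[simp] theorem Store.setNat_realVar (s : Store) (x k : ℕ) :
    (s.setNat x k).realVar = s.realVar := rfl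
@[simp] theorem Store.setNat_natArr (s : Store) (x k : ℕ) :
    (s.setNat x k).natArr = s.natArr := rfl
@[simp] theorem Store.setNat_realArr (s : Store) (x k : ℕ) :
    (s.setNat x k).realArr = s.realArr := rfl
@[simp] theorem Store.setReal_natVar (s : Store) (x : ℕ) (r : ℝ) :
    (s.setReal x r).natVar = s.natVar := rfl
@[simp] theorem Store.setReal_realVar (s : Store) (x : ℕ) (r : ℝ) (y : ℕ) :
    (s.setReal x r).realVar y = if y = x then r else s.realVar y := by
  simp [Store.setReal, Function.update_apply]
@[simp] theorem Store.setReal_natArr (s : Store) (x : ℕ) (r : ℝ) :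
    (s.setReal x r).natArr = s.natArr := rfl
@[simp] theorem Store.setReal_realArr (s : Store) (x : ℕ) (r : ℝ) :
    (s.setReal x r).realArr = s.realArr := rfl
@[simp] theorem Store.setNatArr_natVar (s : Store) (a i k : ℕ) :
    (s.setNatArr a i k).natVar = s.natVar := rfl
@[simp] theorem Store.setNatArr_natArr (s : Store) (a i k b : ℕ) :
    (s.setNatArr a i k).natArr b =
      if b = a then Function.update (s.natArr a) i k else s.natArr b := by
  simp [Store.setNatArr, Function.update_apply]
@[simp] theorem Store.setNatArr_realArr (s : Store) (a i k : ℕ) :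
    (s.setNatArr a i k).realArr = s.realArr := rfl
@[simp] theorem Store.setRealArr_natVar (s : Store) (a i : ℕ) (r : ℝ) :
    (s.setRealArr a i r).natVar = s.natVar := rfl
@[simp] theorem Store.setRealArr_realVar (s : Store) (a i : ℕ) (r : ℝ) :
    (s.setRealArr a i r).realVar = s.realVar := rfl
@[simp] theorem Store.setRealArr_natArr (s : Store) (a i : ℕ) (r : ℝ) :
    (s.setRealArr a i r).natArr = s.natArr := rfl
@[simp] theorem Store.setRealArr_realArr (s : Store) (a i : ℕ) (r : ℝ) (b : ℕ) :
    (s.setRealArr a i r).realArr b =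
      if b = a then Function.update (s.realArr a) i r else s.realArr b := by
  simp [Store.setRealArr, Function.update_apply]

/-! ### Derived instructions -/

/-- The multiple `k • e`, by repeated addition. -/
def NExp.mulc : ℕ → NExp → NExp
  | 0, _ => .const 0
  | k + 1, e => .add (mulc k e) e

@[simp] theorem NExp.val_mulc (s : Store) (k : ℕ) (e : NExp) :
    (NExp.mulc k e).val s = e.val s * k := by
  induction k with
  | zero => simp [NExp.mulc, NExp.val]
  | succ k ih => simp [NExp.mulc, NExp.val, ih, mul_add]

/-- The sum of the expressions `f 0, …, f (n - 1)`. -/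
def RExp.sum : (n : ℕ) → (Fin n → RExp) → RExp
  | 0, _ => .const 0
  | n + 1, f => .add (RExp.sum n fun j => f j.castSucc) (f (Fin.last n))

@[simp] theorem RExp.val_sum (s : Store) (n : ℕ) (f : Fin n → RExp) :
    (RExp.sum n f).val s = ∑ j, (f j).val s := by
  induction n with
  | zero => simp [RExp.sum, RExp.val]
  | succ n ih => simp [RExp.sum, RExp.val, ih, Fin.sum_univ_castSucc]

/-- The conjunction of the tests `f 0, …, f (n - 1)`. -/
def BExp.all : (n : ℕ) → (Fin n → BExp) → BExp
  | 0, _ => .natLt (.const 0) (.const 1)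
  | n + 1, f => .conj (BExp.all n fun j => f j.castSucc) (f (Fin.last n))

@[simp] theorem BExp.holds_all (s : Store) (n : ℕ) (f : Fin n → BExp) :
    (BExp.all n f).holds s ↔ ∀ j, (f j).holds s := by
  induction n with
  | zero => simp [BExp.all, BExp.holds, NExp.val]
  | succ n ih => simp [BExp.all, BExp.holds, ih, Fin.forall_fin_succ']

/-- Set the cells `b, …, b + k - 1` of the real array `a` to `f 0, …, f (k - 1)`. -/
def setCells (a : ℕ) (b : NExp) : ℕ → (ℕ → RExp) → Prog
  | 0, _ => .skip
  | k + 1, f => .seq (setCells a b k f) (.setRealArr a (.add b (.const k)) (f k))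

/-- The running time of `setCells`. -/
def setCellsTime (b : NExp) : ℕ → (ℕ → RExp) → ℕ
  | 0, _ => 1
  | k + 1, f => setCellsTime b k f + (b.cost + 3 + (f k).cost)

@[simp] theorem writesIn_setCells {W : List (ℕ × ℕ)} {a : ℕ} {b : NExp} {k : ℕ} {f : ℕ → RExp}
    (h : (3, a) ∈ W) : (setCells a b k f).WritesIn W := by
  induction k with
  | zero => trivial
  | succ k ih => exact ⟨ih, h⟩

/-- The expression `f j` may read the cell that it is assigned to, and all later ones, but none of
the cells that are overwritten before. -/
theorem exec_setCells (a : ℕ) (b : NExp) (k : ℕ) (f : ℕ → RExp) (s : Store) (β : ℕ)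
    (hβ : b.val s = β)
    (hf : ∀ j < k, ∀ s', Frame [(3, a)] s s' →
      (∀ i, i < β ∨ β + j ≤ i → s'.realArr a i = s.realArr a i) → (f j).val s' = (f j).val s) :
    Exec (setCells a b k f) s (setCellsTime b k f) (fun s' =>
      Frame [(3, a)] s s' ∧ (∀ j < k, s'.realArr a (β + j) = (f j).val s) ∧
      (∀ i, i < β ∨ β + k ≤ i → s'.realArr a i = s.realArr a i)) := by
  induction k with
  | zero => exact Exec.skip ⟨Frame.refl _ _, by simp, fun _ _ => rfl⟩
  | succ k ih =>
    refine (Exec.seq ((ih fun j hj => hf j (by omega)).mono le_rfl fun s' h =>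
      Exec.setRealArr ?_)).mono (by simp [setCellsTime, NExp.cost]) fun _ h => h
    obtain ⟨h1, h2, h3⟩ := h
    have hb : b.val s' = β := by
      rw [← hβ]
      exact NExp.val_congr (funext fun x => h1.nv (by simp)) (funext fun x => h1.na (by simp)) b
    have hk := hf k (by omega) s' h1 h3
    refine ⟨h1.trans ⟨fun _ => rfl, fun _ => rfl, fun _ => rfl, fun {x} hx => ?_⟩, ?_, ?_⟩
    · simp at hx ⊢
      intro h; exact absurd h hx
    · intro j hj
      simp only [NExp.val, hb, Store.setRealArr_realArr, if_true, Function.update_apply, hk]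
      rcases Nat.lt_succ_iff_lt_or_eq.1 hj with h | rfl
      · rw [if_neg (by omega), h2 j h]
      · simp
    · intro i hi
      simp only [NExp.val, hb, Store.setRealArr_realArr, if_true, Function.update_apply]
      rw [if_neg (by omega), h3 i (by omega)]

/-- The loop `for x = 0, …, e - 1`. -/
def forVar (x : ℕ) (e : NExp) (body : Prog) : Prog :=
  .seq (.setNat x (.const 0))
    (.loop (.natLt (.var x) e) (.seq body (.setNat x (.add (.var x) (.const 1)))))

theorem exec_forVar {x : ℕ} {e : NExp} {body : Prog} {s : Store} {T n : ℕ}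
    (Inv : ℕ → Store → Prop) (h0 : Inv 0 (s.setNat x 0))
    (he : ∀ i s, Inv i s → e.val s = n)
    (hstep : ∀ i < n, ∀ s, Inv i s → s.natVar x = i → Exec body s T
      (fun s' => s'.natVar x = i ∧ Inv (i + 1) (s'.setNat x (i + 1)))) :
    Exec (forVar x e body) s ((n + 1) * (T + e.cost + 8)) (Inv n) := by
  refine (Exec.seq (Exec.setNat ((Exec.loop (T := T + 4)
    (fun s' => s'.natVar x ≤ n ∧ Inv (s'.natVar x) s') (fun s' => n - s'.natVar x) ?_ ?_).mono
    le_rfl ?_))).mono ?_ fun _ h => h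
  · rintro s ⟨h1, h2⟩ h3
    have he' := he _ _ h2
    simp only [BExp.holds, NExp.val, he'] at h3
    refine (Exec.seq ((hstep _ h3 s h2 rfl).mono le_rfl fun s' h => Exec.setNat ?_)).mono
      (by simp [NExp.cost]) fun _ h => h
    simp only [NExp.val, h.1, Store.setNat_natVar, if_true]
    exact ⟨⟨h3, h.2⟩, by omega⟩
  · simpa [NExp.val] using h0
  · rintro s' ⟨⟨h1, h2⟩, h3⟩
    have he' := he _ _ h2
    simp only [BExp.holds, NExp.val, he'] at h3
    have : s'.natVar x = n := by omega
    rwa [this] at h2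
  · simp only [NExp.cost, BExp.cost, Store.setNat_natVar, NExp.val, if_true]
    have : (n + 1) * (T + e.cost + 8) = n * (T + 4 + (1 + e.cost + 1) + 1) + n + T + e.cost + 8 := by
      ring
    rw [Nat.sub_zero]; omega

end UncertainKernel

namespace UncertainKernel

/-! ### Heap sort -/

/-- `c` is one of the two children of the node `j` of a binary heap. -/
def IsChild (j c : ℕ) : Prop := c = 2 * j + 1 ∨ c = 2 * j + 2

/-- The keys `k` satisfy the heap condition at all nodes from `lo` on, the heap ending before `e`. -/
def HeapFrom (k : ℕ → ℝ) (lo e : ℕ) : Prop :=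
  ∀ j c, lo ≤ j → IsChild j c → c < e → k c ≤ k j

/-- The heap condition holds except between the node `i` and its children; the children of `i` are
still below its parent. -/
def HeapExcept (k : ℕ → ℝ) (lo e i : ℕ) : Prop :=
  (∀ j c, lo ≤ j → j ≠ i → IsChild j c → c < e → k c ≤ k j) ∧
  (∀ j c, lo ≤ j → IsChild j i → IsChild i c → c < e → k c ≤ k j)

theorem HeapExcept.heapFrom {k : ℕ → ℝ} {lo e i : ℕ} (h : HeapExcept k lo e i)
    (hi : ∀ c, IsChild i c → c < e → k c ≤ k i) : HeapFrom k lo e := by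
  intro j c hj hc he
  by_cases hji : j = i
  · subst hji; exact hi c hc he
  · exact h.1 j c hj hji hc he

theorem HeapFrom.heapExcept {k : ℕ → ℝ} {i e : ℕ} (h : HeapFrom k (i + 1) e) :
    HeapExcept k i e i := by
  refine ⟨fun j c hj hji hc he => h j c (by omega) hc he, fun j c hj hji _ _ => ?_⟩
  rcases hji with hji | hji <;> omega

theorem HeapExcept.swap {k : ℕ → ℝ} {lo e i c : ℕ} (h : HeapExcept k lo e i) (hlo : lo ≤ i)
    (hc : IsChild i c) (hce : c < e) (hmax : ∀ c', IsChild i c' → c' < e → k c' ≤ k c)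
    (hlt : k i < k c) : HeapExcept (k ∘ Equiv.swap i c) lo e c := by
  have hic : i < c := by rcases hc with h | h <;> omega
  have hoff : ∀ j, j ≠ i → j ≠ c → (k ∘ Equiv.swap i c) j = k j := fun j h1 h2 => by
    simp [Equiv.swap_apply_of_ne_of_ne h1 h2]
  have hl : (k ∘ Equiv.swap i c) i = k c := by simp
  have hr : (k ∘ Equiv.swap i c) c = k i := by simp
  constructor
  · intro j c' hj hjc hc' hce'
    have hjc' : j < c' := by rcases hc' with h | h <;> omega
    by_cases hji : j = i
    · subst hji
      rw [hl]
      by_cases h' : c' = c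
      · subst h'; rw [hr]; exact hlt.le
      · rw [hoff _ (by omega) h']; exact hmax _ hc' hce'
    · rw [hoff j hji hjc]
      by_cases h1 : c' = i
      · subst h1; rw [hl]; exact h.2 _ _ hj hc' hc hce
      · have h2 : c' ≠ c := by
          rintro rfl
          rcases hc with hc | hc <;> rcases hc' with hc' | hc' <;> omega
        rw [hoff _ h1 h2]; exact h.1 _ _ hj hji hc' hce'
  · intro j c' hj hjc hcc' hce'
    have : j = i := by rcases hc with hc | hc <;> rcases hjc with hjc | hjc <;> omega
    subst this
    have h3 : c < c' := by rcases hcc' with h | h <;> omega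
    rw [hl, hoff _ (by omega) (by omega)]
    exact h.1 _ _ (by omega) (by omega) hcc' hce'

theorem HeapFrom.le_root {k : ℕ → ℝ} {e : ℕ} (h : HeapFrom k 0 e) : ∀ i < e, k i ≤ k 0 := by
  intro i
  induction i using Nat.strong_induction_on with
  | _ i ih =>
    intro hi
    rcases Nat.eq_zero_or_pos i with rfl | hpos
    · exact le_rfl
    · exact (h ((i - 1) / 2) i (Nat.zero_le _) (by unfold IsChild; omega) hi).trans
        (ih _ (by omega) (by omega))

/-- The key of the location in cell `i` of the heap. -/
def heapKey (i : NExp) : RExp := .arr 2 (.arr 1 i)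

/-- Let a location sink to its place in the heap. Natural number variables `6` and `8` hold its
current node and the end of the heap, variable `7` the child with the larger key; natural number
array `1` holds the heap, real array `2` the keys of the locations. As soon as the location is in
place, variable `6` is set to the end of the heap, which stops the loop. -/
def siftDown : Prog :=
  .loop (.natLt (.add (.add (.var 6) (.var 6)) (.const 1)) (.var 8))
    (.seq (.setNat 7 (.add (.add (.var 6) (.var 6)) (.const 1)))
      (.seq
        (.cond (.conj (.natLt (.add (.var 7) (.const 1)) (.var 8))
            (.realLt (heapKey (.var 7)) (heapKey (.add (.var 7) (.const 1)))))
          (.setNat 7 (.add (.var 7) (.const 1))) .skip)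
        (.cond (.realLt (heapKey (.var 6)) (heapKey (.var 7)))
          (.seq (.setNat 9 (.arr 1 (.var 6)))
            (.seq (.setNatArr 1 (.var 6) (.arr 1 (.var 7)))
              (.seq (.setNatArr 1 (.var 7) (.var 9)) (.setNat 6 (.var 7)))))
          (.setNat 6 (.var 8)))))

theorem writesIn_siftDown : siftDown.WritesIn [(0, 6), (0, 7), (0, 9), (2, 1)] := by
  simp [siftDown, Prog.WritesIn]

/-- The array `a'` arises from `a` by a permutation of the cells before `e`. -/
def PermBefore (e : ℕ) (a a' : ℕ → ℕ) : Prop :=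
  ∃ π : Equiv.Perm ℕ, (∀ j, e ≤ j → π j = j) ∧ a' = a ∘ π

theorem PermBefore.refl (e : ℕ) (a : ℕ → ℕ) : PermBefore e a a := ⟨1, by simp, by simp⟩

theorem PermBefore.trans {e : ℕ} {a a' a'' : ℕ → ℕ} (h : PermBefore e a a')
    (h' : PermBefore e a' a'') : PermBefore e a a'' := by
  obtain ⟨π, h1, rfl⟩ := h
  obtain ⟨ρ, h2, rfl⟩ := h'
  exact ⟨ρ.trans π, fun j hj => by simp [h2 j hj, h1 j hj], by ext; simp⟩

theorem PermBefore.mono {e e' : ℕ} {a a' : ℕ → ℕ} (h : PermBefore e a a') (he : e ≤ e') :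
    PermBefore e' a a' := by
  obtain ⟨π, h1, rfl⟩ := h
  exact ⟨π, fun j hj => h1 j (he.trans hj), rfl⟩

theorem permBefore_swap {e i c : ℕ} (a : ℕ → ℕ) (hi : i < e) (hc : c < e) :
    PermBefore e a (a ∘ Equiv.swap i c) :=
  ⟨_, fun j hj => Equiv.swap_apply_of_ne_of_ne (by omega) (by omega), rfl⟩

theorem perm_lt_of_fix {e : ℕ} {π : Equiv.Perm ℕ} (h : ∀ j, e ≤ j → π j = j) {i : ℕ} (hi : i < e) :
    π i < e := by
  by_contra hc
  have := π.injective (h (π i) (not_lt.1 hc))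
  omega

theorem PermBefore.forall_lt {e : ℕ} {a a' : ℕ → ℕ} (h : PermBefore e a a') {p : ℕ → Prop}
    (hp : ∀ i < e, p (a i)) : ∀ i < e, p (a' i) := by
  obtain ⟨π, h1, rfl⟩ := h
  exact fun i hi => hp _ (perm_lt_of_fix h1 hi)

theorem PermBefore.eq_of_le {e : ℕ} {a a' : ℕ → ℕ} (h : PermBefore e a a') {i : ℕ} (hi : e ≤ i) :
    a' i = a i := by
  obtain ⟨π, h1, rfl⟩ := h
  simp [h1 i hi]

theorem update_update_eq_swap (a : ℕ → ℕ) (i c : ℕ) :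
    Function.update (Function.update a i (a c)) c (a i) = a ∘ Equiv.swap i c := by
  ext j
  simp only [Function.update_apply, Function.comp, Equiv.swap_apply_def]
  split_ifs <;> simp_all

/-- A child of node `i` has a number of at least `2 * i + 1`, so `r` iterations suffice if the heap
ends before node `2 ^ r * (i + 1)`. -/
theorem exec_siftDown (r : ℕ) : ∀ (s : Store) (lo : ℕ), lo ≤ s.natVar 6 →
    HeapExcept (fun j => s.realArr 2 (s.natArr 1 j)) lo (s.natVar 8) (s.natVar 6) →
    s.natVar 8 < 2 ^ r * (s.natVar 6 + 1) →
    Exec siftDown s (r * 60 + 20) (fun s' => PermBefore (s.natVar 8) (s.natArr 1) (s'.natArr 1) ∧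
      HeapFrom (fun j => s.realArr 2 (s'.natArr 1 j)) lo (s.natVar 8)) := by
  induction r with
  | zero =>
    intro s lo hlo hH hr
    refine (Exec.loopDone ?_ ⟨PermBefore.refl _ _, hH.heapFrom fun c hc he => ?_⟩).mono
      (by simp [BExp.cost, NExp.cost]) fun _ h => h
    · simp only [BExp.holds, NExp.val]; omega
    · rcases hc with hc | hc <;> omega
  | succ r ih =>
    intro s lo hlo hH hr
    by_cases hb : s.natVar 6 + s.natVar 6 + 1 < s.natVar 8
    swap
    · refine (Exec.loopDone ?_ ⟨PermBefore.refl _ _, hH.heapFrom fun c hc he => ?_⟩).mono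
        (by simp [BExp.cost, NExp.cost]) fun _ h => h
      · simpa only [BExp.holds, NExp.val] using hb
      · rcases hc with hc | hc <;> omega
    set i := s.natVar 6 with hi
    set e := s.natVar 8 with he
    set k : ℕ → ℝ := fun j => s.realArr 2 (s.natArr 1 j) with hk
    refine (Exec.loopStep (T₁ := 52) (T₂ := r * 60 + 20) (by simpa [BExp.holds, NExp.val] using hb)
      ?_).mono (by simp [BExp.cost, NExp.cost]; omega) fun _ h => h
    refine (Exec.seq (Exec.setNat (Exec.seq (T₁ := 20) (T₂ := 26) ?_))).mono
      (by simp [NExp.cost]) fun _ h => h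
    -- the rest of the iteration, once variable `7` holds the child with the larger key
    have key : ∀ s₁ : Store, s₁.natVar 6 = i → s₁.natVar 8 = e → s₁.natArr 1 = s.natArr 1 →
        s₁.realArr 2 = s.realArr 2 → IsChild i (s₁.natVar 7) → s₁.natVar 7 < e →
        (∀ c, IsChild i c → c < e → k c ≤ k (s₁.natVar 7)) →
        Exec (.cond (.realLt (heapKey (.var 6)) (heapKey (.var 7)))
          (.seq (.setNat 9 (.arr 1 (.var 6)))
            (.seq (.setNatArr 1 (.var 6) (.arr 1 (.var 7)))
              (.seq (.setNatArr 1 (.var 7) (.var 9)) (.setNat 6 (.var 7)))))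
          (.setNat 6 (.var 8))) s₁ 26 (fun s₂ => Exec siftDown s₂ (r * 60 + 20) (fun s' =>
            PermBefore e (s.natArr 1) (s'.natArr 1) ∧
            HeapFrom (fun j => s.realArr 2 (s'.natArr 1 j)) lo e)) := by
      intro s₁ h6 h8 hn hra hc hce hmax
      refine (Exec.cond (T := 15) (fun hlt => ?_) (fun hlt => ?_)).mono
        (by simp [BExp.cost, heapKey, RExp.cost, NExp.cost]) fun _ h => h
      · refine (Exec.seq (Exec.setNat (Exec.seq (Exec.setNatArr (Exec.seq (Exec.setNatArr
          (Exec.setNat ?_))))))).mono (by simp [NExp.cost]) fun _ h => h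
        simp only [BExp.holds, heapKey, RExp.val, NExp.val, h6, hn, hra] at hlt
        simp only [NExp.val]
        set s₂ : Store := _
        change Exec siftDown s₂ _ _
        have e6 : s₂.natVar 6 = s₁.natVar 7 := by simp [s₂]
        have e8 : s₂.natVar 8 = e := by simp [s₂, h8]
        have er : s₂.realArr 2 = s.realArr 2 := by simp [s₂, hra]
        have ea : s₂.natArr 1 = s.natArr 1 ∘ Equiv.swap i (s₁.natVar 7) := by
          simp [s₂, h6, hn, update_update_eq_swap]
        have hic : i < s₁.natVar 7 := by rcases hc with h | h <;> omega
        refine (ih s₂ lo (by omega) ?_ ?_).mono le_rfl ?_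
        · rw [e8, e6]
          have := hH.swap hlo hc hce hmax hlt
          rw [er, ea]
          exact this
        · rw [e8, e6]
          refine hr.trans_le ?_
          rw [pow_succ, mul_assoc]
          refine Nat.mul_le_mul_left _ ?_
          rcases hc with h | h <;> omega
        · rintro s' ⟨h1, h2⟩
          rw [e8] at h1 h2
          rw [er] at h2
          rw [ea] at h1
          exact ⟨(permBefore_swap _ (by omega) hce).trans h1, h2⟩
      · refine (Exec.setNat ?_).mono (by simp [NExp.cost]) fun _ h => h
        simp only [BExp.holds, heapKey, RExp.val, NExp.val, h6, hn, hra, not_lt] at hlt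
        have hfin : HeapFrom k lo e := hH.heapFrom fun c hc' he' => (hmax c hc' he').trans hlt
        refine (Exec.loopDone ?_ ⟨?_, ?_⟩).mono
          (by simp [BExp.cost, NExp.cost]) fun _ h => h
        · simp only [BExp.holds, NExp.val, Store.setNat_natVar]
          simp
          omega
        · simp [hn, PermBefore.refl]
        · simp only [Store.setNat_natArr, hn]
          exact hfin
    refine (Exec.cond (T := 4) (fun hlt => ?_) (fun hlt => ?_)).mono
      (by simp [BExp.cost, heapKey, RExp.cost, NExp.cost]) fun _ h => h
    · refine (Exec.setNat ?_).mono (by simp [NExp.cost]) fun _ h => h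
      simp [BExp.holds, heapKey, RExp.val, NExp.val, ← hi, ← he] at hlt
      refine key _ ?_ ?_ ?_ ?_ ?_ ?_ ?_ <;> simp [NExp.val, ← hi, ← he]
      · unfold IsChild; omega
      · omega
      · intro c hc hce
        rcases hc with hc | hc
        · have : c = i + i + 1 := by omega
          rw [this]; exact hlt.2.le
        · have : c = i + i + 1 + 1 := by omega
          rw [this]
    · refine (Exec.skip ?_).mono (by omega) fun _ h => h
      simp [BExp.holds, heapKey, RExp.val, NExp.val, ← hi, ← he] at hlt
      refine key _ ?_ ?_ ?_ ?_ ?_ ?_ ?_ <;> simp [NExp.val, ← hi, ← he]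
      · unfold IsChild; omega
      · omega
      · intro c hc hce
        rcases hc with hc | hc
        · have : c = i + i + 1 := by omega
          rw [this]
        · have : c = i + i + 1 + 1 := by omega
          rw [this]; exact hlt (by omega)

/-- Turn the locations in the first `m` cells of natural number array `1` into a heap, where `m` is
the value of natural number variable `0`. -/
def buildHeap : Prog :=
  forVar 10 (.var 0)
    (.seq (.setNat 6 (.sub (.sub (.var 0) (.const 1)) (.var 10)))
      (.seq (.setNat 8 (.var 0)) siftDown))

/-- Move the largest location of the heap to its end, and repeat this with the shortened heap. -/
def emptyHeap : Prog :=
  forVar 10 (.var 0)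
    (.seq (.setNat 8 (.sub (.sub (.var 0) (.const 1)) (.var 10)))
      (.seq (.setNat 9 (.arr 1 (.const 0)))
        (.seq (.setNatArr 1 (.const 0) (.arr 1 (.var 8)))
          (.seq (.setNatArr 1 (.var 8) (.var 9))
            (.seq (.setNat 6 (.const 0)) siftDown)))))

/-- Sort the locations in natural number array `1` by ascending keys. -/
def heapSort : Prog := .seq buildHeap emptyHeap

/-- The cells that heap sort changes. -/
def sortCells : List (ℕ × ℕ) := [(0, 6), (0, 7), (0, 8), (0, 9), (0, 10), (2, 1)]

theorem writesIn_siftDown' : siftDown.WritesIn sortCells := by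
  simp [siftDown, Prog.WritesIn, sortCells]

theorem writesIn_heapSort : heapSort.WritesIn sortCells := by
  simp [heapSort, buildHeap, emptyHeap, forVar, Prog.WritesIn, writesIn_siftDown']
  simp [sortCells]

theorem exec_buildHeap (s : Store) (m : ℕ) (hm : s.natVar 0 = m) :
    Exec buildHeap s ((m + 1) * (Nat.log 2 m * 60 + 100)) (fun s' =>
      PermBefore m (s.natArr 1) (s'.natArr 1) ∧
      HeapFrom (fun j => s.realArr 2 (s'.natArr 1 j)) 0 m) := by
  have main := exec_forVar (x := 10) (e := .var 0) (s := s) (n := m)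
    (T := (Nat.log 2 m + 1) * 60 + 28)
    (body := .seq (.setNat 6 (.sub (.sub (.var 0) (.const 1)) (.var 10)))
      (.seq (.setNat 8 (.var 0)) siftDown))
    -- after `x` iterations, the heap condition holds at the last `x` nodes
    (fun x s' => s'.natVar 0 = m ∧ s'.realArr 2 = s.realArr 2 ∧
      PermBefore m (s.natArr 1) (s'.natArr 1) ∧
      HeapFrom (fun j => s.realArr 2 (s'.natArr 1 j)) (m - x) m) ?_ ?_ ?_
  · refine main.mono ?_ fun s' h => ⟨h.2.2.1, by simpa using h.2.2.2⟩
    refine Nat.mul_le_mul_left _ ?_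
    simp only [NExp.cost]; omega
  · refine ⟨by simp [hm], rfl, PermBefore.refl _ _, ?_⟩
    intro j c hj hc he
    rcases hc with h | h <;> omega
  · intro i s' h; exact h.1
  · rintro x hx s' ⟨h0, h2, hp, hh⟩ h10
    refine (Exec.seq (Exec.setNat (Exec.seq (Exec.setNat
      (((exec_siftDown (Nat.log 2 m + 1) _ (m - (x + 1)) ?_ ?_ ?_).frame
        writesIn_siftDown).mono le_rfl ?_))))).mono (by simp [NExp.cost]; omega) fun _ h => h
    · simp [NExp.val, h0, h10]; omega
    · simp only [NExp.val, Store.setNat_natVar, h0, h10, Store.setNat_realArr, Store.setNat_natArr,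
        h2]
      norm_num
      have e1 : m - 1 - x = m - (x + 1) := by omega
      have e2 : m - x = m - (x + 1) + 1 := by omega
      rw [e1]
      rw [e2] at hh
      exact hh.heapExcept
    · simp only [NExp.val, Store.setNat_natVar, h0, h10]
      norm_num
      have := Nat.lt_pow_succ_log_self (b := 2) (by norm_num) m
      exact this.trans_le (Nat.le_mul_of_pos_right _ (by omega))
    · rintro s'' ⟨⟨h1, h3⟩, hF⟩
      simp [NExp.val, h0, h2] at h1 h3
      refine ⟨?_, ?_, ?_, hp.trans h1, ?_⟩
      · rw [hF.nv (by simp)]; simp [h10]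
      · rw [Store.setNat_natVar, if_neg (by norm_num), hF.nv (by simp)]; simp [h0]
      · rw [Store.setNat_realArr, hF.ra (by simp)]; simp [h2]
      · exact h3

theorem exec_emptyHeap (s : Store) (m : ℕ) (hm : s.natVar 0 = m)
    (hh : HeapFrom (fun j => s.realArr 2 (s.natArr 1 j)) 0 m) :
    Exec emptyHeap s ((m + 1) * (Nat.log 2 m * 60 + 120)) (fun s' =>
      PermBefore m (s.natArr 1) (s'.natArr 1) ∧
      ∀ i j, i ≤ j → j < m →
        s.realArr 2 (s'.natArr 1 i) ≤ s.realArr 2 (s'.natArr 1 j)) := by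
  have main := exec_forVar (x := 10) (e := .var 0) (s := s) (n := m)
    (T := (Nat.log 2 m + 1) * 60 + 50)
    (body := .seq (.setNat 8 (.sub (.sub (.var 0) (.const 1)) (.var 10)))
      (.seq (.setNat 9 (.arr 1 (.const 0)))
        (.seq (.setNatArr 1 (.const 0) (.arr 1 (.var 8)))
          (.seq (.setNatArr 1 (.var 8) (.var 9))
            (.seq (.setNat 6 (.const 0)) siftDown)))))
    -- after `x` iterations, the last `x` cells are sorted and hold the largest keys
    (fun x s' => s'.natVar 0 = m ∧ s'.realArr 2 = s.realArr 2 ∧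
      PermBefore m (s.natArr 1) (s'.natArr 1) ∧
      HeapFrom (fun j => s.realArr 2 (s'.natArr 1 j)) 0 (m - x) ∧
      ∀ i j, i ≤ j → m - x ≤ j → j < m →
        s.realArr 2 (s'.natArr 1 i) ≤ s.realArr 2 (s'.natArr 1 j)) ?_ ?_ ?_
  · refine main.mono ?_ fun s' h => ⟨h.2.2.1, fun i j hij hj => h.2.2.2.2 i j hij (by omega) hj⟩
    refine Nat.mul_le_mul_left _ ?_
    simp only [NExp.cost]; omega
  · refine ⟨by simp [hm], rfl, PermBefore.refl _ _, hh, ?_⟩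
    intro i j _ _ _; omega
  · intro i s' h; exact h.1
  · rintro x hx s' ⟨h0, h2, hp, hh, hs⟩ h10
    refine (Exec.seq (Exec.setNat (Exec.seq (Exec.setNat (Exec.seq (Exec.setNatArr
      (Exec.seq (Exec.setNatArr (Exec.seq (Exec.setNat
      (((exec_siftDown (Nat.log 2 m + 1) _ 0 ?_ ?_ ?_).frame
        writesIn_siftDown).mono le_rfl ?_))))))))))).mono (by simp [NExp.cost]; omega) fun _ h => h
    · simp
    · have hw := update_update_eq_swap (s'.natArr 1) 0 (m - 1 - x)
      simp only [NExp.val, Store.setNat_natVar, h0, h10, Store.setNat_realArr, Store.setNat_natArr,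
        Store.setNatArr_natVar, Store.setNatArr_natArr, Store.setNatArr_realArr, h2]
      norm_num [hw]
      have hh' : HeapFrom (fun j => s.realArr 2 (s'.natArr 1 (Equiv.swap 0 (m - 1 - x) j))) 1
          (m - 1 - x) := by
        intro j c hj hc he
        have hjc : j < c := by rcases hc with h | h <;> omega
        simp only [Equiv.swap_apply_of_ne_of_ne (show j ≠ 0 by omega)
          (show j ≠ m - 1 - x by omega), Equiv.swap_apply_of_ne_of_ne (show c ≠ 0 by omega)
          (show c ≠ m - 1 - x by omega)]
        exact hh j c (by omega) hc (by omega)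
      exact hh'.heapExcept
    · simp only [NExp.val, Store.setNat_natVar, Store.setNatArr_natVar, h0, h10]
      norm_num
      have := Nat.lt_pow_succ_log_self (b := 2) (by norm_num) m
      omega
    · rintro s'' ⟨⟨h1, h3⟩, hF⟩
      have hw := update_update_eq_swap (s'.natArr 1) 0 (m - 1 - x)
      simp [NExp.val, h0, h2, h10, hw] at h1 h3
      have hp1 : PermBefore (m - x) (s'.natArr 1) (s''.natArr 1) :=
        (permBefore_swap _ (by omega) (by omega)).trans (h1.mono (by omega))
      refine ⟨?_, ?_, ?_, hp.trans (hp1.mono (by omega)), ?_, ?_⟩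
      · rw [hF.nv (by simp)]; simp [h10]
      · rw [Store.setNat_natVar, if_neg (by norm_num), hF.nv (by simp)]; simp [h0]
      · rw [Store.setNat_realArr, hF.ra (by simp)]; simp [h2]
      · rw [show m - (x + 1) = m - 1 - x by omega]
        exact h3
      · intro i j hij hj hjm
        simp only [Store.setNat_natArr]
        rcases Nat.lt_or_ge j (m - x) with hjx | hjx
        · -- the cell `m - 1 - x` now holds the former root of the heap
          have hj' : j = m - 1 - x := by omega
          have e1 : s''.natArr 1 j = s'.natArr 1 0 := by
            rw [h1.eq_of_le (by omega), hj']; simp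
          rw [e1]
          exact hp1.forall_lt (p := fun l => s.realArr 2 l ≤ s.realArr 2 (s'.natArr 1 0))
            (fun i hi => hh.le_root i hi) i (by omega)
        · rw [hp1.eq_of_le hjx]
          rcases Nat.lt_or_ge i (m - x) with hix | hix
          · exact hp1.forall_lt (p := fun l => s.realArr 2 l ≤ s.realArr 2 (s'.natArr 1 j))
              (fun i hi => hs i j (by omega) hjx hjm) i hix
          · rw [hp1.eq_of_le hix]
            exact hs i j hij hjx hjm

theorem exec_heapSort (s : Store) (m : ℕ) (hm : s.natVar 0 = m) :
    Exec heapSort s ((m + 1) * (Nat.log 2 m * 120 + 220)) (fun s' =>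
      PermBefore m (s.natArr 1) (s'.natArr 1) ∧ (∀ i j, i ≤ j → j < m →
        s.realArr 2 (s'.natArr 1 i) ≤ s.realArr 2 (s'.natArr 1 j)) ∧ Frame sortCells s s') := by
  have hW := writesIn_heapSort
  refine (Exec.seq (T₂ := (m + 1) * (Nat.log 2 m * 60 + 120))
    (((exec_buildHeap s m hm).frame hW.1).mono le_rfl ?_)).mono ?_ fun _ h => h
  · rintro s₁ ⟨⟨h1, h2⟩, hF⟩
    have er : s₁.realArr 2 = s.realArr 2 := hF.ra (by simp [sortCells])
    have e0 : s₁.natVar 0 = m := by rw [hF.nv (by simp [sortCells]), hm]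
    refine ((exec_emptyHeap s₁ m e0 (by rw [er]; exact h2)).frame hW.2).mono le_rfl ?_
    rintro s₂ ⟨⟨h3, h4⟩, hF'⟩
    rw [er] at h4
    exact ⟨h1.trans h3, h4, hF.trans hF'⟩
  · rw [← mul_add]
    exact Nat.mul_le_mul_left _ (by omega)

end UncertainKernel

namespace UncertainKernel

/-! ### Extreme points of the expected polytope -/

/-- The point `p` maximizes `⟨u, ·⟩` over the convex body with support function `H`: it lies in the
body, and the value at `p` is the value of the support function. -/
def IsExtreme {d : ℕ} (H : Pt d → ℝ) (u p : Pt d) : Prop :=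
  inner ℝ u p = H u ∧ ∀ v, inner ℝ v p ≤ H v

theorem le_supportFn {d : ℕ} {P : Finset (Pt d)} {p : Pt d} (hp : p ∈ P) (u : Pt d) :
    inner ℝ u p ≤ supportFn P u := by
  rw [supportFn, dif_pos ⟨p, hp⟩]
  exact Finset.le_sup' (fun p => inner ℝ u p) hp

theorem exists_supportFn {d : ℕ} {P : Finset (Pt d)} (hP : P.Nonempty) (u : Pt d) :
    ∃ p ∈ P, supportFn P u = inner ℝ u p := by
  rw [supportFn, dif_pos hP]
  exact Finset.exists_mem_eq_sup' hP _

theorem supportFn_empty {d : ℕ} (u : Pt d) : supportFn (∅ : Finset (Pt d)) u = 0 := by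
  simp [supportFn]

/-- The set of the first `k` locations in the order `a`. -/
def firstLocs (a : ℕ → ℕ) (k : ℕ) : Finset ℕ := (Finset.range k).image a

theorem firstLocs_succ (a : ℕ → ℕ) (k : ℕ) :
    firstLocs a (k + 1) = insert (a k) (firstLocs a k) := by
  simp [firstLocs, Finset.range_add_one]

open Classical in
/-- If the locations are sorted by descending values of `⟨u, ·⟩`, the first one that is present is
a farthest point of the realization in direction `u`. The first `k` locations being absent is the
event `Disjoint A (firstLocs a k)`, so the `k`-th difference of indicators is the indicator of the
event that the `k`-th location is the first one present. -/
theorem sum_first_present {d m : ℕ} (loc : ℕ → Pt d) (a : ℕ → ℕ)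
    (hsurj : ∀ s < m, ∃ k < m, a k = s)
    {A : Finset ℕ} (hA : A ⊆ Finset.range m) (u : Pt d)
    (hsort : ∀ i j, i ≤ j → j < m → inner ℝ u (loc (a j)) ≤ (inner ℝ u (loc (a i)) : ℝ)) :
    (∀ v : Pt d, ∑ k ∈ Finset.range m, ((if Disjoint A (firstLocs a k) then (1 : ℝ) else 0) -
      (if Disjoint A (firstLocs a (k + 1)) then 1 else 0)) * inner ℝ v (loc (a k)) ≤
      supportFn (A.image loc) v) ∧
    ∑ k ∈ Finset.range m, ((if Disjoint A (firstLocs a k) then (1 : ℝ) else 0) -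
      (if Disjoint A (firstLocs a (k + 1)) then 1 else 0)) * inner ℝ u (loc (a k)) =
      supportFn (A.image loc) u := by
  rcases A.eq_empty_or_nonempty with rfl | ⟨s₀, hs₀⟩
  · simp [supportFn_empty]
  have hex : ∃ k, a k ∈ A ∧ k < m := by
    obtain ⟨k, hk, rfl⟩ := hsurj s₀ (Finset.mem_range.1 (hA hs₀))
    exact ⟨k, hs₀, hk⟩
  set k₀ := Nat.find hex with hk₀
  obtain ⟨hk₀A, hk₀m⟩ : a k₀ ∈ A ∧ k₀ < m := Nat.find_spec hex
  have hmin : ∀ k < k₀, a k ∉ A := fun k hk h => Nat.find_min hex hk ⟨h, by omega⟩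
  have hdis : ∀ k, Disjoint A (firstLocs a k) ↔ k ≤ k₀ := by
    intro k
    rw [Finset.disjoint_right]
    constructor
    · intro h
      by_contra hc
      exact h (Finset.mem_image_of_mem a (Finset.mem_range.2 (not_le.1 hc))) hk₀A
    · intro hk s hs
      obtain ⟨j, hj, rfl⟩ := Finset.mem_image.1 hs
      exact hmin j (by have := Finset.mem_range.1 hj; omega)
  have hsum : ∀ v : Pt d, ∑ k ∈ Finset.range m,
      ((if Disjoint A (firstLocs a k) then (1 : ℝ) else 0) -
      (if Disjoint A (firstLocs a (k + 1)) then 1 else 0)) * inner ℝ v (loc (a k)) =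
      inner ℝ v (loc (a k₀)) := by
    intro v
    rw [Finset.sum_eq_single k₀]
    · simp [hdis]
    · intro k _ hk
      simp only [hdis]
      rcases lt_or_gt_of_ne hk with h | h
      · rw [if_pos (by omega), if_pos (by omega)]; simp
      · rw [if_neg (by omega), if_neg (by omega)]; simp
    · intro h; exact absurd (Finset.mem_range.2 hk₀m) h
  have hmem : loc (a k₀) ∈ A.image loc := Finset.mem_image_of_mem _ hk₀A
  refine ⟨fun v => (hsum v).le.trans (le_supportFn hmem v), (hsum u).trans ?_⟩
  refine le_antisymm (le_supportFn hmem u) ?_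
  obtain ⟨p, hp, hpu⟩ := exists_supportFn ⟨_, hmem⟩ u
  obtain ⟨s, hs, rfl⟩ := Finset.mem_image.1 hp
  rw [hpu]
  obtain ⟨k, hk, rfl⟩ := hsurj s (Finset.mem_range.1 (hA hs))
  exact hsort k₀ k (not_lt.1 fun h => hmin k h hs) hk

/-- The probability that none of the locations in `F` is taken, if the points `v < n` choose their
locations independently. -/
def survival (n : ℕ) (owner : ℕ → ℕ) (prob : ℕ → ℝ) (F : Finset ℕ) : ℝ :=
  ∏ v ∈ Finset.range n, (1 - ∑ s ∈ F with owner s = v, prob s)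

/-- Uncertain points in both models: location `s < m` is a possible location of the point `owner s`
only, which is there with probability `prob s`, and absent with the remaining probability. The
function `H` is the expected support function. The field `extreme` says that for every order `a` of
the locations by descending values of `⟨u, ·⟩`, the expectation of the first location that is
present is an extreme point. -/
structure Model (d m : ℕ) where
  loc : ℕ → Pt d
  owner : ℕ → ℕ
  prob : ℕ → ℝ
  n : ℕ
  H : Pt d → ℝ
  prob_nonneg : ∀ s, 0 ≤ prob s
  sum_prob_le : ∀ v, ∑ s ∈ Finset.range m with owner s = v, prob s ≤ 1
  owner_lt : ∀ s < m, owner s < n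
  exists_extreme : ∀ u, ∃ p, IsExtreme H u p
  extreme : ∀ (a : ℕ → ℕ) (u : Pt d), Set.InjOn a (Finset.range m) → (∀ k < m, a k < m) →
    (∀ i j, i ≤ j → j < m → inner ℝ u (loc (a j)) ≤ (inner ℝ u (loc (a i)) : ℝ)) →
    IsExtreme H u (∑ k ∈ Finset.range m, (survival n owner prob (firstLocs a k) -
      survival n owner prob (firstLocs a (k + 1))) • loc (a k))

section Expectation

variable {Ω : Type*} [Fintype Ω] {d m : ℕ} (q : Ω → ℝ) (loc : ℕ → Pt d)
  (A : Ω → Finset ℕ)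

open Classical in
/-- The expected support function of a random set of locations. -/
def expSupport (q : Ω → ℝ) (loc : ℕ → Pt d) (A : Ω → Finset ℕ) (u : Pt d) : ℝ :=
  ∑ ω, q ω * supportFn ((A ω).image loc) u

open Classical in
/-- The expectation of the farthest points of all realizations is an extreme point. -/
theorem exists_isExtreme_expSupport (hq : ∀ ω, 0 ≤ q ω) (u : Pt d) :
    ∃ p, IsExtreme (expSupport q loc A) u p := by
  have : ∀ ω, ∃ p, IsExtreme (supportFn ((A ω).image loc)) u p := by
    intro ω
    rcases ((A ω).image loc).eq_empty_or_nonempty with h | h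
    · exact ⟨0, by simp [IsExtreme, h, supportFn_empty]⟩
    · obtain ⟨p, hp, h⟩ := exists_supportFn h u
      exact ⟨p, h.symm, fun v => le_supportFn hp v⟩
  choose p hp using this
  refine ⟨∑ ω, q ω • p ω, ?_, fun v => ?_⟩
  · simp only [inner_sum, inner_smul_right, expSupport]
    exact Finset.sum_congr rfl fun ω _ => by rw [(hp ω).1]
  · simp only [inner_sum, inner_smul_right, expSupport]
    exact Finset.sum_le_sum fun ω _ => mul_le_mul_of_nonneg_left ((hp ω).2 v) (hq ω)

open Classical in
/-- The expectation of `sum_first_present`: an extreme point is computable from the probabilities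
`S F` that no location in `F` is present. -/
theorem isExtreme_expSupport (hq : ∀ ω, 0 ≤ q ω) {S : Finset ℕ → ℝ}
    (hA : ∀ ω, A ω ⊆ Finset.range m)
    (hS : ∀ F, S F = ∑ ω, q ω * if Disjoint (A ω) F then 1 else 0)
    (a : ℕ → ℕ) (u : Pt d) (hinj : Set.InjOn a (Finset.range m)) (hlt : ∀ k < m, a k < m)
    (hsort : ∀ i j, i ≤ j → j < m → inner ℝ u (loc (a j)) ≤ (inner ℝ u (loc (a i)) : ℝ)) :
    IsExtreme (expSupport q loc A) u (∑ k ∈ Finset.range m,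
      (S (firstLocs a k) - S (firstLocs a (k + 1))) • loc (a k)) := by
  have hsurj : ∀ s < m, ∃ k < m, a k = s := by
    intro s hs
    have := Finset.surj_on_of_inj_on_of_card_le (s := Finset.range m) (t := Finset.range m)
      (fun k _ => a k) (fun k hk => Finset.mem_range.2 (hlt k (Finset.mem_range.1 hk)))
      (fun k l hk hl h => hinj hk hl h) le_rfl s (Finset.mem_range.2 hs)
    obtain ⟨k, hk, h⟩ := this
    exact ⟨k, Finset.mem_range.1 hk, h.symm⟩
  have key : ∀ v : Pt d, inner ℝ v (∑ k ∈ Finset.range m,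
      (S (firstLocs a k) - S (firstLocs a (k + 1))) • loc (a k)) =
      ∑ ω, q ω * ∑ k ∈ Finset.range m,
        ((if Disjoint (A ω) (firstLocs a k) then (1 : ℝ) else 0) -
        (if Disjoint (A ω) (firstLocs a (k + 1)) then 1 else 0)) * inner ℝ v (loc (a k)) := by
    intro v
    simp only [inner_sum, inner_smul_right, Finset.mul_sum]
    rw [Finset.sum_comm]
    refine Finset.sum_congr rfl fun k _ => ?_
    rw [hS, hS, ← Finset.sum_sub_distrib, Finset.sum_mul]
    exact Finset.sum_congr rfl fun ω _ => by ring
  refine ⟨?_, fun v => ?_⟩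
  · rw [key]
    exact Finset.sum_congr rfl fun ω _ => by
      rw [(sum_first_present loc a hsurj (hA ω) u hsort).2]
  · rw [key]
    exact Finset.sum_le_sum fun ω _ => mul_le_mul_of_nonneg_left
      ((sum_first_present loc a hsurj (hA ω) u hsort).1 v) (hq ω)

end Expectation

/-- The update of the survival probability when the location `s` is added to `F`. If the owner of
`s` is certain to be in `F`, the divisor `R` and the probability of `s` are both `0`, and the
formulas remain true. -/
theorem survival_insert {n : ℕ} {owner : ℕ → ℕ} {prob : ℕ → ℝ} {F : Finset ℕ} {s : ℕ} {R : ℝ}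
    (hs : s ∉ F) (hn : owner s < n) (h0 : 0 ≤ prob s)
    (hR : R = 1 - ∑ t ∈ F with owner t = owner s, prob t) (hle : prob s ≤ R) :
    survival n owner prob F / R * prob s =
      survival n owner prob F - survival n owner prob (insert s F) ∧
    survival n owner prob F / R * (R - prob s) = survival n owner prob (insert s F) := by
  have h1 : survival n owner prob F =
      R * ∏ v ∈ (Finset.range n).erase (owner s), (1 - ∑ t ∈ F with owner t = v, prob t) := by
    rw [hR, survival]
    exact (Finset.mul_prod_erase (Finset.range n)
      (fun v => 1 - ∑ t ∈ F with owner t = v, prob t) (Finset.mem_range.2 hn)).symm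
  have h2 : survival n owner prob (insert s F) =
      (R - prob s) * ∏ v ∈ (Finset.range n).erase (owner s),
        (1 - ∑ t ∈ F with owner t = v, prob t) := by
    rw [survival, ← Finset.mul_prod_erase _ _ (Finset.mem_range.2 hn)]
    congr 1
    · rw [Finset.filter_insert, if_pos rfl, Finset.sum_insert (by simp [hs]), hR]; ring
    · refine Finset.prod_congr rfl fun v hv => ?_
      rw [Finset.filter_insert, if_neg (Ne.symm (Finset.ne_of_mem_erase hv))]
  rw [h1, h2]
  rcases eq_or_ne R 0 with h | h
  · have : prob s = 0 := le_antisymm (h ▸ hle) h0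
    simp [h, this]
  · constructor <;> field_simp
    ring

/-! ### The two models -/

/-- Extend a family of points by `0`. -/
def extendPt {d k : ℕ} (f : Fin k → Pt d) (i : ℕ) : Pt d := if h : i < k then f ⟨i, h⟩ else 0

theorem extendPt_val {d k : ℕ} (f : Fin k → Pt d) (i : Fin k) : extendPt f i = f i := by
  simp [extendPt]

theorem cells_val {α : Type} [Zero α] {k : ℕ} (f : Fin k → α) (i : Fin k) : cells f i = f i := by
  simp [cells]

theorem image_extendPt {d k : ℕ} [DecidableEq (Pt d)] (f : Fin k → Pt d) (A : Finset (Fin k)) :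
    (A.map Fin.valEmbedding).image (extendPt f) = A.image f := by
  ext p
  simp [extendPt_val]

theorem map_val_subset {k : ℕ} (A : Finset (Fin k)) :
    A.map Fin.valEmbedding ⊆ Finset.range k := by
  intro i hi
  obtain ⟨j, _, rfl⟩ := Finset.mem_map.1 hi
  simp

/-- The expected support function of existentially uncertain points. -/
def Existential.expSupport {d n : ℕ} (P : Existential d n) : Pt d → ℝ :=
  UncertainKernel.expSupport P.realizationProb (extendPt P.loc)
    (fun A => A.map Fin.valEmbedding)

theorem Existential.expWidth_eq {d n : ℕ} (P : Existential d n) (u : Pt d) :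
    P.expWidth u = P.expSupport u + P.expSupport (-u) := by
  classical
  simp only [expWidth, expSupport, UncertainKernel.expSupport, image_extendPt, dirWidth,
    ← Finset.sum_add_distrib, mul_add]

/-- Expanding the product over the points gives the sum over all realizations. -/
theorem Existential.survival_eq {d n : ℕ} (P : Existential d n) (F : Finset ℕ) :
    survival n id (cells P.prob) F =
      ∑ A, P.realizationProb A * if Disjoint (A.map Fin.valEmbedding) F then 1 else 0 := by
  classical
  have h1 : survival n id (cells P.prob) F =
      ∏ i : Fin n, ((if (i : ℕ) ∈ F then 0 else P.prob i) + (1 - P.prob i)) := by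
    rw [survival, Finset.prod_range]
    refine Finset.prod_congr rfl fun i _ => ?_
    simp only [id, Finset.sum_filter, Finset.sum_ite_eq', cells_val]
    split_ifs <;> ring
  rw [h1, Finset.prod_add]
  simp only [Finset.powerset_univ]
  refine Finset.sum_congr rfl fun A _ => ?_
  rw [realizationProb, ← Finset.compl_eq_univ_sdiff]
  split_ifs with h
  · rw [mul_one]
    congr 1
    refine Finset.prod_congr rfl fun i hi => ?_
    rw [if_neg]
    exact Finset.disjoint_left.1 h (Finset.mem_map_of_mem _ hi)
  · rw [Finset.not_disjoint_iff] at h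
    obtain ⟨j, hj, hjF⟩ := h
    obtain ⟨i, hi, rfl⟩ := Finset.mem_map.1 hj
    rw [Finset.prod_eq_zero hi (by rw [if_pos (by simpa using hjF)])]
    simp

theorem Existential.realizationProb_nonneg {d n : ℕ} (P : Existential d n) (A : Finset (Fin n)) :
    0 ≤ P.realizationProb A :=
  mul_nonneg (Finset.prod_nonneg fun i _ => P.prob_nonneg i)
    (Finset.prod_nonneg fun i _ => sub_nonneg.2 (P.prob_le_one i))

/-- Existentially uncertain points: every location has its own point. -/
def Existential.model {d n : ℕ} (P : Existential d n) : Model d n where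
  loc := extendPt P.loc
  owner := id
  prob := cells P.prob
  n := n
  H := P.expSupport
  prob_nonneg s := by
    unfold cells; split_ifs
    exacts [P.prob_nonneg _, le_rfl]
  sum_prob_le v := by
    simp only [id, Finset.sum_filter, Finset.sum_ite_eq']
    unfold cells; split_ifs
    exacts [P.prob_le_one _, zero_le_one, zero_le_one]
  owner_lt _ h := h
  exists_extreme u := exists_isExtreme_expSupport _ _ _ P.realizationProb_nonneg u
  extreme a u h1 h2 h3 := isExtreme_expSupport _ _ _ P.realizationProb_nonneg
      (fun A => map_val_subset A) (fun F => by convert P.survival_eq F) a u h1 h2 h3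

open Classical in
/-- The expected support function of locationally uncertain points. -/
def Locational.expSupport {d n m : ℕ} (P : Locational d n m) : Pt d → ℝ :=
  UncertainKernel.expSupport P.realizationProb (extendPt P.loc)
    (fun c => (Finset.univ.image c).map Fin.valEmbedding)

theorem Locational.expWidth_eq {d n m : ℕ} (P : Locational d n m) (u : Pt d) :
    P.expWidth u = P.expSupport u + P.expSupport (-u) := by
  classical
  simp only [expWidth, expSupport, UncertainKernel.expSupport, image_extendPt, dirWidth,
    ← Finset.sum_add_distrib, mul_add, Finset.image_image]
  rfl

theorem Locational.sum_prob_cells {d n m : ℕ} (P : Locational d n m) (v : ℕ) (p : ℕ → Prop)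
    [DecidablePred p] :
    ∑ s ∈ Finset.range m with p s ∧ cells (fun s : Fin m => (P.owner s : ℕ)) s = v,
      cells P.prob s =
      ∑ s : Fin m, if p s ∧ (P.owner s : ℕ) = v then P.prob s else 0 := by
  rw [Finset.sum_filter, Finset.sum_range]
  exact Finset.sum_congr rfl fun s _ => by simp only [cells_val]

open Classical in
/-- Expanding the product over the points gives the sum over all realizations. Here the factor of
each point is the sum of the probabilities of its locations outside of `F`, because all of its
probabilities sum to `1`. -/
theorem Locational.survival_eq {d n m : ℕ} (P : Locational d n m) (F : Finset ℕ) :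
    survival n (cells fun s : Fin m => (P.owner s : ℕ)) (cells P.prob) F =
      ∑ c, P.realizationProb c *
        if Disjoint ((Finset.univ.image c).map Fin.valEmbedding) F then 1 else 0 := by
  have h1 : survival n (cells fun s : Fin m => (P.owner s : ℕ)) (cells P.prob) F =
      ∏ v : Fin n, ∑ s : Fin m,
        if P.owner s = v then (if (s : ℕ) ∈ F then 0 else P.prob s) else 0 := by
    rw [survival, Finset.prod_range]
    refine Finset.prod_congr rfl fun v _ => ?_
    have h2 : ∑ s ∈ F with cells (fun s : Fin m => (P.owner s : ℕ)) s = (v : ℕ), cells P.prob s =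
        ∑ s : Fin m, if P.owner s = v then (if (s : ℕ) ∈ F then P.prob s else 0) else 0 := by
      have h3 := P.sum_prob_cells v (· ∈ F)
      have h4 : ∑ s ∈ F with cells (fun s : Fin m => (P.owner s : ℕ)) s = (v : ℕ), cells P.prob s =
          ∑ s ∈ Finset.range m with s ∈ F ∧ cells (fun s : Fin m => (P.owner s : ℕ)) s = (v : ℕ),
            cells P.prob s := by
        symm
        refine Finset.sum_subset (fun s hs => ?_) fun s hs hs' => ?_
        · simp only [Finset.mem_filter] at hs ⊢; exact hs.2
        · simp only [Finset.mem_filter, Finset.mem_range] at hs hs'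
          have : ¬ s < m := fun h => hs' ⟨h, hs⟩
          simp [cells, this]
      rw [h4, h3]
      refine Finset.sum_congr rfl fun s _ => ?_
      simp only [Fin.val_inj]
      split_ifs <;> simp_all
    rw [h2, ← P.sum_prob v, Finset.sum_filter, ← Finset.sum_sub_distrib]
    refine Finset.sum_congr rfl fun s _ => ?_
    split_ifs <;> ring
  rw [h1, Fintype.prod_sum]
  refine Finset.sum_congr rfl fun c _ => ?_
  rw [realizationProb]
  split_ifs with h
  · rw [mul_one]
    refine Finset.prod_congr rfl fun v _ => ?_
    have : ((c v : Fin m) : ℕ) ∉ F := Finset.disjoint_left.1 h (by simp)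
    rw [if_neg this]
  · rw [Finset.not_disjoint_iff] at h
    obtain ⟨j, hj, hjF⟩ := h
    obtain ⟨i, hi, rfl⟩ := Finset.mem_map.1 hj
    obtain ⟨v, _, rfl⟩ := Finset.mem_image.1 hi
    rw [mul_zero]
    exact Finset.prod_eq_zero (Finset.mem_univ v) (by
      rw [if_pos (show ((c v : Fin m) : ℕ) ∈ F by simpa using hjF)]; simp)

theorem Locational.realizationProb_nonneg {d n m : ℕ} (P : Locational d n m) (c : Fin n → Fin m) :
    0 ≤ P.realizationProb c :=
  Finset.prod_nonneg fun v _ => by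
    split_ifs
    exacts [P.prob_nonneg _, le_rfl]

/-- Locationally uncertain points. -/
def Locational.model {d n m : ℕ} (P : Locational d n m) : Model d m where
  loc := extendPt P.loc
  owner := cells fun s : Fin m => (P.owner s : ℕ)
  prob := cells P.prob
  n := n
  H := P.expSupport
  prob_nonneg s := by
    unfold cells; split_ifs
    exacts [P.prob_nonneg _, le_rfl]
  sum_prob_le v := by
    have h := P.sum_prob_cells v (fun _ => True)
    simp only [true_and] at h
    rw [h]
    by_cases hv : v < n
    · rw [← P.sum_prob ⟨v, hv⟩, Finset.sum_filter]
      exact le_of_eq (Finset.sum_congr rfl fun s _ => by simp [Fin.ext_iff])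
    · rw [Finset.sum_eq_zero]
      · exact zero_le_one
      · intro s _
        rw [if_neg]
        rintro rfl
        exact hv (P.owner s).2
  owner_lt s h := by simp [cells, h]
  exists_extreme u := exists_isExtreme_expSupport _ _ _ P.realizationProb_nonneg u
  extreme a u h1 h2 h3 := isExtreme_expSupport _ _ _ P.realizationProb_nonneg
      (fun c => map_val_subset _) (fun F => by convert P.survival_eq F) a u h1 h2 h3

end UncertainKernel

namespace UncertainKernel

/-! ### The program that finds an extreme point -/

/-- The memory holds the data of the model `M`. -/
structure HoldsModel {d m : ℕ} (M : Model d m) (s : Store) : Prop where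
  nv0 : s.natVar 0 = m
  loc : ∀ i < m, ∀ j : Fin d, s.realArr 8 (i * d + j) = M.loc i j
  prob : ∀ i < m, s.realArr 1 i = M.prob i
  owner : ∀ i < m, s.natArr 0 i = M.owner i

theorem HoldsModel.frame {d m : ℕ} {M : Model d m} {s s' : Store} {W : List (ℕ × ℕ)}
    (h : HoldsModel M s) (hF : Frame W s s') (h0 : (0, 0) ∉ W) (h8 : (3, 8) ∉ W)
    (h1 : (3, 1) ∉ W) (h2 : (2, 0) ∉ W) : HoldsModel M s' where
  nv0 := by rw [hF.nv h0, h.nv0]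
  loc := by rw [hF.ra h8]; exact h.loc
  prob := by rw [hF.ra h1]; exact h.prob
  owner := by rw [hF.na h2]; exact h.owner

/-- The first `d` cells of the real array `a` hold the vector `v`. -/
def HoldsVec {d : ℕ} (s : Store) (a : ℕ) (v : Pt d) : Prop := ∀ i : Fin d, s.realArr a i = v i

theorem HoldsVec.frame {d : ℕ} {s s' : Store} {a : ℕ} {v : Pt d} {W : List (ℕ × ℕ)}
    (h : HoldsVec s a v) (hF : Frame W s s') (ha : (3, a) ∉ W) : HoldsVec s' a v := by
  unfold HoldsVec
  rw [hF.ra ha]; exact h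

theorem inner_eq_sum {d : ℕ} (u p : Pt d) : inner ℝ u p = ∑ j, u j * p j := by
  simp [PiLp.inner_apply, mul_comm]

/-- The cell of coordinate `j` of the location with index `i`. -/
def locCoord (d : ℕ) (i : NExp) (j : ℕ) : RExp := .arr 8 (.add (NExp.mulc d i) (.const j))

/-- The inner product of the direction in real array `4` with the location `i`. -/
def locKey (d : ℕ) (i : NExp) : RExp :=
  .sum d fun j => .mul (.arr 4 (.const j)) (locCoord d i j)

theorem HoldsModel.val_locCoord {d m : ℕ} {M : Model d m} {s : Store} (h : HoldsModel M s)
    {i : NExp} (hi : i.val s < m) (j : Fin d) :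
    (locCoord d i j).val s = M.loc (i.val s) j := by
  simp [locCoord, RExp.val, NExp.val, h.loc _ hi]

theorem HoldsModel.val_locKey {d m : ℕ} {M : Model d m} {s : Store} (h : HoldsModel M s)
    {u : Pt d} (hu : HoldsVec s 4 u) {i : NExp} (hi : i.val s < m) :
    (locKey d i).val s = inner ℝ u (M.loc (i.val s)) := by
  rw [inner_eq_sum, locKey, RExp.val_sum]
  refine Finset.sum_congr rfl fun j _ => ?_
  simp only [RExp.val, NExp.val, h.val_locCoord hi, hu j]

/-- Compute the keys of all locations, and initialize the order of the locations and the remaining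
probabilities of the points. -/
def prepareKeys (d : ℕ) : Prog :=
  forVar 10 (.var 0)
    (.seq (.setNatArr 1 (.var 10) (.var 10))
      (.seq (.setRealArr 2 (.var 10) (locKey d (.var 10)))
        (.setRealArr 3 (.arr 0 (.var 10)) (.const 1))))

/-- The probability of the location in natural number variable `11`. -/
def curProb : RExp := .arr 1 (.var 11)

/-- The remaining probability of the owner of the location in natural number variable `11`. -/
def curRest : RExp := .arr 3 (.arr 0 (.var 11))

/-- Process the location in natural number variable `11`: real variable `1` holds the survival
probability of the locations before it, real variable `2` receives the probability that it is the
first one present, real array `3` holds the remaining probabilities of the points, and real array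
`5` the sum. The quotient is by `0` only if the probability of the location is `0`, and then the
junk value is harmless by `survival_insert`. -/
def addLocation (d : ℕ) : Prog :=
  .seq (.setReal 2 (.mul (.div (.var 1) curRest) curProb))
    (.seq (.setReal 1 (.mul (.div (.var 1) curRest) (.sub curRest curProb)))
      (.seq (.setRealArr 3 (.arr 0 (.var 11)) (.sub curRest curProb))
        (setCells 5 (.const 0) d fun j =>
          .add (.arr 5 (.const j)) (.mul (.var 2) (locCoord d (.var 11) j)))))

/-- Compute the expectation of the first location that is present. The array is sorted by ascending
keys, hence processed from its end. -/
def sumLocations (d : ℕ) : Prog :=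
  .seq (setCells 5 (.const 0) d fun _ => .const 0)
    (.seq (.setReal 1 (.const 1))
      (forVar 10 (.var 0)
        (.seq (.setNat 11 (.arr 1 (.sub (.sub (.var 0) (.const 1)) (.var 10)))) (addLocation d))))

/-- Store an extreme point in the direction of real array `4` in real array `5`. -/
def findExtreme (d : ℕ) : Prog := .seq (prepareKeys d) (.seq heapSort (sumLocations d))

/-- The cells that `findExtreme` changes. -/
def extremeCells : List (ℕ × ℕ) :=
  [(0, 6), (0, 7), (0, 8), (0, 9), (0, 10), (0, 11), (2, 1), (3, 2), (3, 3), (3, 5), (1, 1), (1, 2)]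

/-- The cells that `sumLocations` changes. -/
def sumCells : List (ℕ × ℕ) := [(0, 10), (0, 11), (1, 1), (1, 2), (3, 3), (3, 5)]

theorem writesIn_findExtreme (d : ℕ) : (findExtreme d).WritesIn extremeCells := by
  refine ⟨?_, writesIn_heapSort.mono (by simp [sortCells, extremeCells]), ?_⟩
  · simp [prepareKeys, forVar, Prog.WritesIn, extremeCells]
  · simp [sumLocations, addLocation, forVar, Prog.WritesIn, extremeCells]

theorem exec_prepareKeys {d m : ℕ} {M : Model d m} {s : Store} {u : Pt d} (h : HoldsModel M s)
    (hu : HoldsVec s 4 u) :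
    Exec (prepareKeys d) s ((m + 1) * ((locKey d (.var 10)).cost + 30)) (fun s' =>
      (∀ i < m, s'.natArr 1 i = i ∧ s'.realArr 2 i = inner ℝ u (M.loc i) ∧
        s'.realArr 3 (M.owner i) = 1)) := by
  refine (exec_forVar (n := m) (T := (locKey d (.var 10)).cost + 14)
    (fun x s' => HoldsModel M s' ∧ HoldsVec s' 4 u ∧
      ∀ i < x, s'.natArr 1 i = i ∧ s'.realArr 2 i = inner ℝ u (M.loc i) ∧
        s'.realArr 3 (M.owner i) = 1) ?_ ?_ ?_).mono ?_ fun s' h' => h'.2.2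
  · exact ⟨h.frame (frame_setNat (W := [(0, 10)]) (by simp) _ _) (by simp) (by simp) (by simp)
      (by simp), hu, by simp⟩
  · rintro x s' ⟨h, -⟩; exact h.nv0
  · rintro x hx s' ⟨hM, hu, hs⟩ h10
    refine (Exec.seq (Exec.setNatArr (Exec.seq (Exec.setRealArr (Exec.setRealArr ?_))))).mono
      (by simp [NExp.cost, RExp.cost]; omega) fun _ h => h
    set s₁ : Store := s'.setNatArr 1 _ _ with hs₁
    have hM₁ : HoldsModel M s₁ := hM.frame (frame_setNatArr (W := [(2, 1)]) (by simp) _ _ _)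
      (by simp) (by simp) (by simp) (by simp)
    have hk := hM₁.val_locKey (u := u) (i := .var 10) hu (by simpa [hs₁, NExp.val, h10] using hx)
    simp only [hk]
    have e1 : s₁.natVar 10 = x := h10
    have e2 : s₁.natArr 0 x = M.owner x := hM₁.owner x hx
    have e3 : s₁.natArr 1 = Function.update (s'.natArr 1) x x := by simp [hs₁, NExp.val, h10]
    simp only [NExp.val, RExp.val, Store.setRealArr_natVar, Store.setRealArr_natArr, e1, e2]
    refine ⟨by simp, ⟨?_, ?_, ?_, ?_⟩, ?_, ?_⟩
    · simpa using hM₁.nv0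
    · simpa using hM₁.loc
    · simpa using hM₁.prob
    · simpa using hM₁.owner
    · simpa [HoldsVec, hs₁] using hu
    · intro i hi
      simp only [Store.setNat_natArr, Store.setNat_realArr, Store.setRealArr_natArr,
        Store.setRealArr_realArr, e3, Function.update_apply]
      rcases Nat.lt_succ_iff_lt_or_eq.1 hi with h | rfl
      · obtain ⟨h1, h2, h3⟩ := hs i h
        simp only [hs₁, Store.setNatArr_realArr, if_neg h.ne]
        simp [Function.update_apply, h.ne, h1, h2, h3]
      · simp
  · refine Nat.mul_le_mul_left _ ?_
    simp [NExp.cost]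

theorem prob_le_rest {d m : ℕ} (M : Model d m) {F : Finset ℕ} (hF : F ⊆ Finset.range m) {s : ℕ}
    (hs : s < m) (hsF : s ∉ F) :
    M.prob s ≤ 1 - ∑ t ∈ F with M.owner t = M.owner s, M.prob t := by
  have h1 : ∑ t ∈ insert s F with M.owner t = M.owner s, M.prob t ≤ 1 :=
    (Finset.sum_le_sum_of_subset_of_nonneg (Finset.filter_subset_filter _
      (Finset.insert_subset (Finset.mem_range.2 hs) hF)) fun i _ _ => M.prob_nonneg i).trans
      (M.sum_prob_le (M.owner s))
  rw [Finset.filter_insert, if_pos rfl, Finset.sum_insert (by simp [hsF])] at h1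
  linarith

/-- The state of `sumLocations` after the first `x` locations in the order `a`. -/
structure SumState {d m : ℕ} (M : Model d m) (a : ℕ → ℕ) (x : ℕ) (s : Store) : Prop where
  survival : s.realVar 1 = survival M.n M.owner M.prob (firstLocs a x)
  rest : ∀ i < m, s.realArr 3 (M.owner i) =
    1 - ∑ t ∈ firstLocs a x with M.owner t = M.owner i, M.prob t
  point : HoldsVec s 5 (∑ k ∈ Finset.range x, (UncertainKernel.survival M.n M.owner M.prob
    (firstLocs a k) - UncertainKernel.survival M.n M.owner M.prob (firstLocs a (k + 1))) •
      M.loc (a k))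

/-- The running time of `addLocation`. -/
def addLocationTime (d : ℕ) : ℕ :=
  50 + setCellsTime (.const 0) d fun j =>
    .add (.arr 5 (.const j)) (.mul (.var 2) (locCoord d (.var 11) j))

theorem exec_addLocation {d m : ℕ} {M : Model d m} {s : Store} {a : ℕ → ℕ} {x : ℕ}
    (hM : HoldsModel M s) (hinj : Set.InjOn a (Finset.range m)) (hlt : ∀ k < m, a k < m)
    (hx : x < m) (hs : SumState M a x s) (h11 : s.natVar 11 = a x) :
    Exec (addLocation d) s (addLocationTime d) (SumState M a (x + 1)) := by
  have hax := hlt x hx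
  have hnot : a x ∉ firstLocs a x := by
    intro h
    obtain ⟨k, hk, he⟩ := Finset.mem_image.1 h
    have hk' := Finset.mem_range.1 hk
    have := hinj (Finset.mem_coe.2 (Finset.mem_range.2 (hk'.trans hx)))
      (Finset.mem_coe.2 (Finset.mem_range.2 hx)) he
    omega
  have hsub : firstLocs a x ⊆ Finset.range m := by
    intro s hs
    obtain ⟨k, hk, rfl⟩ := Finset.mem_image.1 hs
    exact Finset.mem_range.2 (hlt k ((Finset.mem_range.1 hk).trans hx))
  obtain ⟨hw, hT⟩ := survival_insert (n := M.n) hnot (M.owner_lt _ hax) (M.prob_nonneg _) rfl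
    (prob_le_rest M hsub hax hnot)
  rw [← firstLocs_succ] at hw hT
  set R := 1 - ∑ t ∈ firstLocs a x with M.owner t = M.owner (a x), M.prob t with hR
  have e1 : s.natArr 0 (a x) = M.owner (a x) := hM.owner _ hax
  have e2 : s.realArr 3 (M.owner (a x)) = R := hs.rest _ hax
  have e3 : s.realArr 1 (a x) = M.prob (a x) := hM.prob _ hax
  have hindep : ∀ (s₀ : Store), ∀ j < d, ∀ s', Frame [(3, 5)] s₀ s' →
      (∀ i, i < 0 ∨ 0 + j ≤ i → s'.realArr 5 i = s₀.realArr 5 i) →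
      RExp.val s' (.add (.arr 5 (.const j)) (.mul (.var 2) (locCoord d (.var 11) j))) =
        RExp.val s₀ (.add (.arr 5 (.const j)) (.mul (.var 2) (locCoord d (.var 11) j))) := by
    intro s₀ j hj s' hF hsame
    simp only [RExp.val, NExp.val, locCoord, NExp.val_mulc]
    rw [hsame j (by omega), hF.rv (by simp), hF.ra (by simp), hF.nv (by simp)]
  refine (Exec.seq (Exec.setReal (Exec.seq (Exec.setReal (Exec.seq (Exec.setRealArr
    ((exec_setCells 5 (.const 0) d _ _ 0 rfl (hindep _)).mono le_rfl ?_))))))).mono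
    (by simp [NExp.cost, RExp.cost, addLocationTime, curRest, curProb]; omega) fun _ h => h
  · rintro s' ⟨hF, hc, -⟩
    simp only [RExp.val, NExp.val, curRest, curProb, Store.setReal_natVar,
      Store.setReal_natArr, Store.setReal_realArr, Store.setReal_realVar,
      Store.setRealArr_realVar, Store.setRealArr_realArr,
      h11, e1, e2, e3, hs.survival, if_true, hw] at hF hc
    norm_num [hT] at hF hc
    refine ⟨?_, ?_, ?_⟩
    · rw [hF.rv (by simp)]; simp
    · intro i hi
      rw [hF.ra (by simp)]
      simp only [Store.setRealArr_realArr, if_true, Store.setReal_realArr, Function.update_apply]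
      rw [firstLocs_succ, Finset.filter_insert]
      by_cases h : M.owner i = M.owner (a x)
      · rw [if_pos h, if_pos h.symm, Finset.sum_insert (by simp [hnot]), hR, h]; ring
      · rw [if_neg h, if_neg (Ne.symm h), hs.rest i hi]
    · intro j
      rw [hc j j.2, Finset.sum_range_succ, PiLp.add_apply, ← hs.point j]
      congr 1
      rw [PiLp.smul_apply, smul_eq_mul]
      congr 1
      simp only [locCoord, RExp.val, NExp.val, NExp.val_mulc, Store.setRealArr_natVar,
        Store.setReal_natVar, h11, Store.setRealArr_realArr, Store.setReal_realArr]
      simpa using hM.loc _ hax j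

theorem exec_sumLocations {d m : ℕ} {M : Model d m} {s : Store} {a : ℕ → ℕ}
    (hM : HoldsModel M s) (hinj : Set.InjOn a (Finset.range m)) (hlt : ∀ k < m, a k < m)
    (ha : ∀ k < m, s.natArr 1 (m - 1 - k) = a k) (hR : ∀ i < m, s.realArr 3 (M.owner i) = 1) :
    Exec (sumLocations d) s
      (setCellsTime (.const 0) d (fun _ => .const 0) + (m + 1) * (addLocationTime d + 30))
      (SumState M a m) := by
  have hf : ∀ k, (firstLocs a 0).filter (fun t => M.owner t = k) = ∅ := by simp [firstLocs]
  refine (Exec.seq ((exec_setCells 5 (.const 0) d _ _ 0 rfl ?_).mono le_rfl ?_)).mono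
    (le_of_eq rfl) fun _ h => h
  · exact fun _ _ _ _ _ => rfl
  · rintro s₁ ⟨hF₁, hc, -⟩
    simp only [zero_add, RExp.val] at hc
    refine (Exec.seq (Exec.setReal (exec_forVar (n := m) (T := addLocationTime d + 10)
      (fun x s' => Frame sumCells s s' ∧ SumState M a x s') ?_ ?_ ?_))).mono ?_ fun _ h => h.2
    · have hF' : Frame [(1, 1), (0, 10)] s₁
          ((s₁.setReal 1 ((RExp.const 1).val s₁)).setNat 10 0) :=
        Runs.frame (.seq (.setReal _ _ _) (.setNat _ _ (.const 0))) (by simp [Prog.WritesIn])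
      refine ⟨(hF₁.mono (by simp [sumCells])).trans (hF'.mono (by simp [sumCells])), ?_, ?_, ?_⟩
      · simp only [Store.setNat_realVar, Store.setReal_realVar, if_true, RExp.val, survival, hf]
        simp
      · intro i hi
        rw [hF'.ra (by simp), hF₁.ra (by simp), hR i hi, hf]; simp
      · intro j
        rw [hF'.ra (by simp), hc j j.2]; simp
    · rintro x s' ⟨hF, -⟩
      exact (hF.nv (by simp [sumCells])).trans hM.nv0
    · rintro x hx s' ⟨hF, hS⟩ h10
      have hM' : HoldsModel M s' := hM.frame hF (by simp [sumCells]) (by simp [sumCells])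
        (by simp [sumCells]) (by simp [sumCells])
      have h11 : NExp.val s' (.arr 1 (.sub (.sub (.var 0) (.const 1)) (.var 10))) = a x := by
        simp only [NExp.val, h10, hM'.nv0, hF.na (show (2, 1) ∉ sumCells by simp [sumCells])]
        exact ha x hx
      refine (Exec.seq (Exec.setNat (((exec_addLocation (a := a) (x := x) (M := M) ?_ hinj hlt hx
        ?_ ?_).frame (W := [(1, 1), (1, 2), (3, 3), (3, 5)]) ?_).mono le_rfl ?_))).mono
        (by simp [NExp.cost]; omega) fun _ h => h
      · exact hM'.frame (frame_setNat (W := [(0, 11)]) (by simp) _ _) (by simp) (by simp)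
          (by simp) (by simp)
      · exact ⟨hS.survival, hS.rest, hS.point⟩
      · rw [h11]; simp
      · simp [addLocation, Prog.WritesIn]
      · rintro s'' ⟨hS', hF'⟩
        refine ⟨?_, ?_, ⟨hS'.survival, hS'.rest, hS'.point⟩⟩
        · rw [hF'.nv (by simp)]; simpa using h10
        · exact hF.trans ((frame_setNat (by simp [sumCells]) _ _).trans
            ((hF'.mono (by simp [sumCells])).trans (frame_setNat (by simp [sumCells]) _ _)))
    · simp only [RExp.cost, NExp.cost]
      have : (m + 1) * (addLocationTime d + 30) =
        (m + 1) * (addLocationTime d + 10 + 1 + 8) + 11 * m + 11 := by ring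
      omega

theorem exists_exec_findExtreme (d : ℕ) : ∃ K : ℕ, ∀ {m : ℕ} (M : Model d m) (s : Store)
    (u : Pt d), HoldsModel M s → HoldsVec s 4 u →
    Exec (findExtreme d) s (K * ((m + 1) * (Nat.log 2 m + 1))) (fun s' =>
      (∃ p, IsExtreme M.H u p ∧ HoldsVec s' 5 p) ∧ Frame extremeCells s s') := by
  refine ⟨(locKey d (.var 10)).cost + 30 + 220 +
    (setCellsTime (.const 0) d (fun _ => .const 0) + addLocationTime d + 30),
    fun {m} M s u hM hu => ?_⟩
  have hW := writesIn_findExtreme d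
  refine Exec.frame (Exec.mono (Exec.seq (((exec_prepareKeys hM hu).frame hW.1).mono le_rfl
    fun s₁ h₁ => Exec.seq ((exec_heapSort s₁ m ?_).mono le_rfl fun s₂ h₂ =>
      (?_ : Exec _ _ (setCellsTime (.const 0) d (fun _ => .const 0) +
        (m + 1) * (addLocationTime d + 30)) _)))) ?_ fun _ h => h) hW
  · rw [h₁.2.nv (by simp [extremeCells]), hM.nv0]
  · obtain ⟨h₁, hF₁⟩ := h₁
    obtain ⟨hp, hsort, hF₂⟩ := h₂
    obtain ⟨π, hπ, hπa⟩ := hp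
    have ha : ∀ i < m, s₂.natArr 1 i = π i := fun i hi => by
      rw [hπa]; exact (h₁ _ (perm_lt_of_fix hπ hi)).1
    have hM₂ : HoldsModel M s₂ := (hM.frame hF₁ (by simp [extremeCells]) (by simp [extremeCells])
      (by simp [extremeCells]) (by simp [extremeCells])).frame hF₂ (by simp [sortCells])
      (by simp [sortCells]) (by simp [sortCells]) (by simp [sortCells])
    have hinj : Set.InjOn (fun k => π (m - 1 - k)) (Finset.range m) := by
      intro k hk l hl h
      have := π.injective h
      simp at hk hl
      omega
    have hlt : ∀ k < m, π (m - 1 - k) < m := fun k hk => perm_lt_of_fix hπ (by omega)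
    refine (exec_sumLocations hM₂ hinj hlt (fun k hk => ha _ (by omega)) ?_).mono le_rfl
      fun s₃ h₃ => ⟨_, M.extreme _ u hinj hlt ?_, h₃.point⟩
    · intro i hi
      rw [hF₂.ra (by simp [sortCells])]
      exact (h₁ i hi).2.2
    · intro i j hij hj
      have := hsort (m - 1 - j) (m - 1 - i) (by omega) (by omega)
      rwa [ha _ (by omega), ha _ (by omega), (h₁ _ (hlt j hj)).2.1,
        (h₁ _ (hlt i (by omega))).2.1] at this
  · set L := (m + 1) * (Nat.log 2 m + 1) with hL
    have h1 : m + 1 ≤ L := Nat.le_mul_of_pos_right _ (by omega)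
    have h2 : (m + 1) * (Nat.log 2 m * 120 + 220) ≤ 220 * L := by
      rw [hL, mul_left_comm]
      exact Nat.mul_le_mul_left _ (by omega)
    set Z := setCellsTime (.const 0) d (fun _ => .const 0)
    have h3 : Z ≤ Z * L := Nat.le_mul_of_pos_right _ (by omega)
    have h4 := Nat.mul_le_mul_right ((locKey d (.var 10)).cost + 30) h1
    have h5 := Nat.mul_le_mul_right (addLocationTime d + 30) h1
    nlinarith

end UncertainKernel

namespace UncertainKernel

/-! ### Bases adapted to a convex body -/

/-- The width of the body with support function `H` in direction `v`. -/
def width {d : ℕ} (H : Pt d → ℝ) (v : Pt d) : ℝ := H v + H (-v)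

section Width

variable {d : ℕ} {H : Pt d → ℝ}

theorem IsExtreme.inner_sub_le {u v p q : Pt d} (hp : IsExtreme H u p) {w : Pt d}
    (hq : IsExtreme H w q) : inner ℝ v (p - q) ≤ width H v := by
  have h1 := hp.2 v
  have h2 := hq.2 (-v)
  rw [inner_neg_left] at h2
  rw [inner_sub_right]; unfold width; linarith

theorem width_neg (v : Pt d) : width H (-v) = width H v := by
  unfold width; rw [neg_neg, add_comm]

theorem IsExtreme.abs_inner_sub_le {u v p q : Pt d} (hp : IsExtreme H u p) {w : Pt d}
    (hq : IsExtreme H w q) : |inner ℝ v (p - q)| ≤ width H v := by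
  refine abs_le.2 ⟨?_, hp.inner_sub_le hq⟩
  have := hp.inner_sub_le hq (v := -v)
  rw [inner_neg_left, width_neg] at this
  linarith

theorem IsExtreme.inner_sub_nonneg {u p q : Pt d} (hp : IsExtreme H u p) {w : Pt d}
    (hq : IsExtreme H w q) : 0 ≤ inner ℝ u (p - q) := by
  rw [inner_sub_right, hp.1]; linarith [hq.2 u]

theorem width_eq_inner {u p q : Pt d} (hp : IsExtreme H u p) (hq : IsExtreme H (-u) q) :
    inner ℝ u (p - q) = width H u := by
  have h := hq.1
  rw [inner_neg_left] at h
  rw [inner_sub_right, hp.1]; unfold width; linarith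

theorem width_nonneg (hH : ∀ u, ∃ p, IsExtreme H u p) (v : Pt d) : 0 ≤ width H v := by
  obtain ⟨p, hp⟩ := hH v
  simpa using hp.inner_sub_le hp (v := v)

theorem width_sub_smul_le (hH : ∀ u, ∃ p, IsExtreme H u p) (v w : Pt d) (c : ℝ) :
    width H (v - c • w) ≤ width H v + |c| * width H w := by
  obtain ⟨p, hp⟩ := hH (v - c • w)
  obtain ⟨q, hq⟩ := hH (-(v - c • w))
  rw [← width_eq_inner hp hq, inner_sub_left, inner_smul_left]
  have h1 := hp.inner_sub_le hq (v := v)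
  have h2 := mul_le_mul_of_nonneg_left (hp.abs_inner_sub_le hq (v := w)) (abs_nonneg c)
  rw [← abs_mul] at h2
  have h3 := neg_abs_le (c * inner ℝ w (p - q))
  simp only [conj_trivial]
  linarith

theorem width_smul_le (hH : ∀ u, ∃ p, IsExtreme H u p) (v : Pt d) (c : ℝ) :
    width H (c • v) ≤ |c| * width H v := by
  obtain ⟨p, hp⟩ := hH (c • v)
  obtain ⟨q, hq⟩ := hH (-(c • v))
  rw [← width_eq_inner hp hq, inner_smul_left]
  have h2 := mul_le_mul_of_nonneg_left (hp.abs_inner_sub_le hq (v := v)) (abs_nonneg c)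
  rw [← abs_mul] at h2
  simp only [conj_trivial]
  exact (le_abs_self _).trans h2

/-- The vectors `u j` span the space, and for `j < k` the body has width at most `2 ^ k` in
direction `u j`; unless this width is `0`, the difference body contains a vector `b` with
`⟨u j, b⟩ = 1` that is orthogonal to all other `u i`. -/
def IsFat (H : Pt d → ℝ) (k : ℕ) (u : Fin d → Pt d) : Prop :=
  (∀ v, ∃ c : Fin d → ℝ, v = ∑ j, c j • u j) ∧
  ∀ j : Fin d, (j : ℕ) < k → width H (u j) ≤ 2 ^ k ∧ (width H (u j) = 0 ∨
    ∃ b, (∀ v, inner ℝ v b ≤ width H v) ∧ inner ℝ (u j) b = 1 ∧ ∀ i, i ≠ j → inner ℝ (u i) b = 0)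

theorem isFat_single (H : Pt d → ℝ) :
    IsFat H 0 (fun j : Fin d => EuclideanSpace.single j (1 : ℝ)) := by
  refine ⟨fun v => ⟨fun j => v j, ?_⟩, fun j hj => absurd hj (Nat.not_lt_zero _)⟩
  ext i
  simp [Finset.sum_apply, Pi.single_apply]

/-- One step of Gauss-Jordan elimination with the pivot `k`. -/
def eliminate (u : Fin d → Pt d) (k : Fin d) (b : Pt d) (j : Fin d) : Pt d :=
  if j = k then (inner ℝ (u k) b)⁻¹ • u k
  else u j - (inner ℝ (u j) b : ℝ) • ((inner ℝ (u k) b : ℝ)⁻¹ • u k)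

theorem IsFat.succ_of_width_eq_zero {k : Fin d} {u : Fin d → Pt d} (h : IsFat H k u)
    (hw : width H (u k) = 0) : IsFat H (k + 1) u := by
  refine ⟨h.1, fun j hj => ?_⟩
  rcases Nat.lt_succ_iff_lt_or_eq.1 hj with hj | hj
  · exact ⟨(h.2 j hj).1.trans (pow_le_pow_right₀ (by norm_num) (by omega)), (h.2 j hj).2⟩
  · rw [Fin.ext hj]
    exact ⟨by rw [hw]; positivity, Or.inl hw⟩

/-- The elimination step at most doubles the widths in the other directions, since
`|⟨u j, b⟩| ≤ width H (u j)` and the width in the direction of the pivot is normalized to `1`. -/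
theorem IsFat.eliminate (hH : ∀ u, ∃ p, IsExtreme H u p) {k : Fin d} {u : Fin d → Pt d}
    (h : IsFat H k u) {p q : Pt d} (hp : IsExtreme H (u k) p) (hq : IsExtreme H (-u k) q)
    (hw : 0 < width H (u k)) : IsFat H (k + 1) (eliminate u k (p - q)) := by
  set b := p - q with hb
  have hwb : inner ℝ (u k) b = width H (u k) := width_eq_inner hp hq
  set w := width H (u k) with hwdef
  have hbv : ∀ v, inner ℝ v b ≤ width H v := fun v => hp.inner_sub_le hq
  have hbv' : ∀ v, |inner ℝ v b| ≤ width H v := fun v => hp.abs_inner_sub_le hq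
  have hk : UncertainKernel.eliminate u k b k = w⁻¹ • u k := by
    simp [UncertainKernel.eliminate, hwb]
  have hj : ∀ j, j ≠ k → UncertainKernel.eliminate u k b j =
      u j - (inner ℝ (u j) b : ℝ) • (w⁻¹ • u k) := by
    intro j hj; simp [UncertainKernel.eliminate, hwb, hj]
  have hk1 : width H (w⁻¹ • u k) ≤ 1 := by
    refine (width_smul_le hH _ _).trans ?_
    rw [abs_of_pos (inv_pos.2 hw), ← hwdef, inv_mul_cancel₀ hw.ne']
  have hj2 : ∀ j, j ≠ k → width H (UncertainKernel.eliminate u k b j) ≤ 2 * width H (u j) := by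
    intro j hjk
    rw [hj j hjk]
    refine (width_sub_smul_le hH _ _ _).trans ?_
    have := mul_le_mul (hbv' (u j)) hk1 (width_nonneg hH _) (width_nonneg hH (u j))
    linarith
  refine ⟨fun v => ?_, fun j hjk => ?_⟩
  · -- only the coefficient of the pivot row changes
    obtain ⟨c, hc⟩ := h.1 v
    refine ⟨fun j => if j = k then ∑ i, c i * inner ℝ (u i) b else c j, ?_⟩
    dsimp only
    rw [← Finset.add_sum_erase _ _ (Finset.mem_univ k), hk]
    rw [Finset.sum_congr rfl (g := fun j => c j • u j - (c j * inner ℝ (u j) b) • (w⁻¹ • u k))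
      (fun j hj' => by
        rw [if_neg (Finset.ne_of_mem_erase hj'), hj j (Finset.ne_of_mem_erase hj'), smul_sub,
          smul_smul])]
    rw [Finset.sum_sub_distrib, ← Finset.sum_smul, if_pos rfl,
      ← Finset.add_sum_erase _ (fun i => c i * inner ℝ (u i) b) (Finset.mem_univ k), add_smul,
      hwb, mul_smul, smul_smul w, mul_inv_cancel₀ hw.ne', one_smul, hc,
      ← Finset.add_sum_erase _ _ (Finset.mem_univ k)]
    abel
  · by_cases hjk' : j = k
    · subst hjk'
      rw [hk]
      refine ⟨hk1.trans (one_le_pow₀ (by norm_num)), Or.inr ⟨b, hbv, ?_, fun i hi => ?_⟩⟩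
      · rw [inner_smul_left, hwb]
        simp [hw.ne']
      · rw [hj i hi, inner_sub_left, inner_smul_left, inner_smul_left, hwb]
        simp [hw.ne']
    · have hlt : (j : ℕ) < k := by
        have : (j : ℕ) ≠ k := fun h => hjk' (Fin.ext h)
        omega
      obtain ⟨h1, h2⟩ := h.2 j hlt
      refine ⟨(hj2 j hjk').trans (by rw [pow_succ]; linarith), ?_⟩
      rcases h2 with h2 | ⟨b', hb1, hb2, hb3⟩
      · left
        have := hj2 j hjk'
        rw [h2, mul_zero] at this
        exact le_antisymm this (width_nonneg hH _)
      · -- the vector `b'` of row `j` is orthogonal to the pivot row, so it is still dual to row `j`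
        right
        have hk0 : inner ℝ (w⁻¹ • u k) b' = 0 := by
          rw [inner_smul_left, hb3 k (Ne.symm hjk'), mul_zero]
        refine ⟨b', hb1, ?_, fun i hi => ?_⟩
        · rw [hj j hjk', inner_sub_left, inner_smul_left, hk0, hb2]; simp
        · by_cases hik : i = k
          · rw [hik, hk, hk0]
          · rw [hj i hik, inner_sub_left, inner_smul_left, hk0, hb3 i hi]; simp

end Width

/-! ### Directions of a face, and the covering argument -/

section Cover

variable {e : ℕ} {H : Pt (e + 1) → ℝ}

/-- The sign that belongs to a Boolean value. -/
def sgn (b : Bool) : ℝ := if b then 1 else -1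

/-- The direction with coordinate `± 1` at the basis vector `u k` and the coordinates `x` at the
other ones. The pair `φ` of `k` and the sign is a face of the cube of coordinates. -/
def faceDir (u : Fin (e + 1) → Pt (e + 1)) (φ : Fin (e + 1) × Bool) (x : Fin e → ℝ) : Pt (e + 1) :=
  sgn φ.2 • u φ.1 + ∑ j, x j • u (φ.1.succAbove j)

theorem inner_faceDir_sub (u : Fin (e + 1) → Pt (e + 1)) (φ : Fin (e + 1) × Bool)
    (x y : Fin e → ℝ) (q : Pt (e + 1)) :
    inner ℝ (faceDir u φ x - faceDir u φ y) q =
      ∑ j, (x j - y j) * inner ℝ (u (φ.1.succAbove j)) q := by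
  simp only [faceDir, add_sub_add_left_eq_sub, ← Finset.sum_sub_distrib, ← sub_smul, sum_inner,
    inner_smul_left, conj_trivial]

theorem inner_faceDir_sub_le (u : Fin (e + 1) → Pt (e + 1)) (φ : Fin (e + 1) × Bool)
    {x y : Fin e → ℝ} {q : Pt (e + 1)} {α β : ℝ} (hx : ∀ j, |x j - y j| ≤ α)
    (hq : ∀ j, |inner ℝ (u (φ.1.succAbove j)) q| ≤ β) :
    inner ℝ (faceDir u φ x - faceDir u φ y) q ≤ e * (α * β) := by
  rw [inner_faceDir_sub]
  calc _ ≤ ∑ _j : Fin e, α * β := Finset.sum_le_sum fun j _ => by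
        refine (le_abs_self _).trans ?_
        rw [abs_mul]
        exact mul_le_mul (hx j) (hq j) (abs_nonneg _) ((abs_nonneg _).trans (hx j))
    _ = _ := by simp

/-- The coordinate with coarse digit `X` and fine digit `f`, of resolution `1 / N ^ 2`. -/
def gridCoord (N X f : ℕ) : ℝ := -1 + X / N + f / (N * N)

theorem exists_gridCoord {N : ℕ} (hN : 1 ≤ N) {x : ℝ} (hx : |x| ≤ 1) :
    ∃ X f, X < 2 * N ∧ f < N ∧ |x - gridCoord N X f| ≤ 1 / (N * N) := by
  have hN0 : (0 : ℝ) < N := by exact_mod_cast hN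
  obtain ⟨hx1, hx2⟩ := abs_le.1 hx
  have hy : 0 ≤ (x + 1) * (N * N) := by
    have : 0 ≤ x + 1 := by linarith
    positivity
  -- the minimum matters for `x = 1` only, the right end of the last interval
  set g := min ⌊(x + 1) * (N * N)⌋₊ (2 * N * N - 1) with hg
  have hpos : 1 ≤ 2 * N * N := by
    have : 1 ≤ N * N := Nat.mul_pos hN hN
    have e1 : 2 * N * N = 2 * (N * N) := by ring
    omega
  have hg1 : (g : ℝ) ≤ (x + 1) * (N * N) :=
    (Nat.cast_le.2 (min_le_left _ _)).trans (Nat.floor_le hy)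
  have hg2 : (x + 1) * (N * N) ≤ g + 1 := by
    rcases min_choice ⌊(x + 1) * ((N : ℝ) * N)⌋₊ (2 * N * N - 1) with h | h
    · rw [hg, h]; exact (Nat.lt_floor_add_one _).le
    · rw [hg, h, Nat.cast_sub hpos]
      push_cast
      nlinarith [mul_pos hN0 hN0]
  refine ⟨g / N, g % N, ?_, Nat.mod_lt _ hN, ?_⟩
  · rw [Nat.div_lt_iff_lt_mul (by omega)]
    have : g ≤ 2 * N * N - 1 := min_le_right _ _
    omega
  · have e1 : gridCoord N (g / N) (g % N) = -1 + g / (N * N) := by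
      have : ((N * (g / N) + g % N : ℕ) : ℝ) = g := by rw [Nat.div_add_mod]
      push_cast at this
      rw [gridCoord, ← this]
      field_simp
      ring
    rw [e1, abs_le]
    constructor
    · have : (g : ℝ) / (N * N) ≤ x + 1 := by
        rw [div_le_iff₀ (by positivity)]; exact hg1
      have : (0 : ℝ) ≤ 1 / (N * N) := by positivity
      linarith
    · have : x + 1 ≤ (g + 1) / (N * N) := by
        rw [le_div_iff₀ (by positivity)]; exact hg2
      rw [add_div] at this
      linarith

/-- The point `r` represents the direction with digits `X` and `f` on the face `φ`: it is extreme in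
a direction of the same coarse cell, and its coordinates differ by at most `1 / N` from those of an
extreme point in the given direction. -/
def Represents (H : Pt (e + 1) → ℝ) (u : Fin (e + 1) → Pt (e + 1)) (N : ℕ)
    (φ : Fin (e + 1) × Bool) (X f : Fin e → ℕ) (r : Pt (e + 1)) : Prop :=
  (∃ f' : Fin e → ℕ, (∀ j, f' j < N) ∧
    IsExtreme H (faceDir u φ fun j => gridCoord N (X j) (f' j)) r) ∧
  ∃ p, IsExtreme H (faceDir u φ fun j => gridCoord N (X j) (f j)) p ∧
    ∀ j, |inner ℝ (u (φ.1.succAbove j)) (p - r)| ≤ 1 / N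

theorem abs_gridCoord_sub_le {N : ℕ} (hN : 1 ≤ N) {X f f' : ℕ} (hf : f < N) (hf' : f' < N) :
    |gridCoord N X f - gridCoord N X f'| ≤ 1 / N := by
  have hN0 : (0 : ℝ) < N := by exact_mod_cast hN
  have e1 : gridCoord N X f - gridCoord N X f' = ((f : ℝ) - f') / (N * N) := by
    unfold gridCoord; ring
  have h1 : (f : ℝ) ≤ N := by exact_mod_cast hf.le
  have h2 : (f' : ℝ) ≤ N := by exact_mod_cast hf'.le
  have h3 : (0 : ℝ) ≤ f := by positivity
  have h4 : (0 : ℝ) ≤ f' := by positivity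
  rw [e1, abs_div, abs_of_pos (mul_pos hN0 hN0), div_le_div_iff₀ (mul_pos hN0 hN0) hN0, one_mul]
  refine mul_le_mul_of_nonneg_right ?_ hN0.le
  rw [abs_le]; constructor <;> linarith

/-- Replacing the extreme point of a direction by a representative costs an error of second order:
the directions and the points of a cell both vary by `1 / N`. -/
theorem exists_near_extreme (hH : ∀ u, ∃ p, IsExtreme H u p) {u : Fin (e + 1) → Pt (e + 1)}
    (hu : IsFat H (e + 1) u) {N : ℕ} (hN : 1 ≤ N) {S : Set (Pt (e + 1))}
    (hS : ∀ φ (X f : Fin e → ℕ), (∀ j, X j < 2 * N) → (∀ j, f j < N) →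
      ∃ r ∈ S, Represents H u N φ X f r) (v : Pt (e + 1)) :
    ∃ r ∈ S, H v - inner ℝ v r ≤ e * (2 * 2 ^ (e + 1) + 1) / (N * N) * width H v := by
  obtain ⟨c, hc⟩ := hu.1 v
  -- coordinates in directions of width `0` do not influence the values on the body
  set c' : Fin (e + 1) → ℝ := fun j => if width H (u j) = 0 then 0 else c j with hc'
  obtain ⟨k, hk⟩ := Finite.exists_max fun j => |c' j|
  set A := |c' k| with hA
  have hinner : ∀ p q, (∃ w, IsExtreme H w p) → (∃ w, IsExtreme H w q) →
      inner ℝ v (p - q) = ∑ j, c' j * inner ℝ (u j) (p - q) := by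
    rintro p q ⟨w, hp⟩ ⟨w', hq⟩
    conv_lhs => rw [hc]
    rw [sum_inner]
    refine Finset.sum_congr rfl fun j _ => ?_
    rw [inner_smul_left, conj_trivial, hc']
    dsimp only
    split_ifs with h
    · have := hp.abs_inner_sub_le hq (v := u j)
      rw [h] at this
      rw [abs_nonpos_iff.1 this]; simp
    · rfl
  -- the dual vector of the largest coordinate lies in the difference body
  have hAW : A ≤ width H v := by
    by_cases h0 : width H (u k) = 0
    · rw [hA, hc']; simp [h0, width_nonneg hH]
    · obtain ⟨b, hb1, hb2, hb3⟩ := (hu.2 k k.2).2.resolve_left h0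
      have h1 : inner ℝ v b = c k := by
        rw [hc, sum_inner, Finset.sum_eq_single k]
        · rw [inner_smul_left, hb2]; simp
        · intro j _ hj
          rw [inner_smul_left, hb3 j hj, mul_zero]
        · simp
      have h2 := hb1 v
      have h3 := hb1 (-v)
      rw [inner_neg_left, width_neg] at h3
      rw [hA, hc']
      simp only [h0, if_false]
      rw [abs_le]; constructor <;> linarith
  -- the coordinates of `v`, scaled such that the largest one becomes `± 1`
  obtain ⟨σ, hσ⟩ : ∃ σ : Bool, c' k = A * sgn σ := by
    rcases abs_choice (c' k) with h | h
    · exact ⟨true, by rw [hA, h]; simp [sgn]⟩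
    · exact ⟨false, by rw [hA, h]; simp [sgn]⟩
  set x : Fin e → ℝ := fun j => c' (k.succAbove j) / A with hx
  have hx1 : ∀ j, |x j| ≤ 1 := by
    intro j
    rw [hx, abs_div, abs_of_nonneg (abs_nonneg (c' k) : 0 ≤ A)]
    exact div_le_one_of_le₀ (hk _) (abs_nonneg _)
  have hxA : ∀ j, c' (k.succAbove j) = A * x j := by
    intro j
    rcases eq_or_ne A 0 with h | h
    · have := hk (k.succAbove j)
      rw [h] at this
      rw [h, zero_mul, abs_nonpos_iff.1 this]
    · rw [hx]; field_simp
  choose X f hX hf hXf using fun j => exists_gridCoord hN (hx1 j)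
  obtain ⟨r, hrS, ⟨f', hf', hr⟩, p, hp, hpr⟩ := hS (k, σ) X f hX hf
  refine ⟨r, hrS, ?_⟩
  obtain ⟨pv, hpv⟩ := hH v
  have hN0 : (0 : ℝ) < N := by exact_mod_cast hN
  set y := faceDir u (k, σ) x with hy
  set y₁ := faceDir u (k, σ) (fun j => gridCoord N (X j) (f j)) with hy₁
  set y₂ := faceDir u (k, σ) (fun j => gridCoord N (X j) (f' j)) with hy₂
  have hvy : inner ℝ v (pv - r) = A * inner ℝ y (pv - r) := by
    rw [hinner _ _ ⟨_, hpv⟩ ⟨_, hr⟩, Fin.sum_univ_succAbove _ k, hy, faceDir, inner_add_left,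
      sum_inner, inner_smul_left, mul_add, Finset.mul_sum, hσ]
    simp only [hxA, inner_smul_left, conj_trivial, mul_assoc]
  have hB : ∀ {w w' a a' : Pt (e + 1)}, IsExtreme H w a → IsExtreme H w' a' → ∀ j,
      |inner ℝ (u (k.succAbove j)) (a - a')| ≤ 2 ^ (e + 1) := fun ha ha' j =>
    (ha.abs_inner_sub_le ha').trans (hu.2 _ (Fin.is_lt _)).1
  have e1 : inner ℝ (y - y₁) (pv - p) ≤ e * (1 / (N * N) * 2 ^ (e + 1)) :=
    inner_faceDir_sub_le u (k, σ) hXf (hB hpv hp)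
  have e2 : inner ℝ (y - y₁) (p - r) ≤ e * (1 / (N * N) * 2 ^ (e + 1)) :=
    inner_faceDir_sub_le u (k, σ) hXf (hB hp hr)
  have e3 : inner ℝ (y₁ - y₂) (p - r) ≤ e * (1 / N * (1 / N)) :=
    inner_faceDir_sub_le u (k, σ)
      (fun j => abs_gridCoord_sub_le hN (hf j) (hf' j)) hpr
  have e4 := hp.inner_sub_nonneg hpv
  have e5 := hr.inner_sub_nonneg hp
  -- `pv`, `p`, `r` are extreme for `v`, `y₁`, `y₂`: pass from `y` to `y₁`, and then from `p` to `r`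
  have hsum : inner ℝ y (pv - r) ≤ e * (2 * 2 ^ (e + 1) + 1) / (N * N) := by
    have h1 : inner ℝ y (pv - r) = inner ℝ (y - y₁) (pv - p) - inner ℝ y₁ (p - pv) +
        inner ℝ (y - y₁) (p - r) + inner ℝ (y₁ - y₂) (p - r) - inner ℝ y₂ (r - p) := by
      simp only [inner_sub_left, inner_sub_right]; ring
    have h2 : (e : ℝ) * (2 * 2 ^ (e + 1) + 1) / (N * N) =
        e * (1 / (N * N) * 2 ^ (e + 1)) + e * (1 / (N * N) * 2 ^ (e + 1)) +
        e * (1 / N * (1 / N)) := by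
      field_simp; ring
    rw [h1, h2]; linarith
  calc H v - inner ℝ v r = inner ℝ v (pv - r) := by rw [inner_sub_right, hpv.1]
    _ = A * inner ℝ y (pv - r) := hvy
    _ ≤ A * (e * (2 * 2 ^ (e + 1) + 1) / (N * N)) :=
        mul_le_mul_of_nonneg_left hsum (abs_nonneg _)
    _ ≤ width H v * (e * (2 * 2 ^ (e + 1) + 1) / (N * N)) :=
        mul_le_mul_of_nonneg_right hAW (by positivity)
    _ = _ := mul_comm _ _

/-- The error of the width is the sum of the errors for `v` and `-v`, hence the factor `2`. -/
theorem isExpKernel_of_near_extreme {d : ℕ} {H : Pt d → ℝ} {S : Finset (Pt d)} {ε η : ℝ}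
    (hH : ∀ u, ∃ p, IsExtreme H u p) (hη : 2 * η ≤ ε) (hS : ∀ r ∈ S, ∃ w, IsExtreme H w r)
    (h : ∀ v, ∃ r ∈ S, H v - inner ℝ v r ≤ η * width H v) :
    IsExpKernel ε (width H) S := by
  have hne : S.Nonempty := let ⟨r, hr, _⟩ := h 0; ⟨r, hr⟩
  intro v
  obtain ⟨r, hr, h1⟩ := h v
  obtain ⟨r', hr', h2⟩ := h (-v)
  have h3 := le_supportFn hr v
  have h4 := le_supportFn hr' (-v)
  obtain ⟨t, ht, h5⟩ := exists_supportFn hne v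
  obtain ⟨t', ht', h6⟩ := exists_supportFn hne (-v)
  obtain ⟨w, h7⟩ := hS t ht
  obtain ⟨w', h8⟩ := hS t' ht'
  have h9 := h7.2 v
  have h10 := h8.2 (-v)
  rw [width_neg] at h2
  have h11 := mul_le_mul_of_nonneg_right hη (width_nonneg hH v)
  have h12 : width H v = H v + H (-v) := rfl
  unfold dirWidth
  constructor
  · linarith
  · linarith

/-! ### The packing argument -/

/-- Extreme points in two directions move monotonically with the directions, so the sum of the two
changes controls both of them. -/
theorem sq_add_sq_le_of_isExtreme {u : Fin (e + 1) → Pt (e + 1)} {φ : Fin (e + 1) × Bool}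
    {x y : Fin e → ℝ} {p q : Pt (e + 1)} (hp : IsExtreme H (faceDir u φ x) p)
    (hq : IsExtreme H (faceDir u φ y) q) :
    ∑ j, ((x j - y j) ^ 2 + (inner ℝ (u (φ.1.succAbove j)) (p - q)) ^ 2) ≤
      ∑ j, (x j - y j + inner ℝ (u (φ.1.succAbove j)) (p - q)) ^ 2 := by
  have h1 : 0 ≤ inner ℝ (faceDir u φ x - faceDir u φ y) (p - q) := by
    have h2 := hp.inner_sub_nonneg hq
    have h3 := hq.inner_sub_nonneg hp
    simp only [inner_sub_left, inner_sub_right] at *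
    linarith
  rw [inner_faceDir_sub] at h1
  have h2 : ∑ j, (x j - y j + inner ℝ (u (φ.1.succAbove j)) (p - q)) ^ 2 =
      ∑ j, ((x j - y j) ^ 2 + (inner ℝ (u (φ.1.succAbove j)) (p - q)) ^ 2) +
      2 * ∑ j, (x j - y j) * inner ℝ (u (φ.1.succAbove j)) (p - q) := by
    rw [Finset.mul_sum, ← Finset.sum_add_distrib]
    exact Finset.sum_congr rfl fun j _ => by ring
  rw [h2]; linarith

theorem gridCoord_bounds {N X f : ℕ} (hf : f < N) :
    (X : ℝ) ≤ (gridCoord N X f + 1) * N ∧ (gridCoord N X f + 1) * N < X + 1 := by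
  have hN0 : (0 : ℝ) < N := by exact_mod_cast (Nat.zero_le f).trans_lt hf
  have e1 : (gridCoord N X f + 1) * N = X + f / N := by
    unfold gridCoord; field_simp; ring
  have h1 : (f : ℝ) / N < 1 := by rw [div_lt_one hN0]; exact_mod_cast hf
  have h2 : (0 : ℝ) ≤ f / N := by positivity
  rw [e1]; constructor <;> linarith

/-- The face, the coarse digits and the fine digits of a direction. -/
structure GridDir (e : ℕ) where
  face : Fin (e + 1) × Bool
  coarse : Fin e → ℕ
  fine : Fin e → ℕ

/-- The direction with the given digits. -/
def GridDir.dir (u : Fin (e + 1) → Pt (e + 1)) (N : ℕ) (g : GridDir e) : Pt (e + 1) :=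
  faceDir u g.face fun j => gridCoord N (g.coarse j) (g.fine j)

/-- The number of intervals of length `1 / ((e + 1) * N)` that are needed for the coordinates of
the points in `card_le_of_separated`. -/
def packBound (e N : ℕ) : ℕ := (2 ^ (e + 1) + 2) * (e + 1) * N + 1

/-- A direction `x` and its extreme point with coordinates `p` are recorded by the sum `x + p`, up
to the precision `1 / ((e + 1) * N)`, and the parities of the coarse digits. By monotonicity, this
determines the coarse cell, and the point up to `1 / N`. -/
theorem card_le_of_separated {u : Fin (e + 1) → Pt (e + 1)}
    (hu : IsFat H (e + 1) u) {N : ℕ} (hN : 1 ≤ N) {cnt : ℕ} (g : Fin cnt → GridDir e)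
    (r : Fin cnt → Pt (e + 1)) (hf : ∀ l j, (g l).fine j < N) (hX : ∀ l j, (g l).coarse j < 2 * N)
    (hr : ∀ l, IsExtreme H ((g l).dir u N) (r l))
    (hsep : ∀ l l', l ≠ l' → (g l).face = (g l').face → (g l).coarse = (g l').coarse →
      ∃ j, 1 / N < |inner ℝ (u ((g l).face.1.succAbove j)) (r l - r l')|) :
    cnt ≤ 2 * (e + 1) * (2 * packBound e N) ^ e := by
  have hN0 : (0 : ℝ) < N := by exact_mod_cast hN
  set D : ℝ := (e + 1) * N with hD
  have hD0 : 0 < D := by positivity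
  set x : Fin cnt → Fin e → ℝ := fun l j => gridCoord N ((g l).coarse j) ((g l).fine j) with hx
  set P : Fin cnt → Fin e → ℝ := fun l j => inner ℝ (u ((g l).face.1.succAbove j)) (r l) with hP
  -- the recorded sums, shifted to be nonnegative, in units of the precision
  set q : Fin cnt → Fin e → ℝ := fun l j =>
    (x l j + 1 + P l j + H (-u ((g l).face.1.succAbove j))) * D with hq
  have hq0 : ∀ l j, 0 ≤ q l j := by
    intro l j
    have h1 := (hr l).2 (-u ((g l).face.1.succAbove j))
    rw [inner_neg_left] at h1
    have h2 : 0 ≤ x l j + 1 := by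
      have := (gridCoord_bounds (X := (g l).coarse j) (hf l j)).1
      exact nonneg_of_mul_nonneg_left ((Nat.cast_nonneg _).trans this) hN0
    refine mul_nonneg ?_ hD0.le
    simp only [hP]; linarith
  have hq1 : ∀ l j, ⌊q l j⌋₊ < packBound e N := by
    intro l j
    rw [Nat.floor_lt (hq0 l j)]
    have h1 := (hr l).2 (u ((g l).face.1.succAbove j))
    have h2 : x l j + 1 ≤ 2 := by
      have h3 := (gridCoord_bounds (X := (g l).coarse j) (hf l j)).2
      have h4 : ((g l).coarse j : ℝ) + 1 ≤ 2 * N := by exact_mod_cast hX l j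
      exact le_of_mul_le_mul_right (h3.le.trans h4) hN0
    have h3 : H (u ((g l).face.1.succAbove j)) + H (-u ((g l).face.1.succAbove j)) ≤ 2 ^ (e + 1) :=
      (hu.2 _ (Fin.is_lt _)).1
    have h4 : q l j ≤ (2 ^ (e + 1) + 2) * D := by
      refine mul_le_mul_of_nonneg_right ?_ hD0.le
      simp only [hP]; linarith
    refine h4.trans_lt ?_
    simp only [packBound]
    push_cast
    rw [hD]; linarith
  let code : Fin cnt → (Fin (e + 1) × Bool) × (Fin e → Fin 2) × (Fin e → Fin (packBound e N)) :=
    fun l => ((g l).face, fun j => ⟨(g l).coarse j % 2, Nat.mod_lt _ (by norm_num)⟩,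
      fun j => ⟨⌊q l j⌋₊, hq1 l j⟩)
  have hinj : Function.Injective code := by
    intro l l' h
    by_contra hne
    simp only [code, Prod.mk.injEq] at h
    obtain ⟨h1, h2, h3⟩ := h
    have h2' : ∀ j, (g l).coarse j % 2 = (g l').coarse j % 2 := fun j =>
      congrArg Fin.val (congrFun h2 j)
    have h3' : ∀ j, ⌊q l j⌋₊ = ⌊q l' j⌋₊ := fun j => congrArg Fin.val (congrFun h3 j)
    have hr' := hr l'
    unfold GridDir.dir at hr'
    rw [← h1] at hr'
    have key := sq_add_sq_le_of_isExtreme (hr l) hr'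
    have hP' : ∀ j, inner ℝ (u ((g l).face.1.succAbove j)) (r l - r l') = P l j - P l' j := by
      intro j
      simp only [hP, ← h1, inner_sub_right]
    simp only [hP'] at key
    change ∑ j, ((x l j - x l' j) ^ 2 + (P l j - P l' j) ^ 2) ≤
      ∑ j, (x l j - x l' j + (P l j - P l' j)) ^ 2 at key
    have hdiff : ∀ j, (x l j - x l' j + (P l j - P l' j)) ^ 2 ≤ (1 / D) ^ 2 := by
      intro j
      have e1 : q l j - q l' j = (x l j - x l' j + (P l j - P l' j)) * D := by
        simp only [hq, ← h1]; ring
      have a1 := Nat.floor_le (hq0 l j)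
      have a2 := Nat.lt_floor_add_one (q l j)
      have a3 := Nat.floor_le (hq0 l' j)
      have a4 := Nat.lt_floor_add_one (q l' j)
      rw [h3' j] at a1 a2
      have a5 : |(x l j - x l' j + (P l j - P l' j)) * D| ≤ 1 := by
        rw [← e1, abs_le]; constructor <;> linarith
      rw [abs_mul, abs_of_pos hD0, ← le_div_iff₀ hD0] at a5
      exact sq_le_sq' (by linarith [(abs_le.1 a5).1]) (abs_le.1 a5).2
    have htot : ∑ j, (x l j - x l' j + (P l j - P l' j)) ^ 2 < (1 / (N : ℝ)) ^ 2 := by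
      calc _ ≤ ∑ _j : Fin e, (1 / D) ^ 2 := Finset.sum_le_sum fun j _ => hdiff j
        _ = e * (1 / D) ^ 2 := by simp
        _ < (1 / (N : ℝ)) ^ 2 := by
          rw [hD, div_pow, div_pow, one_pow, mul_pow, mul_one_div, div_lt_div_iff₀
            (by positivity) (by positivity), one_mul]
          refine mul_lt_mul_of_pos_right ?_ (by positivity)
          have : (0 : ℝ) ≤ e := Nat.cast_nonneg _
          nlinarith
    have hsmall : ∀ j, (x l j - x l' j) ^ 2 + (P l j - P l' j) ^ 2 < (1 / (N : ℝ)) ^ 2 := fun j =>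
      lt_of_le_of_lt (Finset.single_le_sum
        (f := fun j => (x l j - x l' j) ^ 2 + (P l j - P l' j) ^ 2)
        (fun j _ => by positivity) (Finset.mem_univ j)) (key.trans_lt htot)
    -- directions that differ by less than `1 / N` have coarse digits that differ by at most `1`
    have hXeq : (g l).coarse = (g l').coarse := by
      funext j
      have b1 : (x l j - x l' j) ^ 2 < (1 / (N : ℝ)) ^ 2 := by
        have := hsmall j
        nlinarith [sq_nonneg (P l j - P l' j)]
      have b2 := abs_lt_of_sq_lt_sq b1 (by positivity)
      have b3 : |(x l j - x l' j) * N| < 1 := by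
        rw [abs_mul, abs_of_pos hN0, ← lt_div_iff₀ hN0]; exact b2
      obtain ⟨b4, b5⟩ := abs_lt.1 b3
      obtain ⟨c1, c2⟩ := gridCoord_bounds (X := (g l).coarse j) (hf l j)
      obtain ⟨c3, c4⟩ := gridCoord_bounds (X := (g l').coarse j) (hf l' j)
      change _ ≤ (x l j + 1) * N at c1
      change (x l j + 1) * N < _ at c2
      change _ ≤ (x l' j + 1) * N at c3
      change (x l' j + 1) * N < _ at c4
      have d1 : ((g l).coarse j : ℝ) < ((g l').coarse j + 2 : ℕ) := by push_cast; linarith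
      have d2 : ((g l').coarse j : ℝ) < ((g l).coarse j + 2 : ℕ) := by push_cast; linarith
      have d3 := Nat.cast_lt.1 d1
      have d4 := Nat.cast_lt.1 d2
      have := h2' j
      omega
    obtain ⟨j, hj⟩ := hsep l l' hne h1 hXeq
    rw [hP'] at hj
    have b1 : (P l j - P l' j) ^ 2 < (1 / (N : ℝ)) ^ 2 := by
      have := hsmall j
      nlinarith [sq_nonneg (x l j - x l' j)]
    exact absurd (abs_lt_of_sq_lt_sq b1 (by positivity)) (not_lt.2 hj.le)
  have := Fintype.card_le_of_injective code hinj
  simp only [Fintype.card_prod, Fintype.card_fin, Fintype.card_bool, Fintype.card_fun] at this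
  calc cnt ≤ _ := this
    _ = _ := by rw [mul_pow]; ring

end Cover

end UncertainKernel

namespace UncertainKernel

/-! ### The program that computes an adapted basis -/

/-- Real array `6` holds the vectors `u j`, row by row. -/
def HoldsMat {d : ℕ} (s : Store) (u : Fin d → Pt d) : Prop :=
  ∀ j i : Fin d, s.realArr 6 (j * d + i) = u j i

theorem HoldsMat.frame {d : ℕ} {s s' : Store} {u : Fin d → Pt d} {W : List (ℕ × ℕ)}
    (h : HoldsMat s u) (hF : Frame W s s') (ha : (3, 6) ∉ W) : HoldsMat s' u := by
  unfold HoldsMat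
  rw [hF.ra ha]; exact h

theorem exec_setVec {d a : ℕ} {f : ℕ → RExp} {s : Store} (v : Pt d)
    (hv : ∀ j : Fin d, (f j).val s = v j)
    (hf : ∀ j < d, ∀ s', Frame [(3, a)] s s' → (∀ i, j ≤ i → s'.realArr a i = s.realArr a i) →
      (f j).val s' = (f j).val s) :
    Exec (setCells a (.const 0) d f) s (setCellsTime (.const 0) d f)
      (fun s' => HoldsVec s' a v ∧ Frame [(3, a)] s s') := by
  refine (exec_setCells a (.const 0) d f s 0 rfl fun j hj s' hF h => hf j hj s' hF fun i hi =>
    h i (by omega)).mono le_rfl ?_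
  rintro s' ⟨hF, h, -⟩
  exact ⟨fun j => by rw [← hv j, ← h j j.2, zero_add], hF⟩

/-- The inner product of row `j` of the matrix with the vector in the real array `a`. -/
def rowDot (d j a : ℕ) : RExp :=
  .sum d fun i => .mul (.arr 6 (.const (j * d + i))) (.arr a (.const i))

theorem val_rowDot {d a : ℕ} {s : Store} {u : Fin d → Pt d} {v : Pt d} (hu : HoldsMat s u)
    (hv : HoldsVec s a v) (j : Fin d) : (rowDot d j a).val s = inner ℝ (u j) v := by
  rw [inner_eq_sum, rowDot, RExp.val_sum]
  refine Finset.sum_congr rfl fun i _ => ?_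
  simp only [RExp.val, NExp.val, hu j i, hv i]

/-- Replace the matrix by its elimination with the pivot `k`, if real array `9` holds the vector `b`
and real variable `3` holds `⟨u k, b⟩`. -/
def pivotRows (d k : ℕ) : Prog :=
  .seq (setCells 10 (.const 0) d fun i => .div (.arr 6 (.const (k * d + i))) (.var 3))
    (.seq (setCells 11 (.const 0) d fun j => rowDot d j 9)
      (setCells 6 (.const 0) (d * d) fun t =>
        if t / d = k then .arr 10 (.const (t % d))
        else .sub (.arr 6 (.const t)) (.mul (.arr 11 (.const (t / d))) (.arr 10 (.const (t % d))))))

/-- The step of the Gauss-Jordan elimination for row `k`. -/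
def eliminateRow (d k : ℕ) : Prog :=
  .seq (setCells 4 (.const 0) d fun i => .arr 6 (.const (k * d + i)))
    (.seq (findExtreme d)
      (.seq (setCells 9 (.const 0) d fun i => .arr 5 (.const i))
        (.seq (setCells 4 (.const 0) d fun i => .sub (.const 0) (.arr 6 (.const (k * d + i))))
          (.seq (findExtreme d)
            (.seq (setCells 9 (.const 0) d fun i => .sub (.arr 9 (.const i)) (.arr 5 (.const i)))
              (.seq (.setReal 3 (rowDot d k 9))
                (.cond (.realLt (.const 0) (.var 3)) (pivotRows d k) .skip)))))))

/-- The elimination steps for the first `k` rows. -/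
def eliminateRows (d : ℕ) : ℕ → Prog
  | 0 => setCells 6 (.const 0) (d * d) fun t => .const (if t / d = t % d then 1 else 0)
  | k + 1 => .seq (eliminateRows d k) (eliminateRow d k)

/-- The cells that `eliminateRows` changes. -/
def basisCells : List (ℕ × ℕ) :=
  [(1, 3), (3, 4), (3, 6), (3, 9), (3, 10), (3, 11)] ++ extremeCells

theorem writesIn_eliminateRow (d k : ℕ) : (eliminateRow d k).WritesIn basisCells := by
  have h := (writesIn_findExtreme d).mono (W' := basisCells)
    (List.subset_append_right _ _)
  simp [eliminateRow, pivotRows, Prog.WritesIn, h]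
  simp [basisCells]

theorem writesIn_eliminateRows (d k : ℕ) : (eliminateRows d k).WritesIn basisCells := by
  induction k with
  | zero => simp [eliminateRows, basisCells]
  | succ k ih => exact ⟨ih, writesIn_eliminateRow d k⟩

theorem exec_initRows (d : ℕ) (s : Store) : Exec (eliminateRows d 0) s
    (setCellsTime (.const 0) (d * d) fun t => .const (if t / d = t % d then 1 else 0))
    (fun s' => HoldsMat s' fun j : Fin d => EuclideanSpace.single j (1 : ℝ)) := by
  refine (exec_setCells 6 (.const 0) (d * d) _ s 0 rfl fun _ _ _ _ _ => rfl).mono le_rfl ?_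
  rintro s' ⟨-, h, -⟩ j i
  have hlt : (j : ℕ) * d + i < d * d := by
    calc (j : ℕ) * d + i < j * d + d := by omega
      _ = (j + 1) * d := by ring
      _ ≤ d * d := Nat.mul_le_mul_right _ j.2
  have hd : 0 < d := (Nat.zero_le _).trans_lt i.2
  have := h _ hlt
  rw [zero_add] at this
  rw [this, RExp.val, Nat.mul_comm, Nat.mul_add_div hd, Nat.div_eq_of_lt i.2, Nat.mul_add_mod,
    Nat.mod_eq_of_lt i.2, add_zero]
  simp only [PiLp.single_apply, Fin.ext_iff, eq_comm]
  split_ifs <;> simp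

/-- The running time of `pivotRows`. -/
def pivotTime (d k : ℕ) : ℕ :=
  (setCellsTime (.const 0) d fun i => .div (.arr 6 (.const (k * d + i))) (.var 3)) +
    ((setCellsTime (.const 0) d fun j => rowDot d j 9) +
      (setCellsTime (.const 0) (d * d) fun t =>
        if t / d = k then .arr 10 (.const (t % d))
        else .sub (.arr 6 (.const t)) (.mul (.arr 11 (.const (t / d))) (.arr 10 (.const (t % d))))))

theorem exec_pivotRows {d : ℕ} {s : Store} {u : Fin d → Pt d} {b : Pt d} {k : Fin d}
    (hu : HoldsMat s u) (hb : HoldsVec s 9 b) (hw : s.realVar 3 = inner ℝ (u k) b) :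
    Exec (pivotRows d k) s (pivotTime d k) (fun s' => HoldsMat s' (eliminate u k b)) := by
  refine Exec.seq ((exec_setVec ((inner ℝ (u k) b : ℝ)⁻¹ • u k) ?_ ?_).mono le_rfl ?_)
  · intro i
    simp only [RExp.val, NExp.val, hu k i, hw, PiLp.smul_apply, smul_eq_mul]
    rw [div_eq_inv_mul]
  · intro i hi s' hF _
    simp only [RExp.val, NExp.val]
    rw [hF.ra (by simp), hF.rv (by simp)]
  rintro s₁ ⟨hrow, hF₁⟩
  have hu₁ := hu.frame hF₁ (by simp)
  have hb₁ := hb.frame hF₁ (by simp)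
  refine Exec.seq ((exec_setVec (WithLp.toLp 2 fun j => inner ℝ (u j) b) ?_ ?_).mono le_rfl ?_)
  · intro j; exact val_rowDot hu₁ hb₁ j
  · intro j hj s' hF _
    simp only [rowDot, RExp.val_sum, RExp.val, NExp.val]
    rw [hF.ra (by simp), hF.ra (by simp)]
  rintro s₂ ⟨hcoef, hF₂⟩
  have hu₂ := hu₁.frame hF₂ (by simp)
  have hrow₂ := hrow.frame hF₂ (by simp)
  refine (exec_setCells 6 (.const 0) (d * d) _ s₂ 0 rfl ?_).mono le_rfl ?_
  · intro t ht s' hF hs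
    have := hs t (by omega)
    split_ifs <;> simp only [RExp.val, NExp.val]
    · rw [hF.ra (by simp)]
    · rw [this, hF.ra (show (3, 11) ∉ _ by simp), hF.ra (show (3, 10) ∉ _ by simp)]
  rintro s₃ ⟨-, h, -⟩ j i
  have hlt : (j : ℕ) * d + i < d * d := by
    calc (j : ℕ) * d + i < j * d + d := by omega
      _ = (j + 1) * d := by ring
      _ ≤ d * d := Nat.mul_le_mul_right _ j.2
  have hd : 0 < d := (Nat.zero_le _).trans_lt i.2
  have h1 : ((j : ℕ) * d + i) / d = j := by
    rw [Nat.mul_comm, Nat.mul_add_div hd, Nat.div_eq_of_lt i.2, add_zero]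
  have h2 : ((j : ℕ) * d + i) % d = i := by
    rw [Nat.mul_comm, Nat.mul_add_mod, Nat.mod_eq_of_lt i.2]
  have := h _ hlt
  rw [zero_add] at this
  rw [this, h1, h2, eliminate]
  simp only [Fin.ext_iff]
  split_ifs with hjk
  · simp only [RExp.val, NExp.val, hrow₂ i]
  · simp only [RExp.val, NExp.val, hrow₂ i, hu₂ j i, hcoef j, PiLp.sub_apply, PiLp.smul_apply,
      smul_eq_mul]

/-- The unit of time for one extreme point. -/
def unitTime (m : ℕ) : ℕ := (m + 1) * (Nat.log 2 m + 1)

theorem le_mul_unitTime (c m : ℕ) : c ≤ c * unitTime m :=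
  Nat.le_mul_of_pos_right _ (Nat.mul_pos (by omega) (by omega))

/-- Set the direction, and find an extreme point. -/
theorem exists_exec_findExtreme_dir (d : ℕ) (f : ℕ → RExp) : ∃ K : ℕ, ∀ {m : ℕ} (M : Model d m)
    (s : Store) (v : Pt d), HoldsModel M s → (∀ j : Fin d, (f j).val s = v j) →
    (∀ j < d, ∀ s', Frame [(3, 4)] s s' → (f j).val s' = (f j).val s) →
    ∀ {q : Prog} {T : ℕ} {Q : Store → Prop},
    (∀ s' p, IsExtreme M.H v p → HoldsVec s' 5 p → Frame ((3, 4) :: extremeCells) s s' →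
      Exec q s' T Q) →
    Exec (.seq (setCells 4 (.const 0) d f) (.seq (findExtreme d) q)) s (K * unitTime m + T) Q := by
  obtain ⟨K, hK⟩ := exists_exec_findExtreme d
  refine ⟨setCellsTime (.const 0) d f + K, fun {m} M s v hM hv hf {q T Q} hq => ?_⟩
  refine (Exec.seq ((exec_setVec v hv fun j hj s' hF _ => hf j hj s' hF).mono le_rfl
    fun s₁ h₁ => Exec.seq (T₂ := T) ((hK M s₁ v (hM.frame h₁.2 (by simp) (by simp) (by simp)
      (by simp)) h₁.1).mono le_rfl fun s₂ h₂ => ?_))).mono ?_ fun _ h => h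
  · obtain ⟨⟨p, hp, hp5⟩, hF₂⟩ := h₂
    exact hq s₂ p hp hp5 ((h₁.2.mono (by simp)).trans (hF₂.mono (by simp)))
  · have := le_mul_unitTime (setCellsTime (.const 0) d f) m
    have hu : (m + 1) * (Nat.log 2 m + 1) = unitTime m := rfl
    rw [hu, add_mul]; omega

theorem exists_exec_eliminateRow {d : ℕ} (k : Fin d) : ∃ K : ℕ, ∀ {m : ℕ} (M : Model d m)
    (s : Store) (u : Fin d → Pt d), HoldsModel M s → IsFat M.H k u → HoldsMat s u →
    Exec (eliminateRow d k) s (K * unitTime m)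
      (fun s' => ∃ u', IsFat M.H (k + 1) u' ∧ HoldsMat s' u') := by
  obtain ⟨K₁, h₁⟩ := exists_exec_findExtreme_dir d (fun i => .arr 6 (.const (k * d + i)))
  obtain ⟨K₂, h₂⟩ := exists_exec_findExtreme_dir d
    (fun i => .sub (.const 0) (.arr 6 (.const (k * d + i))))
  set c₁ := setCellsTime (.const 0) d fun i => .arr 5 (.const i) with hc₁
  set c₂ := setCellsTime (.const 0) d fun i => .sub (.arr 9 (.const i)) (.arr 5 (.const i)) with hc₂
  refine ⟨K₁ + K₂ + (c₁ + (c₂ + ((rowDot d k 9).cost + 1 + (4 + (pivotTime d k + 1))))),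
    fun {m} M s u hM hu hm => ?_⟩
  refine Exec.mono (h₁ M s (u k) hM (fun i => hm k i) ?_
    (T := c₁ + (K₂ * unitTime m + (c₂ + ((rowDot d k 9).cost + 1 + (4 + (pivotTime d k + 1))))))
    fun s₁ p hp hp5 hF₁ => ?_) ?_ fun _ h => h
  · intro i hi s' hF
    simp only [RExp.val, NExp.val]
    rw [hF.ra (by simp)]
  · have hM₁ := hM.frame hF₁ (by simp [extremeCells]) (by simp [extremeCells])
      (by simp [extremeCells]) (by simp [extremeCells])
    have hm₁ := hm.frame hF₁ (by simp [extremeCells])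
    refine Exec.seq ((exec_setVec p ?_ fun i hi s' hF _ => ?_).mono le_rfl
      fun s₂ hs₂ => ?_)
    · exact hp5
    · simp only [RExp.val, NExp.val]
      rw [hF.ra (by simp)]
    obtain ⟨hp9, hF₂⟩ := hs₂
    have hM₂ := hM₁.frame hF₂ (by simp) (by simp) (by simp) (by simp)
    have hm₂ := hm₁.frame hF₂ (by simp)
    refine h₂ M s₂ (-u k) hM₂ (fun i => ?_) ?_ fun s₃ q hq hq5 hF₃ => ?_
    · simp only [RExp.val, NExp.val, hm₂ k i]; simp
    · intro i hi s' hF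
      simp only [RExp.val, NExp.val]
      rw [hF.ra (by simp)]
    have hm₃ := hm₂.frame hF₃ (by simp [extremeCells])
    have hp9₃ := hp9.frame hF₃ (by simp [extremeCells])
    refine Exec.seq ((exec_setVec (p - q) (fun i => ?_) fun i hi s' hF hs => ?_).mono le_rfl
      fun s₄ hs₄ => ?_)
    · simp only [RExp.val, NExp.val, hp9₃ i, hq5 i, PiLp.sub_apply]
    · simp only [RExp.val, NExp.val]
      rw [hs i le_rfl, hF.ra (show (3, 5) ∉ _ by simp)]
    obtain ⟨hb, hF₄⟩ := hs₄
    have hm₄ := hm₃.frame hF₄ (by simp)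
    have hw := val_rowDot hm₄ hb k
    refine Exec.seq (Exec.setReal ?_)
    rw [hw]
    set w : ℝ := inner ℝ (u k) (p - q) with hwdef
    have hwid : w = width M.H (u k) := width_eq_inner hp hq
    have hm₅ : HoldsMat (s₄.setReal 3 w) u := hm₄
    have hb₅ : HoldsVec (s₄.setReal 3 w) 9 (p - q) := hb
    refine (Exec.cond (T := pivotTime d k + 1) (fun hpos => ?_) (fun hneg => ?_)).mono
      (by simp [BExp.cost, RExp.cost]) fun _ h => h
    · refine (exec_pivotRows hm₅ hb₅ (by simp [hwdef])).mono (by omega) fun s' h => ⟨_, ?_, h⟩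
      refine hu.eliminate M.exists_extreme hp hq ?_
      rw [← hwid]
      simpa [BExp.holds, RExp.val] using hpos
    · refine Exec.mono (Exec.skip ⟨u, hu.succ_of_width_eq_zero ?_, hm₅⟩) (by omega) fun _ h => h
      refine le_antisymm ?_ (width_nonneg M.exists_extreme _)
      rw [← hwid]
      simpa [BExp.holds, RExp.val] using hneg
  · have := le_mul_unitTime (c₁ + (c₂ + ((rowDot d k 9).cost + 1 + (4 + (pivotTime d k + 1))))) m
    rw [add_mul, add_mul]; omega

theorem exists_exec_eliminateRows (d : ℕ) : ∀ k ≤ d, ∃ K : ℕ, ∀ {m : ℕ} (M : Model d m)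
    (s : Store), HoldsModel M s → Exec (eliminateRows d k) s (K * unitTime m)
      (fun s' => (∃ u, IsFat M.H k u ∧ HoldsMat s' u) ∧ Frame basisCells s s') := by
  intro k
  induction k with
  | zero =>
    intro _
    refine ⟨_, fun {m} M s hM => Exec.frame ((exec_initRows d s).mono (le_mul_unitTime _ m)
      fun s' h => ⟨_, isFat_single _, h⟩) (writesIn_eliminateRows d 0)⟩
  | succ k ih =>
    intro hk
    obtain ⟨K₁, h₁⟩ := ih (by omega)
    obtain ⟨K₂, h₂⟩ := exists_exec_eliminateRow (⟨k, hk⟩ : Fin d)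
    refine ⟨K₁ + K₂, fun {m} M s hM => Exec.frame ((Exec.seq ((h₁ M s hM).mono le_rfl ?_)).mono
      (add_mul _ _ _).ge fun _ h => h) (writesIn_eliminateRows d (k + 1))⟩
    rintro s₁ ⟨⟨u, hu, hm⟩, hF⟩
    exact h₂ M s₁ u (hM.frame hF (by simp [basisCells, extremeCells])
      (by simp [basisCells, extremeCells]) (by simp [basisCells, extremeCells])
      (by simp [basisCells, extremeCells])) hu hm

end UncertainKernel

namespace UncertainKernel

/-! ### Nested loops -/

/-- Run the body for all values below `natVar bnd` of the cells `0, …, j - 1` of the natural number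
array `a`. -/
def enumDigits (a bnd : ℕ) (body : Prog) : ℕ → Prog
  | 0 => body
  | j + 1 => .seq (.setNatArr a (.const j) (.const 0))
      (.loop (.natLt (.arr a (.const j)) (.var bnd))
        (.seq (enumDigits a bnd body j)
          (.setNatArr a (.const j) (.add (.arr a (.const j)) (.const 1)))))

theorem writesIn_enumDigits {W : List (ℕ × ℕ)} {a bnd : ℕ} {body : Prog} (h : body.WritesIn W)
    (ha : (2, a) ∈ W) (j : ℕ) : (enumDigits a bnd body j).WritesIn W := by
  induction j with
  | zero => exact h
  | succ j ih => exact ⟨ha, ih, ha⟩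

/-- The first `e` cells of the natural number array `a`. -/
def digits (e a : ℕ) (s : Store) (j : Fin e) : ℕ := s.natArr a j

/-- The digit vectors whose first `j` digits are arbitrary numbers below `R`, and that agree with
`D` otherwise. -/
def digitBox {e : ℕ} (R j : ℕ) (D : Fin e → ℕ) : Set (Fin e → ℕ) :=
  {D' | ∀ i : Fin e, ((i : ℕ) < j → D' i < R) ∧ (j ≤ (i : ℕ) → D' i = D i)}

/-- The time that `enumDigits` spends outside of its body. -/
def enumOverhead (R : ℕ) : ℕ → ℕ
  | 0 => 0
  | j + 1 => 8 + R * (enumOverhead R j + 11)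

theorem enumOverhead_le {R : ℕ} (hR : 1 ≤ R) (j : ℕ) : enumOverhead R j ≤ 19 * j * R ^ j := by
  induction j with
  | zero => simp [enumOverhead]
  | succ j ih =>
    have h1 : 1 ≤ R ^ j := Nat.one_le_pow _ _ hR
    have h2 := Nat.mul_le_mul_left R ih
    have h3 : R ≤ R * R ^ j := Nat.le_mul_of_pos_right _ h1
    have h4 : 19 * (j + 1) * R ^ (j + 1) = R * (19 * j * R ^ j) + 19 * (R * R ^ j) := by ring
    rw [enumOverhead, h4, mul_add]
    omega

/-- The invariant `Inv V n s t` speaks of the set `V` of the digit vectors for which the body was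
run, their number `n`, the memory, and an upper bound `t` for the time spent in the body. -/
theorem runs_enumDigits {e a bnd R : ℕ} {body : Prog}
    (Inv : Set (Fin e → ℕ) → ℕ → Store → ℕ → Prop)
    (hset : ∀ V n s t j k, Inv V n s t → Inv V n (s.setNatArr a j k) t)
    (hbnd : ∀ V n s t, Inv V n s t → s.natVar bnd = R)
    (hbody : ∀ V n s t, Inv V n s t → (∀ j, digits e a s j < R) → digits e a s ∉ V →
      ∃ τ s', Runs body s τ s' ∧ digits e a s' = digits e a s ∧
        Inv (insert (digits e a s) V) (n + 1) s' (t + τ)) :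
    ∀ j ≤ e, ∀ V n s t, Inv V n s t → (∀ i : Fin e, j ≤ (i : ℕ) → digits e a s i < R) →
      (∀ D ∈ digitBox R j (digits e a s), D ∉ V) →
      ∃ τ s' t', Runs (enumDigits a bnd body j) s τ s' ∧
        (∀ i : Fin e, j ≤ (i : ℕ) → digits e a s' i = digits e a s i) ∧
        Inv (V ∪ digitBox R j (digits e a s)) (n + R ^ j) s' t' ∧
        t + τ ≤ t' + enumOverhead R j := by
  intro j
  induction j with
  | zero =>
    intro _ V n s t hI hlt hV
    have hbox : digitBox R 0 (digits e a s) = {digits e a s} := by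
      ext D; simp [digitBox, funext_iff]
    rw [hbox] at hV ⊢
    obtain ⟨τ, s', h1, h2, h3⟩ := hbody V n s t hI (fun j => hlt j (Nat.zero_le _)) (hV _ rfl)
    refine ⟨τ, s', t + τ, h1, fun i _ => congrFun h2 i, ?_, by simp [enumOverhead]⟩
    rwa [Set.union_singleton, pow_zero]
  | succ j ih =>
    intro hj V n s t hI hlt hV
    set jj : Fin e := ⟨j, hj⟩ with hjj
    -- the state of the loop when digit `j` has the value `x`
    have key : ∀ k x, x + k = R → ∀ s₁ t₁ n₁,
        Inv (V ∪ {D | D ∈ digitBox R (j + 1) (digits e a s) ∧ D jj < x}) n₁ s₁ t₁ →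
        digits e a s₁ jj = x →
        (∀ i : Fin e, j + 1 ≤ (i : ℕ) → digits e a s₁ i = digits e a s i) →
        ∃ τ s' t', Runs (.loop (.natLt (.arr a (.const j)) (.var bnd))
            (.seq (enumDigits a bnd body j)
              (.setNatArr a (.const j) (.add (.arr a (.const j)) (.const 1))))) s₁ τ s' ∧
          (∀ i : Fin e, j + 1 ≤ (i : ℕ) → digits e a s' i = digits e a s i) ∧
          Inv (V ∪ digitBox R (j + 1) (digits e a s)) (n₁ + k * R ^ j) s' t' ∧
          t₁ + τ ≤ t' + k * (enumOverhead R j + 11) + 5 := by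
      intro k
      induction k with
      | zero =>
        intro x hx s₁ t₁ n₁ hI₁ hx₁ hup
        rw [add_zero] at hx
        have hnot : ¬ (BExp.natLt (.arr a (.const j)) (.var bnd)).holds s₁ := by
          have hx' : s₁.natArr a j = x := hx₁
          simp only [BExp.holds, NExp.val, hbnd _ _ _ _ hI₁]
          omega
        refine ⟨_, s₁, t₁, .loopDone hnot, hup, ?_, by simp [BExp.cost, NExp.cost]⟩
        have : {D | D ∈ digitBox R (j + 1) (digits e a s) ∧ D jj < x} =
            digitBox R (j + 1) (digits e a s) := by
          ext D
          simp only [Set.mem_ofPred_eq, and_iff_left_iff_imp]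
          intro h
          rw [hx]
          exact (h jj).1 (by simp [hjj])
        rw [this] at hI₁
        simpa using hI₁
      | succ k ihk =>
        intro x hx s₁ t₁ n₁ hI₁ hx₁ hup
        have hyes : (BExp.natLt (.arr a (.const j)) (.var bnd)).holds s₁ := by
          have hx' : s₁.natArr a j = x := hx₁
          simp only [BExp.holds, NExp.val, hbnd _ _ _ _ hI₁]
          omega
        have hcase : ∀ D, D ∈ digitBox R j (digits e a s₁) ↔
            D ∈ digitBox R (j + 1) (digits e a s) ∧ D jj = x := by
          intro D
          constructor
          · intro h
            have hDx : D jj = x := by rw [(h jj).2 le_rfl, hx₁]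
            refine ⟨fun i => ⟨fun hi => ?_, fun hi => ?_⟩, hDx⟩
            · rcases Nat.lt_succ_iff_lt_or_eq.1 hi with hi | hi
              · exact (h i).1 hi
              · have : i = jj := Fin.ext hi
                rw [this, hDx]; omega
            · rw [(h i).2 (by omega), hup i hi]
          · rintro ⟨h, hDx⟩ i
            refine ⟨fun hi => (h i).1 (by omega), fun hi => ?_⟩
            rcases Nat.eq_or_lt_of_le hi with hi | hi
            · have : i = jj := Fin.ext hi.symm
              rw [this, hDx, hx₁]
            · rw [(h i).2 hi, hup i hi]
        obtain ⟨τ, s₂, t₂, hr, hd, hI₂, ht⟩ := ih (by omega) _ n₁ s₁ t₁ hI₁ (fun i hi => by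
            rcases Nat.eq_or_lt_of_le hi with hi | hi
            · have : i = jj := Fin.ext hi.symm
              rw [this, hx₁]; omega
            · rw [hup i hi]; exact hlt i hi) (fun D hD hD' => by
            obtain ⟨h1, h2⟩ := (hcase D).1 hD
            rcases hD' with h | h
            · exact hV D h1 h
            · exact absurd h.2 (by omega))
        set s₃ := s₂.setNatArr a j (x + 1) with hs₃
        have hx₂ : s₂.natArr a j = x := (hd jj le_rfl).trans hx₁
        have hrun : Runs (.seq (enumDigits a bnd body j)
            (.setNatArr a (.const j) (.add (.arr a (.const j)) (.const 1)))) s₁ (τ + 6) s₃ := by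
          have := Runs.setNatArr s₂ a (.const j) (.add (.arr a (.const j)) (.const 1))
          simp only [NExp.val, hx₂] at this
          exact .seq hr this
        have hd₃ : ∀ i : Fin e, j + 1 ≤ (i : ℕ) → digits e a s₃ i = digits e a s i := by
          intro i hi
          rw [← hup i hi, ← hd i (by omega)]
          simp only [digits, hs₃, Store.setNatArr_natArr, if_true, Function.update_apply]
          rw [if_neg (by omega)]
        have hI₃ := hset _ _ _ _ j (x + 1) hI₂
        have hset' : V ∪ {D | D ∈ digitBox R (j + 1) (digits e a s) ∧ D jj < x} ∪
            digitBox R j (digits e a s₁) =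
            V ∪ {D | D ∈ digitBox R (j + 1) (digits e a s) ∧ D jj < x + 1} := by
          ext D
          simp only [Set.mem_union, Set.mem_ofPred_eq, hcase, Nat.lt_succ_iff_lt_or_eq]
          tauto
        rw [hset'] at hI₃
        obtain ⟨τ', s', t', hr', hd', hI', ht'⟩ := ihk (x + 1) (by omega) s₃ t₂ _ hI₃
          (by simp [digits, hs₃, hjj]) hd₃
        refine ⟨_, s', t', .loopStep hyes hrun hr', hd', ?_, ?_⟩
        · have : n₁ + (k + 1) * R ^ j = n₁ + R ^ j + k * R ^ j := by ring
          rw [this]; exact hI'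
        · simp only [BExp.cost, NExp.cost]
          have : (k + 1) * (enumOverhead R j + 11) =
            k * (enumOverhead R j + 11) + enumOverhead R j + 11 := by ring
          omega
    have hdig : ∀ i : Fin e, j + 1 ≤ (i : ℕ) →
        digits e a (s.setNatArr a j 0) i = digits e a s i := by
      intro i hi
      simp only [digits, Store.setNatArr_natArr, if_true, Function.update_apply]
      rw [if_neg (by omega)]
    obtain ⟨τ, s', t', hr, hd, hI', ht⟩ := key R 0 (by omega) (s.setNatArr a j 0) t n
      (by simpa using hset _ _ _ _ j 0 hI) (by simp [digits, hjj]) hdig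
    refine ⟨_, s', t', .seq (.setNatArr s a (.const j) (.const 0)) hr, hd, ?_, ?_⟩
    · rw [pow_succ, mul_comm]; exact hI'
    · simp only [NExp.cost, enumOverhead]
      omega

end UncertainKernel

namespace UncertainKernel

/-! ### The program that visits the directions of a face -/

section Visit

variable {e : ℕ}

/-- The coordinate of the current direction at the basis vector with digit number `j`: natural
number arrays `2` and `3` hold the coarse and fine digits. -/
def coordExp (j : ℕ) : RExp :=
  .add (.add (.const (-1)) (.div (.ofNat (.arr 2 (.const j))) (.ofNat (.var 2))))
    (.div (.ofNat (.arr 3 (.const j))) (.mul (.ofNat (.var 2)) (.ofNat (.var 2))))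

/-- Coordinate `i` of the current direction on the face `φ`. -/
def dirExp (φ : Fin (e + 1) × Bool) (i : ℕ) : RExp :=
  .add (.mul (.const (if φ.2 then 1 else -1)) (.arr 6 (.const ((φ.1 : ℕ) * (e + 1) + i))))
    (.sum e fun j => .mul (coordExp j)
      (.arr 6 (.const ((φ.1.succAbove j : ℕ) * (e + 1) + i))))

/-- The difference between the point in real array `5` and the output point with index
`natVar 13`, in the coordinate that belongs to row `k` of the matrix. -/
def diffExp (d k : ℕ) : RExp :=
  .sum d fun i => .mul (.arr 6 (.const (k * d + i)))
    (.sub (.arr 5 (.const i)) (.arr 0 (.add (NExp.mulc d (.var 13)) (.const i))))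

/-- The test whether these differences are at most `1 / N` in absolute value for all free
coordinates of the face; their squares are compared. -/
def closeTest (φ : Fin (e + 1) × Bool) : BExp :=
  .all e fun j => .neg (.realLt (.const 1)
    (.mul (.mul (diffExp (e + 1) (φ.1.succAbove j)) (diffExp (e + 1) (φ.1.succAbove j)))
      (.mul (.ofNat (.var 2)) (.ofNat (.var 2)))))

/-- Search the output points of the current cell for one that is close to the point in real array
`5`. -/
def searchClose (φ : Fin (e + 1) × Bool) : Prog :=
  .seq (.setNat 13 (.var 4))
    (.loop (.conj (.natLt (.var 13) (.var 3)) (.neg (closeTest φ)))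
      (.setNat 13 (.add (.var 13) (.const 1))))

/-- Output the point in real array `5`, unless the search was successful. -/
def appendPoint (d : ℕ) : Prog :=
  .cond (.natLt (.var 13) (.var 3)) .skip
    (.seq (setCells 0 (NExp.mulc d (.var 3)) d fun i => .arr 5 (.const i))
      (.setNat 3 (.add (.var 3) (.const 1))))

/-- Process the current direction of the face `φ`. -/
def visitDir (φ : Fin (e + 1) × Bool) : Prog :=
  .seq (setCells 4 (.const 0) (e + 1) (dirExp φ))
    (.seq (findExtreme (e + 1)) (.seq (searchClose φ) (appendPoint (e + 1))))

/-- Process the directions of the current coarse cell. Natural number variable `4` holds the index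
of its first output point. -/
def visitCell (φ : Fin (e + 1) × Bool) : Prog :=
  .seq (.setNat 4 (.var 3)) (enumDigits 3 2 (visitDir φ) e)

/-- Process the directions of the face `φ`. -/
def visitFace (φ : Fin (e + 1) × Bool) : Prog := enumDigits 2 12 (visitCell φ) e

/-- The memory cells that `visitDir` changes. -/
def visitCells : List (ℕ × ℕ) := [(0, 3), (0, 13), (3, 0), (3, 4)] ++ extremeCells

theorem writesIn_visitDir (φ : Fin (e + 1) × Bool) : (visitDir φ).WritesIn visitCells := by
  have h := (writesIn_findExtreme (e + 1)).mono (W' := visitCells)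
    (List.subset_append_right _ _)
  simp [visitDir, searchClose, appendPoint, Prog.WritesIn, h]
  simp [visitCells]

/-- The point of the output with index `l`. -/
def outPt (d : ℕ) (s : Store) (l : ℕ) : Pt d :=
  WithLp.toLp 2 fun j : Fin d => s.realArr 0 (l * d + j)

/-- The memory holds the model, the matrix of basis vectors and the resolution. -/
structure Env {d m : ℕ} (M : Model d m) (u : Fin d → Pt d) (N : ℕ) (s : Store) : Prop where
  model : HoldsModel M s
  mat : HoldsMat s u
  nv2 : s.natVar 2 = N
  nv12 : s.natVar 12 = 2 * N

theorem Env.frame {d m : ℕ} {M : Model d m} {u : Fin d → Pt d} {N : ℕ} {s s' : Store}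
    {W : List (ℕ × ℕ)} (h : Env M u N s) (hF : Frame W s s') (h0 : (0, 0) ∉ W) (h8 : (3, 8) ∉ W)
    (h1 : (3, 1) ∉ W) (h2 : (2, 0) ∉ W) (h6 : (3, 6) ∉ W) (h3 : (0, 2) ∉ W) (h12 : (0, 12) ∉ W) :
    Env M u N s' :=
  ⟨h.model.frame hF h0 h8 h1 h2, h.mat.frame hF h6, by rw [hF.nv h3, h.nv2],
    by rw [hF.nv h12, h.nv12]⟩

/-- The digits are in the range of the grid. -/
def GridDir.Valid (N : ℕ) (γ : GridDir e) : Prop :=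
  (∀ j, γ.coarse j < 2 * N) ∧ ∀ j, γ.fine j < N

/-- The directions in the same cell as `γ`. -/
def GridDir.SameCell (γ γ' : GridDir e) : Prop := γ.face = γ'.face ∧ γ.coarse = γ'.coarse

/-- The output points are extreme in the directions `g l`, points of the same cell are separated,
and all directions in `C` are represented. -/
structure Reps (H : Pt (e + 1) → ℝ) (u : Fin (e + 1) → Pt (e + 1)) (N : ℕ) (C : Set (GridDir e))
    (g : ℕ → GridDir e) (s : Store) : Prop where
  valid : ∀ γ ∈ C, γ.Valid N
  mem : ∀ l < s.natVar 3, g l ∈ C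
  extreme : ∀ l < s.natVar 3, IsExtreme H ((g l).dir u N) (outPt (e + 1) s l)
  sep : ∀ l < s.natVar 3, ∀ l' < l, (g l).SameCell (g l') →
    ∃ j, 1 / N < |inner ℝ (u ((g l).face.1.succAbove j)) (outPt (e + 1) s l - outPt (e + 1) s l')|
  cover : ∀ γ ∈ C, ∃ l < s.natVar 3, Represents H u N γ.face γ.coarse γ.fine (outPt (e + 1) s l)

theorem Reps.congr {H : Pt (e + 1) → ℝ} {u : Fin (e + 1) → Pt (e + 1)} {N : ℕ}
    {C : Set (GridDir e)} {g : ℕ → GridDir e} {s s' : Store} (h : Reps H u N C g s)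
    (h3 : s'.natVar 3 = s.natVar 3) (h0 : s'.realArr 0 = s.realArr 0) : Reps H u N C g s' := by
  have ho : outPt (e + 1) s' = outPt (e + 1) s := by
    funext l; simp only [outPt, h0]
  constructor
  · exact h.valid
  · rw [h3]; exact h.mem
  · rw [h3, ho]; exact h.extreme
  · rw [h3, ho]; exact h.sep
  · rw [h3, ho]; exact h.cover

theorem val_dirExp {m : ℕ} {M : Model (e + 1) m} {u : Fin (e + 1) → Pt (e + 1)} {N : ℕ} {s : Store}
    (hE : Env M u N s) (φ : Fin (e + 1) × Bool) (i : Fin (e + 1)) :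
    (dirExp φ i).val s =
      faceDir u φ (fun j => gridCoord N (digits e 2 s j) (digits e 3 s j)) i := by
  have hs : ((if φ.2 then 1 else -1 : ℚ) : ℝ) = sgn φ.2 := by
    unfold sgn; split_ifs <;> simp
  have h := hE.mat
  simp only [HoldsMat] at h
  simp only [dirExp, RExp.val, NExp.val, hs, h, RExp.val_sum, faceDir, PiLp.add_apply,
    PiLp.smul_apply, smul_eq_mul, WithLp.ofLp_sum, Finset.sum_apply, coordExp, gridCoord, digits,
    hE.nv2, Rat.cast_neg, Rat.cast_one]

theorem val_diffExp {d m : ℕ} {M : Model d m} {u : Fin d → Pt d} {N : ℕ} {s : Store}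
    (hE : Env M u N s) {p : Pt d} (hp : HoldsVec s 5 p) (k : Fin d) :
    (diffExp d k).val s = inner ℝ (u k) (p - outPt d s (s.natVar 13)) := by
  have h := hE.mat
  simp only [HoldsMat] at h
  rw [inner_eq_sum, diffExp, RExp.val_sum]
  refine Finset.sum_congr rfl fun i _ => ?_
  simp only [RExp.val, NExp.val, h, hp i, NExp.val_mulc, PiLp.sub_apply, outPt]

theorem holds_closeTest {m : ℕ} {M : Model (e + 1) m} {u : Fin (e + 1) → Pt (e + 1)} {N : ℕ}
    (hN : 1 ≤ N) {s : Store} (hE : Env M u N s) {p : Pt (e + 1)} (hp : HoldsVec s 5 p)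
    (φ : Fin (e + 1) × Bool) :
    (closeTest φ).holds s ↔ ∀ j, |inner ℝ (u (φ.1.succAbove j))
      (p - outPt (e + 1) s (s.natVar 13))| ≤ 1 / N := by
  have hN0 : (0 : ℝ) < N := by exact_mod_cast hN
  rw [closeTest, BExp.holds_all]
  refine forall_congr' fun j => ?_
  simp only [BExp.holds, RExp.val, val_diffExp hE hp, NExp.val, hE.nv2, Rat.cast_one, not_lt]
  set z : ℝ := inner ℝ (u (φ.1.succAbove j)) (p - outPt (e + 1) s (s.natVar 13))
  rw [le_div_iff₀ hN0]
  have h1 : z * z * (N * N) = (|z| * N) ^ 2 := by rw [mul_pow, sq_abs]; ring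
  rw [h1, ← abs_of_nonneg (by positivity : 0 ≤ |z| * N), sq_le_one_iff_abs_le_one,
    abs_of_nonneg (by positivity : 0 ≤ |z| * N), abs_of_nonneg (by positivity : 0 ≤ |z| * N)]

/-- The state in which a direction of the cell that starts at the output point `c₀` is
processed. As the cells are processed one after the other, the output points of the current cell
are those from `c₀` on. -/
structure InCell (N : ℕ) (C : Set (GridDir e)) (g : ℕ → GridDir e) (φ : Fin (e + 1) × Bool)
    (X : Fin e → ℕ) (c₀ : ℕ) {m : ℕ} (M : Model (e + 1) m) (u : Fin (e + 1) → Pt (e + 1))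
    (s : Store) : Prop where
  env : Env M u N s
  reps : Reps M.H u N C g s
  nv4 : s.natVar 4 = c₀
  le : c₀ ≤ s.natVar 3
  cell : ∀ l < s.natVar 3, c₀ ≤ l ↔ (g l).face = φ ∧ (g l).coarse = X

/-- The time for one step of the search. -/
def searchTime (φ : Fin (e + 1) × Bool) : ℕ := (closeTest φ).cost + 20

theorem exec_searchClose {m : ℕ} {M : Model (e + 1) m} {u : Fin (e + 1) → Pt (e + 1)} {N c₀ : ℕ}
    (hN : 1 ≤ N) {s : Store} (hE : Env M u N s) {p : Pt (e + 1)} (hp : HoldsVec s 5 p)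
    (φ : Fin (e + 1) × Bool) (h4 : s.natVar 4 = c₀) (hc : c₀ ≤ s.natVar 3) :
    Exec (searchClose φ) s ((s.natVar 3 - c₀ + 1) * searchTime φ) (fun s' =>
      Frame [(0, 13)] s s' ∧ c₀ ≤ s'.natVar 13 ∧ s'.natVar 13 ≤ s.natVar 3 ∧
      (∀ l, c₀ ≤ l → l < s'.natVar 13 → ∃ j, 1 / N <
        |inner ℝ (u (φ.1.succAbove j)) (p - outPt (e + 1) s l)|) ∧
      (s'.natVar 13 < s.natVar 3 → ∀ j,
        |inner ℝ (u (φ.1.succAbove j)) (p - outPt (e + 1) s (s'.natVar 13))| ≤ 1 / N)) := by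
  have hclose : ∀ s', Frame [(0, 13)] s s' → ((closeTest φ).holds s' ↔
      ∀ j, |inner ℝ (u (φ.1.succAbove j)) (p - outPt (e + 1) s (s'.natVar 13))| ≤ 1 / N) := by
    intro s' hF
    have ho : outPt (e + 1) s' = outPt (e + 1) s := by
      funext l; simp only [outPt, hF.ra (show (3, 0) ∉ _ by simp)]
    rw [holds_closeTest hN (hE.frame hF (by simp) (by simp) (by simp) (by simp) (by simp) (by simp)
      (by simp)) (hp.frame hF (by simp)), ho]
  refine (Exec.seq (Exec.setNat ((Exec.loop (T := 4) (fun s' => Frame [(0, 13)] s s' ∧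
    c₀ ≤ s'.natVar 13 ∧ s'.natVar 13 ≤ s.natVar 3 ∧ ∀ l, c₀ ≤ l → l < s'.natVar 13 →
      ∃ j, 1 / N < |inner ℝ (u (φ.1.succAbove j)) (p - outPt (e + 1) s l)|)
    (fun s' => s.natVar 3 - s'.natVar 13) ?_ ?_).mono le_rfl ?_))).mono ?_ fun _ h => h
  · rintro s' ⟨hF, h1, h2, h3⟩ hb
    simp only [BExp.holds, NExp.val, hF.nv (show (0, 3) ∉ _ by simp), hclose s' hF] at hb
    refine (Exec.setNat ?_).mono (by simp [NExp.cost]) fun _ h => h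
    simp only [NExp.val, Store.setNat_natVar, if_true]
    refine ⟨⟨hF.trans (frame_setNat (by simp) _ _), by omega, by omega, fun l hl hl' => ?_⟩,
      by omega⟩
    rcases Nat.lt_succ_iff_lt_or_eq.1 hl' with h | rfl
    · exact h3 l hl h
    · have := hb.2
      push Not at this
      exact this
  · refine ⟨frame_setNat (by simp) _ _, ?_⟩
    simp only [Store.setNat_natVar, if_true, NExp.val, h4]
    exact ⟨le_rfl, hc, fun l h1 h2 => absurd h2 (not_lt.2 h1)⟩
  · rintro s' ⟨⟨hF, h1, h2, h3⟩, hb⟩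
    refine ⟨hF, h1, h2, h3, fun hlt => ?_⟩
    simp only [BExp.holds, NExp.val, hF.nv (show (0, 3) ∉ _ by simp), hclose s' hF, not_and,
      not_not] at hb
    exact hb hlt
  · simp only [Store.setNat_natVar, if_true, NExp.val, h4, NExp.cost, BExp.cost, searchTime]
    have : (s.natVar 3 - c₀ + 1) * ((closeTest φ).cost + 20) =
      (s.natVar 3 - c₀) * (4 + (1 + 1 + 1 + ((closeTest φ).cost + 1) + 1) + 1) +
        10 * (s.natVar 3 - c₀) + ((closeTest φ).cost + 20) := by ring
    omega

theorem represents_of_mem {H : Pt (e + 1) → ℝ} {u : Fin (e + 1) → Pt (e + 1)} {N : ℕ}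
    {γ γ' : GridDir e} {p r : Pt (e + 1)} (hcell : γ'.face = γ.face ∧ γ'.coarse = γ.coarse)
    (hγ' : γ'.Valid N) (hr : IsExtreme H (γ'.dir u N) r) (hp : IsExtreme H (γ.dir u N) p)
    (h : ∀ j, |inner ℝ (u (γ.face.1.succAbove j)) (p - r)| ≤ 1 / N) :
    Represents H u N γ.face γ.coarse γ.fine r := by
  refine ⟨⟨γ'.fine, hγ'.2, ?_⟩, p, hp, h⟩
  unfold GridDir.dir at hr
  rwa [hcell.1, hcell.2] at hr

/-- The time for `appendPoint`. -/
def appendTime (d : ℕ) : ℕ :=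
  20 + setCellsTime (NExp.mulc d (.var 3)) d fun i => .arr 5 (.const i)

theorem exec_appendPoint {N c₀ m : ℕ} {M : Model (e + 1) m} {u : Fin (e + 1) → Pt (e + 1)}
    {C : Set (GridDir e)} {g : ℕ → GridDir e} {γ : GridDir e} {s : Store} {p : Pt (e + 1)}
    (hI : InCell N C g γ.face γ.coarse c₀ M u s) (hγ : γ.Valid N) (hp5 : HoldsVec s 5 p)
    (hp : IsExtreme M.H (γ.dir u N) p) (h1 : c₀ ≤ s.natVar 13) (h2 : s.natVar 13 ≤ s.natVar 3)
    (h3 : ∀ l, c₀ ≤ l → l < s.natVar 13 → ∃ j, 1 / N <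
        |inner ℝ (u (γ.face.1.succAbove j)) (p - outPt (e + 1) s l)|)
    (h4 : s.natVar 13 < s.natVar 3 → ∀ j,
        |inner ℝ (u (γ.face.1.succAbove j)) (p - outPt (e + 1) s (s.natVar 13))| ≤ 1 / N) :
    Exec (appendPoint (e + 1)) s (appendTime (e + 1)) (fun s' => s.natVar 3 ≤ s'.natVar 3 ∧
      ∃ g', InCell N (insert γ C) g' γ.face γ.coarse c₀ M u s') := by
  refine (Exec.cond (T := appendTime (e + 1) - 4) (fun hb => ?_) (fun hb => ?_)).mono
    (by simp [BExp.cost, NExp.cost, appendTime]; omega) fun _ h => h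
  · simp only [BExp.holds, NExp.val] at hb
    refine Exec.mono (Exec.skip ⟨le_rfl, g, hI.env, ?_, hI.nv4, hI.le, hI.cell⟩)
      (by simp [appendTime]; omega) fun _ h => h
    refine ⟨?_, fun l hl => Or.inr (hI.reps.mem l hl), hI.reps.extreme, hI.reps.sep, ?_⟩
    · rintro γ' (rfl | h)
      exacts [hγ, hI.reps.valid _ h]
    · rintro γ' (rfl | h)
      · exact ⟨_, hb, represents_of_mem ((hI.cell _ hb).1 h1) (hI.reps.valid _ (hI.reps.mem _ hb))
          (hI.reps.extreme _ hb) hp (h4 hb)⟩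
      · exact hI.reps.cover _ h
  · simp only [BExp.holds, NExp.val] at hb
    have h13 : s.natVar 13 = s.natVar 3 := by omega
    set cnt := s.natVar 3 with hcnt
    refine (Exec.seq ((exec_setCells 0 _ (e + 1) _ s (cnt * (e + 1)) ?_ ?_).mono le_rfl
      fun s₁ hs₁ => Exec.setNat ?_)).mono (by simp [NExp.cost, appendTime]; omega) fun _ h => h
    · simp only [NExp.val_mulc, NExp.val, hcnt]
    · intro j _ s' hF _
      simp only [RExp.val, NExp.val]
      rw [hF.ra (by simp)]
    obtain ⟨hF, hnew, hold⟩ := hs₁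
    have e3 : NExp.val s₁ (.add (.var 3) (.const 1)) = cnt + 1 := by
      simp only [NExp.val, hF.nv (show (0, 3) ∉ _ by simp), hcnt]
    rw [e3]
    set s' := s₁.setNat 3 (cnt + 1) with hs'
    have hF' : Frame [(3, 0), (0, 3)] s s' :=
      (hF.mono (by simp)).trans (frame_setNat (by simp) _ _)
    have hc' : s'.natVar 3 = cnt + 1 := by simp [hs']
    have hout : ∀ l < cnt, outPt (e + 1) s' l = outPt (e + 1) s l := by
      intro l hl
      ext j
      have h := hold (l * (e + 1) + j) (Or.inl (by
        calc l * (e + 1) + j < l * (e + 1) + (e + 1) := by omega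
          _ = (l + 1) * (e + 1) := by ring
          _ ≤ cnt * (e + 1) := Nat.mul_le_mul_right _ hl))
      simpa [outPt, hs'] using h
    have houtn : outPt (e + 1) s' cnt = p := by
      ext j
      have h := hnew j j.2
      simp only [RExp.val, NExp.val, hp5 j] at h
      simpa [outPt, hs'] using h
    refine ⟨by omega, fun l => if l = cnt then γ else g l, ?_, ⟨?_, ?_, ?_, ?_, ?_⟩, ?_, ?_, ?_⟩
    · exact hI.env.frame hF' (by simp) (by simp) (by simp) (by simp) (by simp) (by simp) (by simp)
    · rintro γ' (rfl | h)
      exacts [hγ, hI.reps.valid _ h]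
    · intro l hl
      split_ifs with h
      · exact Or.inl rfl
      · exact Or.inr (hI.reps.mem l (by omega))
    · intro l hl
      split_ifs with h
      · rw [h, houtn]; exact hp
      · rw [hout l (by omega)]; exact hI.reps.extreme l (by omega)
    · intro l hl l' hl'
      rw [if_neg (show l' ≠ cnt by omega), hout l' (by omega)]
      split_ifs with h
      · intro hsame
        rw [h, houtn]
        exact h3 l' ((hI.cell l' (by omega)).2 ⟨hsame.1.symm, hsame.2.symm⟩) (by omega)
      · rw [hout l (by omega)]
        exact hI.reps.sep l (by omega) l' hl'
    · rintro γ' (rfl | h)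
      · refine ⟨cnt, by omega, ?_⟩
        rw [houtn]
        exact represents_of_mem ⟨rfl, rfl⟩ hγ hp hp fun j => by simp
      · obtain ⟨l, hl, hr⟩ := hI.reps.cover _ h
        exact ⟨l, by omega, by rw [hout l hl]; exact hr⟩
    · rw [hF'.nv (by simp), hI.nv4]
    · have := hI.le; omega
    · intro l hl
      split_ifs with h
      · have := hI.le
        simp only [and_self, iff_true]; omega
      · exact hI.cell l (by omega)

theorem exists_exec_visitDir (φ : Fin (e + 1) × Bool) : ∃ K : ℕ, ∀ {m N c₀ : ℕ}
    (M : Model (e + 1) m) (u : Fin (e + 1) → Pt (e + 1)) (C : Set (GridDir e))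
    (g : ℕ → GridDir e) (s : Store), 1 ≤ N →
    (⟨φ, digits e 2 s, digits e 3 s⟩ : GridDir e).Valid N →
    InCell N C g φ (digits e 2 s) c₀ M u s →
    Exec (visitDir φ) s (K * unitTime m + (s.natVar 3 - c₀) * K) (fun s' =>
      (s.natVar 3 ≤ s'.natVar 3 ∧
      ∃ g', InCell N (insert ⟨φ, digits e 2 s, digits e 3 s⟩ C) g' φ (digits e 2 s) c₀ M u s') ∧
      Frame visitCells s s') := by
  obtain ⟨K, hK⟩ := exists_exec_findExtreme_dir (e + 1) (dirExp φ)
  refine ⟨K + searchTime φ + appendTime (e + 1), fun {m N c₀} M u C g s hN hγ hI =>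
    Exec.frame (Exec.mono (hK M s _ hI.env.model (val_dirExp hI.env φ) ?_
      (T := (s.natVar 3 - c₀ + 1) * searchTime φ + appendTime (e + 1))
      fun s₁ p hp hp5 hF₁ => ?_) ?_ fun _ h => h) (writesIn_visitDir φ)⟩
  · intro j _ s' hF
    simp only [dirExp, RExp.val, NExp.val, RExp.val_sum, coordExp]
    rw [hF.ra (by simp), hF.na (by simp), hF.na (by simp), hF.nv (by simp)]
  · have hc₁ : s₁.natVar 3 = s.natVar 3 := hF₁.nv (by simp [extremeCells])
    have hE₁ : Env M u N s₁ := hI.env.frame hF₁ (by simp [extremeCells]) (by simp [extremeCells])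
      (by simp [extremeCells]) (by simp [extremeCells]) (by simp [extremeCells])
      (by simp [extremeCells]) (by simp [extremeCells])
    have hR₁ : Reps M.H u N C g s₁ := hI.reps.congr hc₁ (hF₁.ra (by simp [extremeCells]))
    have h4₁ : s₁.natVar 4 = c₀ := by rw [hF₁.nv (by simp [extremeCells]), hI.nv4]
    refine Exec.seq (((exec_searchClose hN hE₁ hp5 φ h4₁ (by rw [hc₁]; exact hI.le)).mono
      (by rw [hc₁]) fun s₂ h₂ => ?_))
    obtain ⟨hF₂, h1, h2, h3, h4⟩ := h₂
    have hc₂ : s₂.natVar 3 = s₁.natVar 3 := hF₂.nv (by simp)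
    have ho : outPt (e + 1) s₂ = outPt (e + 1) s₁ := by
      funext l; simp only [outPt, hF₂.ra (show (3, 0) ∉ _ by simp)]
    refine (exec_appendPoint (γ := ⟨φ, digits e 2 s, digits e 3 s⟩) (C := C) (g := g) (p := p)
      ⟨hE₁.frame hF₂ (by simp) (by simp) (by simp) (by simp) (by simp) (by simp) (by simp),
        hR₁.congr hc₂ (hF₂.ra (by simp)), by rw [hF₂.nv (by simp), h4₁], by
        rw [hc₂, hc₁]; exact hI.le, by rw [hc₂, hc₁]; exact hI.cell⟩ hγ
      (hp5.frame hF₂ (by simp)) hp h1 (by rw [hc₂]; exact h2) (by rw [ho]; exact h3)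
      (by rw [ho, hc₂]; exact h4)).mono le_rfl ?_
    rintro s₃ ⟨h5, h6⟩
    exact ⟨by omega, h6⟩
  · have h1 := le_mul_unitTime (searchTime φ) m
    have h2 := le_mul_unitTime (appendTime (e + 1)) m
    have h3 : (s.natVar 3 - c₀) * searchTime φ ≤
      (s.natVar 3 - c₀) * (K + searchTime φ + appendTime (e + 1)) :=
      Nat.mul_le_mul_left _ (by omega)
    rw [add_mul (s.natVar 3 - c₀), add_mul, add_mul, one_mul]
    omega

end Visit

end UncertainKernel

namespace UncertainKernel

/-! ### All directions of the grid -/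

section Faces

variable {e : ℕ}

theorem InCell.frame {N c₀ m : ℕ} {C : Set (GridDir e)} {g : ℕ → GridDir e}
    {φ : Fin (e + 1) × Bool} {X : Fin e → ℕ} {M : Model (e + 1) m}
    {u : Fin (e + 1) → Pt (e + 1)} {s s' : Store} (h : InCell N C g φ X c₀ M u s)
    (hF : Frame [(2, 3)] s s') : InCell N C g φ X c₀ M u s' := by
  have h3 : s'.natVar 3 = s.natVar 3 := hF.nv (by simp)
  exact ⟨h.env.frame hF (by simp) (by simp) (by simp) (by simp) (by simp) (by simp) (by simp),
    h.reps.congr h3 (hF.ra (by simp)), by rw [hF.nv (by simp), h.nv4], by rw [h3]; exact h.le,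
    by rw [h3]; exact h.cell⟩

theorem digits_frame {a : ℕ} {s s' : Store} {W : List (ℕ × ℕ)} (hF : Frame W s s')
    (ha : (2, a) ∉ W) : digits e a s' = digits e a s := by
  funext j; simp only [digits, hF.na ha]

theorem mem_digitBox_self {R : ℕ} {D D' : Fin e → ℕ} : D' ∈ digitBox R e D ↔ ∀ j, D' j < R :=
  ⟨fun h j => (h j).1 j.2, fun h j => ⟨fun _ => h j, fun hj => absurd j.2 (not_lt.2 hj)⟩⟩

/-- The memory cells that `visitCell` changes. -/
def cellCells : List (ℕ × ℕ) := [(0, 4), (2, 3)] ++ visitCells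

theorem writesIn_visitCell (φ : Fin (e + 1) × Bool) : (visitCell φ).WritesIn cellCells :=
  ⟨by simp [Prog.WritesIn, cellCells], writesIn_enumDigits
    ((writesIn_visitDir φ).mono (List.subset_append_right _ _)) (by simp) _⟩

/-- The running time is amortized: the comparisons with the output points of the cell are paid for
by the points that the cell adds to the output. -/
theorem exists_runs_visitCell (φ : Fin (e + 1) × Bool) : ∃ K : ℕ, ∀ {m N : ℕ}
    (M : Model (e + 1) m) (u : Fin (e + 1) → Pt (e + 1)) (C : Set (GridDir e))
    (g : ℕ → GridDir e) (s : Store), 1 ≤ N → (∀ j, digits e 2 s j < 2 * N) →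
    Env M u N s → Reps M.H u N C g s →
    (∀ γ ∈ C, ¬ (γ.face = φ ∧ γ.coarse = digits e 2 s)) →
    ∃ τ s', Runs (visitCell φ) s τ s' ∧ s.natVar 3 ≤ s'.natVar 3 ∧ Env M u N s' ∧
      (∃ g', Reps M.H u N (C ∪ {γ | γ.face = φ ∧ γ.coarse = digits e 2 s ∧ ∀ j, γ.fine j < N})
        g' s') ∧ Frame cellCells s s' ∧
      τ ≤ N ^ e * (K * unitTime m + (s'.natVar 3 - s.natVar 3) * K) + enumOverhead N e + 2 := by
  obtain ⟨K, hK⟩ := exists_exec_visitDir φ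
  refine ⟨K, fun {m N} M u C g s hN hX hE hR hC => ?_⟩
  set X := digits e 2 s with hXdef
  set c₀ := s.natVar 3 with hc₀
  set s₁ := s.setNat 4 c₀ with hs₁
  have hF₁ : Frame [(0, 4)] s s₁ := frame_setNat (by simp) _ _
  have h := runs_enumDigits (e := e) (a := 3) (bnd := 2) (R := N) (body := visitDir φ)
    (fun W n s' t => (∃ g', InCell N (C ∪ {γ | γ.face = φ ∧ γ.coarse = X ∧ γ.fine ∈ W}) g' φ X c₀
        M u s') ∧ digits e 2 s' = X ∧ t ≤ n * (K * unitTime m + (s'.natVar 3 - c₀) * K))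
    ?_ ?_ ?_ e le_rfl ∅ 0 s₁ 0 ?_ (fun i hi => absurd i.2 (not_lt.2 hi)) (fun _ _ h => h)
  · obtain ⟨τ, s', t', hr, -, ⟨⟨g', hI⟩, -, ht⟩, hτ⟩ := h
    have hrun : Runs (visitCell φ) s (2 + τ) s' := .seq (.setNat s 4 (.var 3)) hr
    refine ⟨_, s', hrun, hI.le, hI.env, ⟨g', ?_⟩, hrun.frame (writesIn_visitCell φ), ?_⟩
    · have h2 := hI.reps
      simpa only [Set.empty_union, mem_digitBox_self] using h2
    · rw [zero_add] at ht
      omega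
  · rintro W n s' t j k ⟨⟨g', hI⟩, hd, ht⟩
    have hF : Frame [(2, 3)] s' (s'.setNatArr 3 j k) := frame_setNatArr (by simp) _ _ _
    exact ⟨⟨g', hI.frame hF⟩, (digits_frame hF (by simp)).trans hd, ht⟩
  · rintro W n s' t ⟨⟨g', hI⟩, -, -⟩
    exact hI.env.nv2
  · rintro W n s' t ⟨⟨g', hI⟩, hd, ht⟩ hlt -
    obtain ⟨τ, s'', hr, hτ, ⟨hle, g'', hI'⟩, hF⟩ := hK M u _ g' s' hN
      ⟨fun j => by rw [hd]; exact hX j, hlt⟩ (by rw [hd]; exact hI)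
    have hd' : digits e 3 s'' = digits e 3 s' :=
      digits_frame hF (by simp [visitCells, extremeCells])
    refine ⟨τ, s'', hr, hd', ⟨g'', ?_⟩,
      (digits_frame hF (by simp [visitCells, extremeCells])).trans hd, ?_⟩
    · rw [hd] at hI'
      convert hI' using 1
      ext ⟨a, b, c⟩
      simp only [Set.mem_union, Set.mem_ofPred_eq, Set.mem_insert_iff, GridDir.mk.injEq]
      tauto
    · have h1 : (s'.natVar 3 - c₀) * K ≤ (s''.natVar 3 - c₀) * K :=
        Nat.mul_le_mul_right _ (by omega)
      have h2 : n * (K * unitTime m + (s'.natVar 3 - c₀) * K) ≤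
        n * (K * unitTime m + (s''.natVar 3 - c₀) * K) := Nat.mul_le_mul_left _ (by omega)
      rw [add_mul, one_mul]
      omega
  · have h3 : s₁.natVar 3 = s.natVar 3 := hF₁.nv (by simp)
    refine ⟨⟨g, hE.frame hF₁ (by simp) (by simp) (by simp) (by simp) (by simp) (by simp) (by simp),
      ?_, by simp [hs₁], by rw [h3], ?_⟩, digits_frame hF₁ (by simp), by simp⟩
    · simpa using hR.congr h3 (hF₁.ra (by simp))
    · intro l hl
      rw [h3] at hl
      exact ⟨fun h => absurd hl (not_lt.2 h), fun h => absurd h (hC _ (hR.mem l hl))⟩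

/-- The packing bound applies at any time, since the output points of a cell are separated. -/
theorem Reps.count_le {H : Pt (e + 1) → ℝ} {u : Fin (e + 1) → Pt (e + 1)} {N : ℕ}
    {C : Set (GridDir e)} {g : ℕ → GridDir e} {s : Store} (h : Reps H u N C g s)
    (hu : IsFat H (e + 1) u) (hN : 1 ≤ N) :
    s.natVar 3 ≤ 2 * (e + 1) * (2 * packBound e N) ^ e := by
  refine card_le_of_separated hu hN (fun l : Fin (s.natVar 3) => g l)
    (fun l => outPt (e + 1) s l) (fun l => (h.valid _ (h.mem l l.2)).2)
    (fun l => (h.valid _ (h.mem l l.2)).1) (fun l => h.extreme l l.2) ?_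
  intro l l' hne h1 h2
  rcases lt_or_gt_of_ne (fun h => hne (Fin.ext h)) with hlt | hlt
  · obtain ⟨j, hj⟩ := h.sep l' l'.2 l hlt ⟨h1.symm, h2.symm⟩
    refine ⟨j, ?_⟩
    rwa [← abs_neg, ← inner_neg_right, neg_sub, h1]
  · exact h.sep l l.2 l' hlt ⟨h1, h2⟩

/-- The constant in the bound for the number of output points. -/
def countConst (e : ℕ) : ℕ := 2 * (e + 1) * (2 * ((2 ^ (e + 1) + 2) * (e + 1) + 1)) ^ e

theorem packing_le {e N : ℕ} (hN : 1 ≤ N) :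
    2 * (e + 1) * (2 * packBound e N) ^ e ≤ countConst e * N ^ e := by
  calc 2 * (e + 1) * (2 * packBound e N) ^ e
      ≤ 2 * (e + 1) * (2 * ((2 ^ (e + 1) + 2) * (e + 1) + 1) * N) ^ e := by
        refine Nat.mul_le_mul_left _ (Nat.pow_le_pow_left ?_ _)
        rw [mul_assoc]
        refine Nat.mul_le_mul_left _ ?_
        rw [packBound, add_mul _ 1 N, one_mul]
        omega
    _ = countConst e * N ^ e := by rw [countConst, mul_pow]; ring

theorem exists_runs_visitFace (φ : Fin (e + 1) × Bool) : ∃ K : ℕ, ∀ {m N : ℕ}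
    (M : Model (e + 1) m) (u : Fin (e + 1) → Pt (e + 1)) (C : Set (GridDir e))
    (g : ℕ → GridDir e) (s : Store), 1 ≤ N → IsFat M.H (e + 1) u → Env M u N s →
    Reps M.H u N C g s → (∀ γ ∈ C, γ.face ≠ φ) →
    Exec (visitFace φ) s (K * (N ^ e * N ^ e * unitTime m)) (fun s' => Env M u N s' ∧
      ∃ g', Reps M.H u N (C ∪ {γ | γ.face = φ ∧ γ.Valid N}) g' s') := by
  obtain ⟨K, hK⟩ := exists_runs_visitCell φ
  refine ⟨2 ^ e * (K + 19 * e + 2) + K * countConst e + 19 * e * 2 ^ e,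
    fun {m N} M u C g s hN hu hE hR hC => ?_⟩
  set c₁ := s.natVar 3 with hc₁
  set A := N ^ e * (K * unitTime m) + enumOverhead N e + 2 with hA
  have h := runs_enumDigits (e := e) (a := 2) (bnd := 12) (R := 2 * N) (body := visitCell φ)
    (fun V n s' t => Env M u N s' ∧
      (∃ g', Reps M.H u N (C ∪ {γ | γ.face = φ ∧ γ.coarse ∈ V ∧ ∀ j, γ.fine j < N}) g' s') ∧
      c₁ ≤ s'.natVar 3 ∧ t ≤ n * A + N ^ e * ((s'.natVar 3 - c₁) * K))
    ?_ ?_ ?_ e le_rfl ∅ 0 s 0 ?_ (fun i hi => absurd i.2 (not_lt.2 hi)) (fun _ _ h => h)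
  · obtain ⟨τ, s', t', hr, -, ⟨hE', ⟨g', hR'⟩, -, ht⟩, hτ⟩ := h
    refine ⟨τ, s', hr, ?_, hE', g', ?_⟩
    · have hcnt := (hR'.count_le hu hN).trans (packing_le hN)
      set P := N ^ e with hP
      set U := unitTime m with hU
      have hP1 : 1 ≤ P := Nat.one_le_pow _ _ hN
      have hU1 : 1 ≤ U := Nat.mul_pos (by omega) (by omega)
      have h1 : enumOverhead N e ≤ 19 * e * P := enumOverhead_le hN e
      have h2 : enumOverhead (2 * N) e ≤ 19 * e * (2 ^ e * P) := by
        rw [hP, ← mul_pow]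
        exact enumOverhead_le (by omega) e
      have hPU : 1 ≤ P * U := Nat.mul_pos hP1 hU1
      have hA' : A ≤ (K + 19 * e + 2) * (P * U) := by
        have a1 : 19 * e * P ≤ 19 * e * (P * U) :=
          Nat.mul_le_mul_left _ (Nat.le_mul_of_pos_right _ hU1)
        have a2 : (K + 19 * e + 2) * (P * U) = P * (K * U) + 19 * e * (P * U) + 2 * (P * U) := by
          ring
        rw [a2, hA]; omega
      have h3 : (0 + (2 * N) ^ e) * A ≤ 2 ^ e * (K + 19 * e + 2) * (P * P * U) := by
        rw [zero_add, mul_pow]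
        calc 2 ^ e * P * A ≤ 2 ^ e * P * ((K + 19 * e + 2) * (P * U)) := Nat.mul_le_mul_left _ hA'
          _ = _ := by ring
      have h4 : P * ((s'.natVar 3 - c₁) * K) ≤ K * countConst e * (P * P * U) := by
        calc P * ((s'.natVar 3 - c₁) * K) ≤ P * (countConst e * P * K) :=
              Nat.mul_le_mul_left _ (Nat.mul_le_mul_right _ (by omega))
          _ = K * countConst e * (P * P) * 1 := by ring
          _ ≤ K * countConst e * (P * P) * U := Nat.mul_le_mul_left _ hU1
          _ = _ := by ring
      have h5 : 19 * e * (2 ^ e * P) ≤ 19 * e * 2 ^ e * (P * P * U) := by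
        calc 19 * e * (2 ^ e * P) = 19 * e * 2 ^ e * P * 1 := by ring
          _ ≤ 19 * e * 2 ^ e * P * (P * U) := Nat.mul_le_mul_left _ hPU
          _ = _ := by ring
      rw [zero_add] at hτ
      rw [add_mul, add_mul]
      omega
    · convert hR' using 1
      ext γ
      simp only [Set.mem_union, Set.mem_ofPred_eq, Set.mem_empty_iff_false, false_or,
        mem_digitBox_self, GridDir.Valid]
  · rintro V n s' t j k ⟨hE', ⟨g', hR'⟩, hle, ht⟩
    have hF : Frame [(2, 2)] s' (s'.setNatArr 2 j k) := frame_setNatArr (by simp) _ _ _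
    exact ⟨hE'.frame hF (by simp) (by simp) (by simp) (by simp) (by simp) (by simp) (by simp),
      ⟨g', hR'.congr (hF.nv (by simp)) (hF.ra (by simp))⟩, hle, ht⟩
  · rintro V n s' t ⟨hE', -⟩
    exact hE'.nv12
  · rintro V n s' t ⟨hE', ⟨g', hR'⟩, hle, ht⟩ hlt hV
    obtain ⟨τ, s'', hr, hle', hE'', hR'', hF, hτ⟩ := hK M u _ g' s' hN hlt hE' hR' (by
      rintro γ (h | h) ⟨h1, h2⟩
      · exact hC γ h h1
      · exact hV (h2 ▸ h.2.1))
    obtain ⟨g'', hR''⟩ := hR''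
    have hd := digits_frame (e := e) (a := 2) hF (by simp [cellCells, visitCells, extremeCells])
    refine ⟨τ, s'', hr, hd, hE'', ⟨g'', ?_⟩, hle.trans hle', ?_⟩
    · convert hR'' using 1
      ext γ
      simp only [Set.mem_union, Set.mem_ofPred_eq, Set.mem_insert_iff]
      tauto
    · have h1 : s''.natVar 3 - c₁ = (s'.natVar 3 - c₁) + (s''.natVar 3 - s'.natVar 3) := by omega
      have h2 : (n + 1) * A + N ^ e * ((s''.natVar 3 - c₁) * K) = n * A +
          N ^ e * ((s'.natVar 3 - c₁) * K) + (N ^ e * (K * unitTime m +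
            (s''.natVar 3 - s'.natVar 3) * K) + enumOverhead N e + 2) := by
        rw [h1, hA]; ring
      rw [h2]; omega
  · refine ⟨hE, ⟨g, ?_⟩, le_rfl, by simp⟩
    simpa using hR

/-- Process the directions of all faces in the list. -/
def visitFaces : List (Fin (e + 1) × Bool) → Prog
  | [] => .skip
  | φ :: L => .seq (visitFace φ) (visitFaces L)

theorem exists_exec_visitFaces (L : List (Fin (e + 1) × Bool)) : L.Nodup → ∃ K : ℕ, ∀ {m N : ℕ}
    (M : Model (e + 1) m) (u : Fin (e + 1) → Pt (e + 1)) (C : Set (GridDir e))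
    (g : ℕ → GridDir e) (s : Store), 1 ≤ N → IsFat M.H (e + 1) u → Env M u N s →
    Reps M.H u N C g s → (∀ γ ∈ C, γ.face ∉ L) →
    Exec (visitFaces L) s (K * (N ^ e * N ^ e * unitTime m)) (fun s' =>
      ∃ g', Reps M.H u N (C ∪ {γ | γ.face ∈ L ∧ γ.Valid N}) g' s') := by
  induction L with
  | nil =>
    intro _
    refine ⟨1, fun {m N} M u C g s hN hu hE hR hC => Exec.mono (Exec.skip ⟨g, ?_⟩) ?_
      fun _ h => h⟩
    · have h1 : 0 < N ^ e := Nat.pow_pos hN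
      have h2 : 0 < unitTime m := Nat.mul_pos (by omega) (by omega)
      rw [one_mul]
      exact Nat.mul_pos (Nat.mul_pos h1 h1) h2
    · simpa using hR
  | cons φ L ih =>
    intro hL
    obtain ⟨hφ, hL⟩ := List.nodup_cons.1 hL
    obtain ⟨K₁, h₁⟩ := exists_runs_visitFace φ
    obtain ⟨K₂, h₂⟩ := ih hL
    refine ⟨K₁ + K₂, fun {m N} M u C g s hN hu hE hR hC => ?_⟩
    rw [add_mul]
    refine Exec.seq ((h₁ M u C g s hN hu hE hR fun γ hγ h => hC γ hγ (by simp [h])).mono le_rfl ?_)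
    rintro s₁ ⟨hE₁, g₁, hR₁⟩
    refine (h₂ M u _ g₁ s₁ hN hu hE₁ hR₁ ?_).mono le_rfl ?_
    · rintro γ (h | h)
      · exact fun h' => hC γ h (by simp [h'])
      · rw [h.1]; exact hφ
    · rintro s₂ ⟨g₂, hR₂⟩
      refine ⟨g₂, ?_⟩
      convert hR₂ using 1
      ext γ
      simp only [Set.mem_union, Set.mem_ofPred_eq, List.mem_cons]
      tauto

end Faces

end UncertainKernel

namespace UncertainKernel

/-! ### The program -/

/-- The memory holds the uncertain points, with the locations in the array that is to become the
output array. -/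
structure HoldsInput {d m : ℕ} (M : Model d m) (s : Store) : Prop where
  nv0 : s.natVar 0 = m
  loc : ∀ i < m, ∀ j : Fin d, s.realArr 0 (i * d + j) = M.loc i j
  prob : ∀ i < m, s.realArr 1 i = M.prob i
  owner : ∀ i < m, s.natArr 0 i = M.owner i

/-- Move the locations out of the output array. -/
def copyLoc (d : ℕ) : Prog :=
  forVar 10 (.var 0) (setCells 8 (NExp.mulc d (.var 10)) d
    fun j => .arr 0 (.add (NExp.mulc d (.var 10)) (.const j)))

/-- The running time of the body of the loop in `copyLoc`. -/
def copyLocTime (d : ℕ) : ℕ :=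
  setCellsTime (NExp.mulc d (.var 10)) d
    fun j => .arr 0 (.add (NExp.mulc d (.var 10)) (.const j))

theorem exec_copyLoc {d m : ℕ} {M : Model d m} {s : Store} (h : HoldsInput M s) :
    Exec (copyLoc d) s ((copyLocTime d + 9) * unitTime m)
      (fun s' => HoldsModel M s' ∧ Frame [(0, 10), (3, 8)] s s') := by
  refine (exec_forVar (T := copyLocTime d) (n := m)
    (fun i s' => Frame [(0, 10), (3, 8)] s s' ∧ ∀ k < i, ∀ j : Fin d,
      s'.realArr 8 (k * d + j) = s.realArr 0 (k * d + j)) ?_ ?_ ?_).mono ?_ ?_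
  · exact ⟨frame_setNat (by simp) _ _, fun k hk => absurd hk (Nat.not_lt_zero _)⟩
  · rintro i s' ⟨hF, -⟩
    simp only [NExp.val]
    rw [hF.nv (by simp), h.nv0]
  · rintro i hi s' ⟨hF, hc⟩ h10
    refine (exec_setCells 8 _ d _ s' (i * d) ?_ ?_).mono le_rfl ?_
    · simp only [NExp.val_mulc, NExp.val, h10]
    · intro j _ s'' hF' _
      simp only [RExp.val, NExp.val, NExp.val_mulc]
      rw [hF'.ra (by simp), hF'.nv (by simp)]
    · rintro s'' ⟨hF', hnew, hold⟩
      refine ⟨by rw [hF'.nv (by simp), h10], (hF.trans (hF'.mono (by simp))).trans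
        (frame_setNat (by simp) _ _), fun k hk j => ?_⟩
      rw [Store.setNat_realArr]
      rcases Nat.lt_succ_iff_lt_or_eq.1 hk with hk | rfl
      · rw [hold _ (Or.inl ?_), hc k hk j]
        calc k * d + j < k * d + d := by omega
          _ = (k + 1) * d := by ring
          _ ≤ i * d := Nat.mul_le_mul_right _ hk
      · rw [hnew j j.2]
        simp only [RExp.val, NExp.val, NExp.val_mulc, h10]
        rw [hF.ra (by simp)]
  · simp only [NExp.cost]
    calc (m + 1) * (copyLocTime d + 1 + 8) = (copyLocTime d + 9) * ((m + 1) * 1) := by ring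
      _ ≤ _ := Nat.mul_le_mul_left _ (Nat.mul_le_mul_left _ (by omega))
  · rintro s' ⟨hF, hc⟩
    refine ⟨⟨by rw [hF.nv (by simp), h.nv0], fun i hi j => ?_, fun i hi => ?_, fun i hi => ?_⟩, hF⟩
    · rw [hc i hi j, h.loc i hi j]
    · rw [hF.ra (by simp), h.prob i hi]
    · rw [hF.na (by simp), h.owner i hi]

/-- Twice the constant of `exists_near_extreme`. -/
def accuracy (e : ℕ) : ℚ := 2 * (e * (2 * 2 ^ (e + 1) + 1))

/-- `N` is the smallest positive resolution of the grid that suffices for the error `ε`. It is of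
the order of `1 / √ε`, and found without a square root. -/
structure IsResolution (e : ℕ) (ε : ℝ) (N : ℕ) : Prop where
  pos : 1 ≤ N
  le : (accuracy e : ℝ) ≤ N * N * ε
  lt : ∀ k, 1 ≤ k → k < N → k * k * ε < accuracy e

theorem accuracy_nonneg (e : ℕ) : (0 : ℝ) ≤ accuracy e := by
  exact_mod_cast (by unfold accuracy; positivity : (0 : ℚ) ≤ accuracy e)

theorem exists_isResolution (e : ℕ) {ε : ℝ} (hε : 0 < ε) : ∃ N, IsResolution e ε N := by
  classical
  have h : ∃ N : ℕ, 1 ≤ N ∧ (accuracy e : ℝ) ≤ N * N * ε := by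
    obtain ⟨N, hN⟩ := exists_nat_ge (accuracy e / ε : ℝ)
    refine ⟨N + 1, by omega, ?_⟩
    rw [div_le_iff₀ hε] at hN
    refine hN.trans (mul_le_mul_of_nonneg_right ?_ hε.le)
    push_cast
    nlinarith [Nat.cast_nonneg (α := ℝ) N]
  refine ⟨Nat.find h, (Nat.find_spec h).1, (Nat.find_spec h).2, fun k hk hlt => ?_⟩
  by_contra hc
  exact Nat.find_min h hlt ⟨hk, not_lt.1 hc⟩

/-- In dimension one, there is nothing to discretize. -/
theorem IsResolution.eq_one {ε : ℝ} {N : ℕ} (h : IsResolution 0 ε N) (hε : 0 < ε) : N = 1 := by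
  by_contra hne
  have := h.lt 1 le_rfl (by have := h.pos; omega)
  simp only [accuracy] at this
  norm_num at this
  linarith

theorem IsResolution.sq_le {e N : ℕ} {ε : ℝ} (h : IsResolution e ε N) (hε : 0 < ε) (hε1 : ε ≤ 1) :
    (N : ℝ) ^ 2 ≤ (4 * accuracy e + 1) * (1 / ε) := by
  have ha := accuracy_nonneg e
  rw [mul_one_div, le_div_iff₀ hε]
  rcases Nat.eq_or_lt_of_le h.pos with h1 | h1
  · rw [← h1]; norm_num; linarith
  · obtain ⟨k, rfl⟩ : ∃ k, N = k + 1 := ⟨N - 1, by omega⟩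
    have hk : 1 ≤ k := by omega
    have hlt := h.lt k hk (by omega)
    have hk' : (1 : ℝ) ≤ k := by exact_mod_cast hk
    have h2 : ((k + 1 : ℕ) : ℝ) ^ 2 ≤ 4 * (k * k) := by push_cast; nlinarith
    nlinarith

/-- Compute the resolution of the grid and twice that number, and set the number of output points
to `0`. -/
def initGrid (e : ℕ) : Prog :=
  .seq (.setNat 2 (.const 1)) (.seq
    (.loop (.realLt (.mul (.mul (.ofNat (.var 2)) (.ofNat (.var 2))) (.var 0))
      (.const (accuracy e))) (.setNat 2 (.add (.var 2) (.const 1))))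
    (.seq (.setNat 12 (.add (.var 2) (.var 2))) (.setNat 3 (.const 0))))

theorem exec_initGrid {e N : ℕ} {ε : ℝ} {s : Store} (hN : IsResolution e ε N)
    (hs : s.realVar 0 = ε) : Exec (initGrid e) s (30 * N) (fun s' =>
      s'.natVar 2 = N ∧ s'.natVar 12 = 2 * N ∧ s'.natVar 3 = 0 ∧
      Frame [(0, 2), (0, 12), (0, 3)] s s') := by
  have hN1 := hN.pos
  refine (Exec.seq (Exec.setNat (Exec.seq (T₂ := 6) ((Exec.loop (T := 4)
    (fun s' => 1 ≤ s'.natVar 2 ∧ s'.natVar 2 ≤ N ∧ Frame [(0, 2), (0, 12), (0, 3)] s s')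
    (fun s' => N - s'.natVar 2) ?_ ?_).mono le_rfl ?_)))).mono ?_ fun _ h => h
  · rintro s' ⟨h1, h2, hF⟩ hb
    simp only [BExp.holds, RExp.val, NExp.val, hF.rv (show (1, 0) ∉ _ by simp), hs] at hb
    have hlt : s'.natVar 2 < N := by
      refine lt_of_le_of_ne h2 fun h => ?_
      rw [h] at hb
      exact absurd hN.le (not_le.2 hb)
    refine (Exec.setNat ?_).mono (by simp [NExp.cost]) fun _ h => h
    simp only [NExp.val, Store.setNat_natVar, if_true]
    exact ⟨⟨by omega, hlt, hF.trans (frame_setNat (by simp) _ _)⟩, by omega⟩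
  · simp only [NExp.val, Store.setNat_natVar, if_true]
    exact ⟨le_rfl, hN1, frame_setNat (by simp) _ _⟩
  · rintro s' ⟨⟨h1, h2, hF⟩, hb⟩
    simp only [BExp.holds, RExp.val, NExp.val, hF.rv (show (1, 0) ∉ _ by simp), hs] at hb
    have h2N : s'.natVar 2 = N := by
      refine le_antisymm h2 (not_lt.1 fun h => hb (hN.lt _ h1 h))
    refine (Exec.seq (Exec.setNat (Exec.setNat ?_))).mono (by simp [NExp.cost]) fun _ h => h
    refine ⟨by simp [h2N], by simp [NExp.val, h2N]; omega, by simp [NExp.val], ?_⟩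
    exact (hF.trans (frame_setNat (by simp) _ _)).trans (frame_setNat (by simp) _ _)
  · simp [NExp.cost, BExp.cost, RExp.cost, NExp.val]
    omega

/-- All faces of the cube of directions. -/
def allFaces (e : ℕ) : List (Fin (e + 1) × Bool) := Finset.univ.toList

/-- The program that computes an exp-kernel in dimension `e + 1`. -/
def kernelProg (e : ℕ) : Prog :=
  .seq (copyLoc (e + 1)) (.seq (eliminateRows (e + 1) (e + 1)) (.seq (initGrid e)
    (.seq (visitFaces (allFaces e)) (.setNat 0 (.var 3)))))

theorem mem_output {d : ℕ} {s : Store} {p : Pt d} :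
    p ∈ s.output d ↔ ∃ l < s.outputSize, outPt d s l = p := by
  simp [Store.output, outPt]

theorem Reps.isExpKernel {e m N : ℕ} {M : Model (e + 1) m} {u : Fin (e + 1) → Pt (e + 1)}
    {g : ℕ → GridDir e} {s : Store} {ε : ℝ} (h : Reps M.H u N {γ | γ.Valid N} g s)
    (hu : IsFat M.H (e + 1) u) (hN : IsResolution e ε N) :
    IsExpKernel ε (width M.H) ((s.setNat 0 (s.natVar 3)).output (e + 1)) := by
  have hmem : ∀ p, p ∈ (s.setNat 0 (s.natVar 3)).output (e + 1) ↔
      ∃ l < s.natVar 3, outPt (e + 1) s l = p := by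
    intro p
    rw [mem_output]
    simp [Store.outputSize, outPt]
  have hN0 : (0 : ℝ) < N := by exact_mod_cast hN.pos
  refine isExpKernel_of_near_extreme M.exists_extreme
    (η := e * (2 * 2 ^ (e + 1) + 1) / (N * N)) ?_ ?_ ?_
  · have := hN.le
    rw [accuracy] at this
    push_cast at this
    rw [mul_div_assoc', div_le_iff₀ (by positivity)]
    linarith
  · intro r hr
    obtain ⟨l, hl, rfl⟩ := (hmem r).1 hr
    exact ⟨_, h.extreme l hl⟩
  · intro v
    refine exists_near_extreme M.exists_extreme hu hN.pos (S := {r | r ∈ _}) ?_ v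
    intro φ X f hX hf
    obtain ⟨l, hl, hr⟩ := h.cover ⟨φ, X, f⟩ ⟨hX, hf⟩
    exact ⟨_, (hmem _).2 ⟨l, hl, rfl⟩, hr⟩

theorem exists_exec_kernelProg (e : ℕ) : ∃ K : ℕ, ∀ {m N : ℕ} (M : Model (e + 1) m) (s : Store)
    {ε : ℝ}, 0 < ε → IsResolution e ε N → HoldsInput M s → s.realVar 0 = ε →
    Exec (kernelProg e) s (K * (N ^ e * N ^ e * unitTime m)) (fun s' =>
      s'.outputSize ≤ countConst e * N ^ e ∧ IsExpKernel ε (width M.H) (s'.output (e + 1))) := by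
  obtain ⟨K₁, h₁⟩ := exists_exec_eliminateRows (e + 1) (e + 1) le_rfl
  obtain ⟨K₂, h₂⟩ := exists_exec_visitFaces (allFaces e) (Finset.nodup_toList _)
  refine ⟨copyLocTime (e + 1) + 9 + K₁ + 30 + K₂ + 2, fun {m N} M s ε hε hN hM hs => ?_⟩
  have hN1 := hN.pos
  refine Exec.mono (Exec.seq ((exec_copyLoc hM).mono le_rfl ?_))
    (?_ : _ + (K₁ * unitTime m + (30 * N + (K₂ * (N ^ e * N ^ e * unitTime m) + 2))) ≤ _)
    fun _ h => h
  · rintro s₁ ⟨hM₁, hF₁⟩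
    refine Exec.seq ((h₁ M s₁ hM₁).mono le_rfl ?_)
    rintro s₂ ⟨⟨u, hu, hm⟩, hF₂⟩
    refine Exec.seq ((exec_initGrid hN ?_).mono le_rfl ?_)
    · rw [hF₂.rv (by simp [basisCells, extremeCells]), hF₁.rv (by simp), hs]
    rintro s₃ ⟨hn2, hn12, hn3, hF₃⟩
    have hE : Env M u N s₃ := ⟨(hM₁.frame hF₂ (by simp [basisCells, extremeCells])
      (by simp [basisCells, extremeCells]) (by simp [basisCells, extremeCells])
      (by simp [basisCells, extremeCells])).frame hF₃ (by simp) (by simp) (by simp) (by simp),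
      hm.frame hF₃ (by simp), hn2, hn12⟩
    refine Exec.seq ((h₂ M u ∅ (fun _ => ⟨(0, true), 0, 0⟩) s₃ hN1 hu hE
      ⟨by simp, by simp [hn3], by simp [hn3], by simp [hn3], by simp⟩ (by simp)).mono le_rfl ?_)
    rintro s₄ ⟨g, hR⟩
    have hall : (∅ : Set (GridDir e)) ∪ {γ | γ.face ∈ allFaces e ∧ γ.Valid N} =
        {γ | γ.Valid N} := by simp [allFaces]
    rw [hall] at hR
    refine Exec.setNat ⟨?_, hR.isExpKernel hu hN⟩
    simpa [Store.outputSize, NExp.val] using (hR.count_le hu hN1).trans (packing_le hN1)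
  · set U := unitTime m
    have hU : 1 ≤ U := Nat.mul_pos (by omega) (by omega)
    have hP : 1 ≤ N ^ e * N ^ e := Nat.mul_pos (Nat.pow_pos hN1) (Nat.pow_pos hN1)
    -- the search for the resolution takes time `O(N)`
    have hNP : N ≤ N ^ e * N ^ e := by
      rcases Nat.eq_zero_or_pos e with rfl | he
      · simp [hN.eq_one hε]
      · exact (Nat.le_self_pow he.ne' N).trans (Nat.le_mul_of_pos_right _ (Nat.pow_pos hN1))
    set P := N ^ e * N ^ e
    have a1 : (copyLocTime (e + 1) + 9) * U ≤ (copyLocTime (e + 1) + 9) * (P * U) :=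
      Nat.mul_le_mul_left _ (Nat.le_mul_of_pos_left _ hP)
    have a2 : K₁ * U ≤ K₁ * (P * U) := Nat.mul_le_mul_left _ (Nat.le_mul_of_pos_left _ hP)
    have a3 : N ≤ P * U := hNP.trans (Nat.le_mul_of_pos_right _ hU)
    simp only [add_mul _ _ (P * U)] at a1 ⊢
    omega

/-! ### The bounds in terms of `ε` -/

theorem unitTime_le {m : ℕ} (hm : 1 ≤ m) : (unitTime m : ℝ) ≤ 8 * (m * Real.log (m + 1)) := by
  have hm' : (1 : ℝ) ≤ m := by exact_mod_cast hm
  have h2 : 1 / 2 ≤ Real.log 2 := by linarith [Real.log_two_gt_d9]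
  have hlog : Real.log 2 ≤ Real.log (m + 1) := Real.log_le_log (by norm_num) (by linarith)
  have h1 : (Nat.log 2 m : ℝ) * Real.log 2 ≤ Real.log (m + 1) := by
    rw [← Real.log_pow]
    refine Real.log_le_log (by positivity) ?_
    have : 2 ^ Nat.log 2 m ≤ m := Nat.pow_log_le_self 2 (by omega)
    have : (2 : ℝ) ^ Nat.log 2 m ≤ m := by exact_mod_cast this
    linarith
  have h3 : (Nat.log 2 m : ℝ) + 1 ≤ 4 * Real.log (m + 1) := by
    have : (0 : ℝ) ≤ Nat.log 2 m := Nat.cast_nonneg _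
    nlinarith
  have h4 : (unitTime m : ℝ) = (m + 1) * (Nat.log 2 m + 1) := by simp [unitTime]
  rw [h4]
  calc ((m : ℝ) + 1) * (Nat.log 2 m + 1) ≤ (2 * m) * (4 * Real.log (m + 1)) :=
        mul_le_mul (by linarith) h3 (by positivity) (by positivity)
    _ = _ := by ring

theorem IsResolution.pow_le {e N : ℕ} {ε : ℝ} (h : IsResolution e ε N) (hε : 0 < ε)
    (hε1 : ε ≤ 1) :
    (N : ℝ) ^ e ≤ (4 * accuracy e + 1) ^ e * (1 / ε) ^ ((e : ℝ) / 2) := by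
  have ha := accuracy_nonneg e
  have hB : (1 : ℝ) ≤ 4 * accuracy e + 1 := by linarith
  have h1 : (N : ℝ) ^ e = ((N : ℝ) ^ 2) ^ ((e : ℝ) / 2) := by
    rw [← Real.rpow_natCast ((N : ℝ)) 2, ← Real.rpow_mul (Nat.cast_nonneg _), ← Real.rpow_natCast]
    congr 1
    push_cast; ring
  rw [h1]
  calc ((N : ℝ) ^ 2) ^ ((e : ℝ) / 2)
      ≤ ((4 * accuracy e + 1) * (1 / ε)) ^ ((e : ℝ) / 2) :=
        Real.rpow_le_rpow (by positivity) (h.sq_le hε hε1) (by positivity)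
    _ = (4 * accuracy e + 1) ^ ((e : ℝ) / 2) * (1 / ε) ^ ((e : ℝ) / 2) :=
        Real.mul_rpow (by positivity) (by positivity)
    _ ≤ (4 * accuracy e + 1) ^ (e : ℝ) * (1 / ε) ^ ((e : ℝ) / 2) := by
        refine mul_le_mul_of_nonneg_right (Real.rpow_le_rpow_of_exponent_le hB ?_) (by positivity)
        linarith [Nat.cast_nonneg (α := ℝ) e]
    _ = _ := by rw [Real.rpow_natCast]

theorem exists_computesExpKernel (e K : ℕ) : ∃ C : ℝ, ∀ {m : ℕ} {ε : ℝ} {p : Prog} {s : Store}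
    {w : Pt (e + 1) → ℝ}, 1 ≤ m → 0 < ε → ε ≤ 1 →
    (∀ N, IsResolution e ε N → Exec p s (K * (N ^ e * N ^ e * unitTime m)) (fun s' =>
      s'.outputSize ≤ countConst e * N ^ e ∧ IsExpKernel ε w (s'.output (e + 1)))) →
    ComputesExpKernel p s ε w (C * (1 / ε) ^ ((((e + 1 : ℕ) : ℝ) - 1) / 2))
      (C * ((1 / ε) ^ (e + 1 - 1) * (m * Real.log (m + 1)))) := by
  set B : ℝ := (4 * accuracy e + 1) ^ e with hB
  have hB0 : 0 ≤ B := by have := accuracy_nonneg e; positivity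
  refine ⟨B * (8 * K + countConst e), fun {m ε p s w} hm hε hε1 h => ?_⟩
  obtain ⟨N, hN⟩ := exists_isResolution e hε
  obtain ⟨t, s', hr, ht, hsz, hk⟩ := h N hN
  have hL : 0 ≤ m * Real.log (m + 1) :=
    mul_nonneg (Nat.cast_nonneg _) (Real.log_nonneg (by linarith [Nat.cast_nonneg (α := ℝ) m]))
  refine ⟨t, s', hr, ?_, ?_, hk⟩
  · have h1 : (t : ℝ) ≤ K * ((N : ℝ) ^ e * (N : ℝ) ^ e * unitTime m) := by exact_mod_cast ht
    have h2 : (N : ℝ) ^ e * (N : ℝ) ^ e ≤ B * (1 / ε) ^ e := by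
      rw [← mul_pow, ← sq, hB, ← mul_pow]
      exact pow_le_pow_left₀ (by positivity) (hN.sq_le hε hε1) e
    calc (t : ℝ) ≤ K * ((N : ℝ) ^ e * (N : ℝ) ^ e * unitTime m) := h1
      _ ≤ K * (B * (1 / ε) ^ e * (8 * (m * Real.log (m + 1)))) := by
          refine mul_le_mul_of_nonneg_left ?_ (Nat.cast_nonneg _)
          exact mul_le_mul h2 (unitTime_le hm) (Nat.cast_nonneg _) (by positivity)
      _ = B * (8 * K) * ((1 / ε) ^ e * (m * Real.log (m + 1))) := by ring
      _ ≤ B * (8 * K + countConst e) * ((1 / ε) ^ (e + 1 - 1) * (m * Real.log (m + 1))) := by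
          rw [Nat.add_sub_cancel]
          refine mul_le_mul_of_nonneg_right (mul_le_mul_of_nonneg_left ?_ hB0) (by positivity)
          linarith [Nat.cast_nonneg (α := ℝ) (countConst e)]
  · have h1 : (s'.outputSize : ℝ) ≤ countConst e * (N : ℝ) ^ e := by exact_mod_cast hsz
    have h2 : (((e + 1 : ℕ) : ℝ) - 1) / 2 = (e : ℝ) / 2 := by push_cast; ring
    rw [h2]
    calc (s'.outputSize : ℝ) ≤ countConst e * (N : ℝ) ^ e := h1
      _ ≤ countConst e * (B * (1 / ε) ^ ((e : ℝ) / 2)) :=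
          mul_le_mul_of_nonneg_left (hN.pow_le hε hε1) (Nat.cast_nonneg _)
      _ = B * countConst e * (1 / ε) ^ ((e : ℝ) / 2) := by ring
      _ ≤ _ := by
          refine mul_le_mul_of_nonneg_right (mul_le_mul_of_nonneg_left ?_ hB0) (by positivity)
          linarith [Nat.cast_nonneg (α := ℝ) K]

/-! ### The inputs of the two models -/

theorem pointCells_val {d k : ℕ} (pts : Fin k → Pt d) {i : ℕ} (hi : i < k) (j : Fin d) :
    pointCells pts (i * d + j) = extendPt pts i j := by
  have hd : 0 < d := (Nat.zero_le _).trans_lt j.2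
  have hlt : i * d + j < k * d := by
    calc i * d + j < i * d + d := by omega
      _ = (i + 1) * d := by ring
      _ ≤ k * d := Nat.mul_le_mul_right _ hi
  rw [pointCells, dif_pos hlt, extendPt, dif_pos hi]
  have h1 : Fin.divNat (⟨i * d + j, hlt⟩ : Fin (k * d)) = ⟨i, hi⟩ := by
    ext
    simp only [Fin.coe_divNat]
    rw [Nat.mul_comm, Nat.mul_add_div hd, Nat.div_eq_of_lt j.2, add_zero]
  have h2 : Fin.modNat (⟨i * d + j, hlt⟩ : Fin (k * d)) = j := by
    ext
    simp only [Fin.coe_modNat]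
    rw [Nat.mul_comm, Nat.mul_add_mod, Nat.mod_eq_of_lt j.2]
  rw [h1, h2]

theorem Locational.holdsInput {d n m : ℕ} (P : Locational d n m) (ε : ℝ) :
    HoldsInput P.model (P.input ε) where
  nv0 := by simp [input]
  loc i hi j := by simpa [input, model] using pointCells_val P.loc hi j
  prob i hi := by simp [input, model]
  owner i hi := by simp [input, model]

/-- In the existential model, every location is a point of its own. -/
def setOwners : Prog := forVar 10 (.var 0) (.setNatArr 0 (.var 10) (.var 10))

theorem Existential.exec_setOwners {d n : ℕ} (P : Existential d n) (ε : ℝ) :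
    Exec setOwners (P.input ε) (12 * unitTime n)
      (fun s' => HoldsInput P.model s' ∧ s'.realVar 0 = ε) := by
  refine (exec_forVar (T := 3) (n := n)
    (fun i s' => Frame [(0, 10), (2, 0)] (P.input ε) s' ∧ ∀ k < i, s'.natArr 0 k = k)
    ?_ ?_ ?_).mono ?_ ?_
  · exact ⟨frame_setNat (by simp) _ _, fun k hk => absurd hk (Nat.not_lt_zero _)⟩
  · rintro i s' ⟨hF, -⟩
    simp only [NExp.val]
    rw [hF.nv (by simp)]
    simp [input]
  · rintro i hi s' ⟨hF, hc⟩ h10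
    refine Exec.setNatArr ⟨by simpa using h10, (hF.trans (frame_setNatArr (by simp) _ _ _)).trans
        (frame_setNat (by simp) _ _), fun k hk => ?_⟩
    simp only [NExp.val, h10, Store.setNat_natArr, Store.setNatArr_natArr, if_true,
      Function.update_apply]
    split_ifs with h
    · exact h.symm
    · exact hc k (by omega)
  · simp only [NExp.cost]
    calc (n + 1) * (3 + 1 + 8) = 12 * ((n + 1) * 1) := by ring
      _ ≤ _ := Nat.mul_le_mul_left _ (Nat.mul_le_mul_left _ (by omega))
  · rintro s' ⟨hF, hc⟩
    refine ⟨⟨?_, fun i hi j => ?_, fun i hi => ?_, fun i hi => hc i hi⟩, ?_⟩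
    · rw [hF.nv (by simp)]; simp [input]
    · rw [hF.ra (by simp)]
      simpa [input, model] using pointCells_val P.loc hi j
    · rw [hF.ra (by simp)]; simp [input, model]
    · rw [hF.rv (by simp)]; simp [input]

theorem Existential.width_model {d n : ℕ} (P : Existential d n) :
    width P.model.H = P.expWidth := by
  funext u; exact (P.expWidth_eq u).symm

theorem Locational.width_model {d n m : ℕ} (P : Locational d n m) :
    width P.model.H = P.expWidth := by
  funext u; exact (P.expWidth_eq u).symm

theorem Existential.exists_exec (e : ℕ) : ∃ K : ℕ, ∀ {n N : ℕ} (P : Existential (e + 1) n) {ε : ℝ},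
    0 < ε → IsResolution e ε N →
    Exec (.seq setOwners (kernelProg e)) (P.input ε) (K * (N ^ e * N ^ e * unitTime n)) (fun s' =>
      s'.outputSize ≤ countConst e * N ^ e ∧ IsExpKernel ε P.expWidth (s'.output (e + 1))) := by
  obtain ⟨K, hK⟩ := exists_exec_kernelProg e
  refine ⟨12 + K, fun {n N} P ε hε hN => Exec.mono (Exec.seq ((P.exec_setOwners ε).mono le_rfl
    fun s' h => P.width_model ▸ hK P.model s' hε hN h.1 h.2)) ?_ fun _ h => h⟩
  have hP : 1 ≤ N ^ e * N ^ e := Nat.mul_pos (Nat.pow_pos hN.pos) (Nat.pow_pos hN.pos)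
  rw [add_mul]
  exact Nat.add_le_add_right (Nat.mul_le_mul_left _ (Nat.le_mul_of_pos_left _ hP)) _

end UncertainKernel

end


theorem mainTheorem2 (d : ℕ) (hd : 1 ≤ d) :
    (∃ (prog : UncertainKernel.Prog) (C : ℝ),
      ∀ (n : ℕ) (P : UncertainKernel.Existential d n) (ε : ℝ), 1 ≤ n → 0 < ε → ε ≤ 1 →
        UncertainKernel.ComputesExpKernel prog (P.input ε) ε P.expWidth
          (C * (1 / ε) ^ (((d : ℝ) - 1) / 2))
          (C * ((1 / ε) ^ (d - 1) * (n * Real.log (n + 1))))) ∧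
    (∃ (prog : UncertainKernel.Prog) (C : ℝ),
      ∀ (n m : ℕ) (P : UncertainKernel.Locational d n m) (ε : ℝ), 1 ≤ m → 0 < ε → ε ≤ 1 →
        UncertainKernel.ComputesExpKernel prog (P.input ε) ε P.expWidth
          (C * (1 / ε) ^ (((d : ℝ) - 1) / 2))
          (C * ((1 / ε) ^ (d - 1) * (m * Real.log (m + 1))))) := by
  obtain ⟨e, rfl⟩ : ∃ e, d = e + 1 := ⟨d - 1, by omega⟩
  constructor
  · obtain ⟨K, hK⟩ := UncertainKernel.Existential.exists_exec e
    obtain ⟨C, hC⟩ := UncertainKernel.exists_computesExpKernel e K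
    exact ⟨.seq UncertainKernel.setOwners (UncertainKernel.kernelProg e), C,
      fun n P ε hn hε hε1 => hC hn hε hε1 fun N hN => hK P hε hN⟩
  · obtain ⟨K, hK⟩ := UncertainKernel.exists_exec_kernelProg e
    obtain ⟨C, hC⟩ := UncertainKernel.exists_computesExpKernel e K
    refine ⟨UncertainKernel.kernelProg e, C, fun n m P ε hm hε hε1 => hC hm hε hε1 fun N hN => ?_⟩
    rw [← P.width_model]
    exact hK P.model (P.input ε) hε hN (P.holdsInput ε) (by
      simp [UncertainKernel.Locational.input])
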